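/- Let $\mathbb F$ be $\mathbb R$ or $\mathbb C$. A (unital) $\mathrm C^*$-category over $\mathbb F$ is a category enriched in $\mathbb F$-vector spaces, with an involutive antilinear contravariant endofunctor $a\mapsto a^*$ that is the identity on objects and with complete norms on the Hom spaces, such that $\|ba\|\le\|b\|\,\|a\|$ and $\|a^*a\|=\|a\|^2$, and such that for every arrow $a:x\to y$ the set $\{z\in\mathbb F\mid a^*a-z1_x\text{ is not invertible}\}$ is contained in $[0,\infty)$. A $*$-functor is an $\mathbb F$-linear, identity preserving functor that commutes with the involutions. Let $\mathsf C_1^*\mathsf{cat}$ be the category of small $\mathrm C^*$-categories and $*$-functors. For small $\mathrm C^*$-categories $A,B$, let $A\otimes_{\mathbb F}B$ be the $*$-category with objects $\operatorname{ob}A\times\operatorname{ob}B$, Hom spaces $A(x,x')\otimes_{\mathbb F}B(y,y')$ and involution $(a\otimes b)^*=a^*\otimes b^*$; the maximal tensor product $A\otimes_{\max}B$ is its universal enveloping $\mathrm C^*$-category, that is, it comes with a $*$-functor $A\otimes_{\mathbb F}B\to A\otimes_{\max}B$ through which every $*$-functor from $A\otimes_{\mathbb F}B$ to a $\mathrm C^*$-category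 factors uniquely. An arrow $u:x\to y$ is unitary if $u^*u=1_x$ and $uu^*=1_y$. A $*$-functor $F:A\to B$ is * a weak equivalence if it is a unitary equivalence: there are a $*$-functor $G:B\to A$ and natural isomorphisms $GF\simeq\mathrm{id}_A$ and $FG\simeq\mathrm{id}_B$ with unitary components; * a cofibration if it is injective on objects; * a fibration if for every object $x$ of $A$ and every unitary $v:Fx\to y$ in $B$ there is a unitary $u:x\to x'$ in $A$ with $Fu=v$ (so that $Fx'=y$). **Proposition 3.15.** With these three classes $\mathsf C_1^*\mathsf{cat}$ is a model category (complete and cocomplete, with functorial factorizations), the unitary model structure; and $\otimes_{\max}$, with unit $\mathbb F$ and with the functoriality, associativity, unit and symmetry isomorphisms given by the evident formulas on elementary tensors, is a closed symmetric monoidal structure on $\mathsf C_1^*\mathsf{cat}$. For any two $*$-functors $F:A\to B$ and $F':A'\to B'$ let $$F\Box F'\;:\;(B\otimes_{\max}A')\sqcup_{A\otimes_{\max}A'}(A\otimes_{\max}B')\longrightarrow B\otimes_{\max}B'$$ be the $*$-functor induced by $B\otimes_{\max}F'$ and $F\otimes_{\max}B'$ through the pushout property. 1. If $F$ and $F'$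 are cofibrations, then $F\Box F'$ is a cofibration. 2. If moreover $F$ or $F'$ is a weak equivalence, then $F\Box F'$ is a weak equivalence. Moreover the unit axiom holds: if $q:Q\to\mathbb F$ is a weak equivalence with $Q$ cofibrant and $X$ is a cofibrant object, then $q\otimes_{\max}X$ and $X\otimes_{\max}q$ are weak equivalences. Hence $\mathsf C_1^*\mathsf{cat}$ is a symmetric monoidal model category in the sense of Hovey. -/

import Mathlib

open CategoryTheory MonoidalCategory Limits HomotopicalAlgebra
open scoped TensorProduct

/-! Arrows `x ⟶ y` of a category are always read through `CategoryStruct.toQuiver`. -/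

attribute [-instance] CategoryTheory.catToReflQuiver

universe v v₁ v₂ v₃ u u₁ u₂ u₃

noncomputable section

/-! ### `*`-categories and `C*`-categories -/

/-- A `*`-category over `𝕜` is a category enriched in `𝕜`-vector spaces (`Preadditive` and
`Linear 𝕜`) with an involutive antilinear contravariant endofunctor that is the identity on
objects.  Compositions are in diagrammatic order: `f ≫ g` is the arrow usually written `g f`. -/
class StarCategory (𝕜 : Type) [RCLike 𝕜] (A : Type u) [Category.{v} A] [Preadditive A]
    [Linear 𝕜 A] where
  /-- the adjoint `a ↦ a*` -/
  adj : ∀ {x y : A}, (x ⟶ y) → (y ⟶ x)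
  adj_add : ∀ {x y : A} (a b : x ⟶ y), adj (a + b) = adj a + adj b
  adj_smul : ∀ {x y : A} (z : 𝕜) (a : x ⟶ y), adj (z • a) = (starRingEnd 𝕜 z) • adj a
  adj_comp : ∀ {x y w : A} (a : x ⟶ y) (b : y ⟶ w), adj (a ≫ b) = adj b ≫ adj a
  adj_adj : ∀ {x y : A} (a : x ⟶ y), adj (adj a) = a

/-- An endomorphism `h` of `x` is positive if its spectrum
`{z ∈ 𝕜 | h - z 1ₓ is not invertible}` is contained in `[0, ∞)`. -/
def IsPositiveEnd (𝕜 : Type) [RCLike 𝕜] {A : Type u} [Category.{v} A] [Preadditive A]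
    [Linear 𝕜 A] {x : A} (h : x ⟶ x) : Prop :=
  ∀ z : 𝕜, ¬ IsIso (h - z • 𝟙 x) → ∃ r : ℝ, 0 ≤ r ∧ z = (r : 𝕜)

/-- A (unital) `C*`-category over `𝕜`: a `*`-category with complete norms on its Hom spaces such
that composition is submultiplicative, the `C*`-identity `‖a* a‖ = ‖a‖ ^ 2` holds for every
arrow `a`, and every `a* a` is positive. -/
class CStarCategory (𝕜 : Type) [RCLike 𝕜] (A : Type u) [Category.{v} A] [Preadditive A]
    [Linear 𝕜 A] extends StarCategory 𝕜 A where
  homNorm : ∀ x y : A, Norm (x ⟶ y)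
  /-- the norm axioms on each Hom space -/
  core : ∀ x y : A, NormedSpace.Core 𝕜 (x ⟶ y)
  complete : ∀ x y : A,
    letI : NormedAddCommGroup (x ⟶ y) := NormedAddCommGroup.ofCore (core x y)
    CompleteSpace (x ⟶ y)
  norm_comp_le : ∀ {x y w : A} (a : x ⟶ y) (b : y ⟶ w), ‖a ≫ b‖ ≤ ‖b‖ * ‖a‖
  norm_comp_adj : ∀ {x y : A} (a : x ⟶ y), ‖a ≫ adj a‖ = ‖a‖ ^ 2
  positive : ∀ {x y : A} (a : x ⟶ y), IsPositiveEnd 𝕜 (a ≫ adj a)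

/-- An arrow `a` is unitary if `a* a = 1` and `a a* = 1`. -/
def IsUnitaryArrow (𝕜 : Type) [RCLike 𝕜] {A : Type u} [Category.{v} A] [Preadditive A]
    [Linear 𝕜 A] [StarCategory 𝕜 A] {x y : A} (a : x ⟶ y) : Prop :=
  a ≫ StarCategory.adj 𝕜 a = 𝟙 x ∧ StarCategory.adj 𝕜 a ≫ a = 𝟙 y

/-- A `*`-functor: a `𝕜`-linear (identity preserving) functor commuting with the involutions. -/
structure StarFunctor (𝕜 : Type) [RCLike 𝕜]
    (A : Type u₁) [Category.{v₁} A] [Preadditive A] [Linear 𝕜 A] [StarCategory 𝕜 A]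
    (B : Type u₂) [Category.{v₂} B] [Preadditive B] [Linear 𝕜 B] [StarCategory 𝕜 B]
    extends A ⥤ B where
  map_add : ∀ {x y : A} (a b : x ⟶ y),
    toFunctor.map (a + b) = toFunctor.map a + toFunctor.map b
  map_smul : ∀ {x y : A} (z : 𝕜) (a : x ⟶ y), toFunctor.map (z • a) = z • toFunctor.map a
  map_adj : ∀ {x y : A} (a : x ⟶ y),
    toFunctor.map (StarCategory.adj 𝕜 a) = StarCategory.adj 𝕜 (toFunctor.map a)

namespace StarFunctor

variable {𝕜 : Type} [RCLike 𝕜]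
  {A : Type u₁} [Category.{v₁} A] [Preadditive A] [Linear 𝕜 A] [StarCategory 𝕜 A]
  {B : Type u₂} [Category.{v₂} B] [Preadditive B] [Linear 𝕜 B] [StarCategory 𝕜 B]
  {C : Type u₃} [Category.{v₃} C] [Preadditive C] [Linear 𝕜 C] [StarCategory 𝕜 C]

/-- The identity `*`-functor. -/
def id (𝕜 : Type) [RCLike 𝕜] (A : Type u₁) [Category.{v₁} A] [Preadditive A] [Linear 𝕜 A]
    [StarCategory 𝕜 A] : StarFunctor 𝕜 A A where
  toFunctor := 𝟭 A
  map_add _ _ := rfl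
  map_smul _ _ := rfl
  map_adj _ := rfl

/-- Composition of `*`-functors: first `F`, then `G`. -/
def comp (F : StarFunctor 𝕜 A B) (G : StarFunctor 𝕜 B C) : StarFunctor 𝕜 A C where
  toFunctor := F.toFunctor ⋙ G.toFunctor
  map_add a b := by simp [F.map_add, G.map_add]
  map_smul z a := by simp [F.map_smul, G.map_smul]
  map_adj a := by simp [F.map_adj, G.map_adj]

/-- The action of a `*`-functor on arrows, an arrow being taken together with its source and
its target. -/
def onArrow (F : StarFunctor 𝕜 A B) (a : Arrow A) : Arrow B := Arrow.mk (F.map a.hom)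

/-- A unitary equivalence: a `*`-functor with a quasi-inverse `*`-functor, through natural
isomorphisms with unitary components. -/
def IsUnitaryEquivalence (F : StarFunctor 𝕜 A B) : Prop :=
  ∃ (G : StarFunctor 𝕜 B A) (s : F.toFunctor ⋙ G.toFunctor ≅ 𝟭 A)
    (t : G.toFunctor ⋙ F.toFunctor ≅ 𝟭 B),
    (∀ x : A, IsUnitaryArrow 𝕜 (s.hom.app x)) ∧ (∀ y : B, IsUnitaryArrow 𝕜 (t.hom.app y))

/-- The cofibrations of the unitary model structure: injective on objects. -/
def IsCofib (F : StarFunctor 𝕜 A B) : Prop := Function.Injective F.obj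

/-- The fibrations of the unitary model structure: every unitary `t : F x ⟶ y` is `F s` for some
unitary `s : x ⟶ x'` (in particular `F x' = y`). -/
def IsFib (F : StarFunctor 𝕜 A B) : Prop :=
  ∀ (x : A) (y : B) (t : F.obj x ⟶ y), IsUnitaryArrow 𝕜 t →
    ∃ (x' : A) (s : x ⟶ x') (h : F.obj x' = y),
      IsUnitaryArrow 𝕜 s ∧ F.map s ≫ eqToHom h = t

end StarFunctor

/-! ### The category of small `C*`-categories -/

/-- Small `C*`-categories over `𝕜` (small: objects and arrows are in `Type u`). -/
structure CStarCat (𝕜 : Type) [RCLike 𝕜] : Type (u + 1) where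
  carrier : Type u
  [category : Category.{u} carrier]
  [preadditive : Preadditive carrier]
  [linear : Linear 𝕜 carrier]
  [cstar : CStarCategory 𝕜 carrier]

namespace CStarCat

variable {𝕜 : Type} [RCLike 𝕜]

instance : CoeSort (CStarCat.{u} 𝕜) (Type u) := ⟨CStarCat.carrier⟩

attribute [instance] CStarCat.category CStarCat.preadditive CStarCat.linear CStarCat.cstar

/-- The category of small `C*`-categories and `*`-functors. -/
instance : Category.{u} (CStarCat.{u} 𝕜) where
  Hom A B := StarFunctor 𝕜 A B
  id A := StarFunctor.id 𝕜 A
  comp F G := F.comp G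

/-- The `*`-functor underlying a morphism. -/
abbrev Hom.toStar {A B : CStarCat.{u} 𝕜} (F : A ⟶ B) : StarFunctor 𝕜 A B := F

/-- The class `Weq` of unitary equivalences. -/
def unitaryEquivalences (𝕜 : Type) [RCLike 𝕜] : MorphismProperty (CStarCat.{u} 𝕜) :=
  fun _ _ F => (Hom.toStar F).IsUnitaryEquivalence

/-- The class `Cof`. -/
def unitaryCofibrations (𝕜 : Type) [RCLike 𝕜] : MorphismProperty (CStarCat.{u} 𝕜) :=
  fun _ _ F => (Hom.toStar F).IsCofib

/-- The class `Fib`. -/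
def unitaryFibrations (𝕜 : Type) [RCLike 𝕜] : MorphismProperty (CStarCat.{u} 𝕜) :=
  fun _ _ F => (Hom.toStar F).IsFib

end CStarCat

/-! ### The base field as a `C*`-category -/

/-- The single object of the base field, seen as a category. -/
inductive BaseFieldObj (𝕜 : Type) : Type u
  | pt

namespace BaseFieldObj

variable (𝕜 : Type) [RCLike 𝕜]

instance : Category.{u} (BaseFieldObj.{u} 𝕜) where
  Hom _ _ := ULift.{u} 𝕜
  id _ := ⟨1⟩
  comp f g := ⟨g.down * f.down⟩
  id_comp f := by ext; simp
  comp_id f := by ext; simp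
  assoc f g h := by ext; simp [mul_assoc]

/-- The endomorphism of the single object given by a scalar. -/
def arrow (z : 𝕜) : (pt : BaseFieldObj.{u} 𝕜) ⟶ pt := ULift.up z

instance : Preadditive (BaseFieldObj.{u} 𝕜) where
  homGroup _ _ := inferInstanceAs (AddCommGroup (ULift.{u} 𝕜))
  add_comp _ _ _ f f' g := ULift.ext _ _ (mul_add g.down f.down f'.down)
  comp_add _ _ _ f g g' := ULift.ext _ _ (add_mul g.down g'.down f.down)

instance : Linear 𝕜 (BaseFieldObj.{u} 𝕜) where
  homModule _ _ := inferInstanceAs (Module 𝕜 (ULift.{u} 𝕜))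
  smul_comp _ _ _ r f g := ULift.ext _ _ (mul_smul_comm r g.down f.down)
  comp_smul _ _ _ f r g := ULift.ext _ _ (smul_mul_assoc r g.down f.down)

theorem isIso_of_ne_zero {x : BaseFieldObj.{u} 𝕜} (f : x ⟶ x)
    (hf : (show ULift.{u} 𝕜 from f).down ≠ 0) : IsIso f :=
  ⟨⟨ULift.up ((show ULift.{u} 𝕜 from f).down)⁻¹,
    ULift.ext _ _ (inv_mul_cancel₀ hf), ULift.ext _ _ (mul_inv_cancel₀ hf)⟩⟩

instance (x y : BaseFieldObj.{u} 𝕜) : Norm (x ⟶ y) := inferInstanceAs (Norm (ULift.{u} 𝕜))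

theorem core (x y : BaseFieldObj.{u} 𝕜) : NormedSpace.Core 𝕜 (x ⟶ y) where
  norm_nonneg f := norm_nonneg (ULift.down f)
  norm_smul c f := norm_smul c (ULift.down f)
  norm_triangle f g := norm_add_le (ULift.down f) (ULift.down g)
  norm_eq_zero_iff f := (norm_eq_zero (a := ULift.down f)).trans
    ⟨fun h => ULift.ext _ _ h, fun h => congrArg ULift.down h⟩

instance : CStarCategory 𝕜 (BaseFieldObj.{u} 𝕜) where
  adj f := ULift.up (starRingEnd 𝕜 (ULift.down f))
  adj_add f g := ULift.ext _ _ (map_add (starRingEnd 𝕜) (ULift.down f) (ULift.down g))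
  adj_smul z f := ULift.ext _ _ (map_mul (starRingEnd 𝕜) z (ULift.down f))
  adj_comp f g := ULift.ext _ _ ((map_mul (starRingEnd 𝕜) (ULift.down g) (ULift.down f)).trans
    (mul_comm _ _))
  adj_adj f := ULift.ext _ _ (RCLike.conj_conj (ULift.down f))
  homNorm _ _ := inferInstance
  core := core 𝕜
  complete x y := by
    let _ : NormedAddCommGroup (x ⟶ y) := NormedAddCommGroup.ofCore (core 𝕜 x y)
    let e : (x ⟶ y) ≃ 𝕜 := ⟨ULift.down, ULift.up, fun _ => rfl, fun _ => rfl⟩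
    have he : Isometry e := Isometry.of_dist_eq fun a b => by
      rw [dist_eq_norm, dist_eq_norm]; rfl
    exact (completeSpace_congr he.isUniformEmbedding).2 inferInstance
  norm_comp_le f g := norm_mul_le (ULift.down g) (ULift.down f)
  norm_comp_adj f := by
    change ‖starRingEnd 𝕜 (ULift.down f) * ULift.down f‖ = ‖ULift.down f‖ ^ 2
    rw [norm_mul, RCLike.norm_conj, sq]
  positive f z hz := by
    refine ⟨‖ULift.down f‖ ^ 2, by positivity, ?_⟩
    by_contra hne
    refine hz (isIso_of_ne_zero 𝕜 _ ?_)
    change starRingEnd 𝕜 (ULift.down f) * ULift.down f - z * 1 ≠ 0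
    rw [mul_one, RCLike.conj_mul, sub_ne_zero]
    exact fun h => hne (by rw [← h]; push_cast; rfl)

end BaseFieldObj

/-- The base field as a `C*`-category with one object. -/
def CStarCat.baseField (𝕜 : Type) [RCLike 𝕜] : CStarCat.{u} 𝕜 where
  carrier := BaseFieldObj.{u} 𝕜

/-! ### The algebraic tensor product of `*`-categories -/

/-- The objects of the algebraic tensor product of two `*`-categories: pairs of objects. -/
structure AlgTensor (𝕜 : Type) (A : Type u₁) (B : Type u₂) : Type (max u₁ u₂) where
  fst : A
  snd : B

namespace AlgTensor

variable (𝕜 : Type) [RCLike 𝕜]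
  (A : Type u₁) [Category.{v₁} A] [Preadditive A] [Linear 𝕜 A]
  (B : Type u₂) [Category.{v₂} B] [Preadditive B] [Linear 𝕜 B]

/-- The Hom space from `(x, y)` to `(x', y')` is `A(x, x') ⊗ B(y, y')`, and composition is
determined by `(a ⊗ b) ≫ (a' ⊗ b') = (a ≫ a') ⊗ (b ≫ b')`. -/
instance : Category.{max v₁ v₂} (AlgTensor 𝕜 A B) where
  Hom p q := (p.fst ⟶ q.fst) ⊗[𝕜] (p.snd ⟶ q.snd)
  id p := 𝟙 p.fst ⊗ₜ[𝕜] 𝟙 p.snd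
  comp {p q r} f g :=
    TensorProduct.map₂ (Linear.comp (S := 𝕜) p.fst q.fst r.fst)
      (Linear.comp (S := 𝕜) p.snd q.snd r.snd) f g
  id_comp {p q} f := by
    induction f using TensorProduct.induction_on with
    | zero => simp
    | tmul a b => simp
    | add f g hf hg => rw [map_add, hf, hg]
  comp_id {p q} f := by
    induction f using TensorProduct.induction_on with
    | zero => simp
    | tmul a b => simp
    | add f g hf hg => rw [map_add, LinearMap.add_apply, hf, hg]
  assoc {p q r s} f g h := by
    induction f using TensorProduct.induction_on with
    | zero => simp
    | add f f' hf hf' => simp only [map_add, LinearMap.add_apply, hf, hf']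
    | tmul a b =>
      induction g using TensorProduct.induction_on with
      | zero => simp
      | add g g' hg hg' => simp only [map_add, LinearMap.add_apply, hg, hg']
      | tmul a' b' =>
        induction h using TensorProduct.induction_on with
        | zero => simp
        | add h h' hh hh' => simp only [map_add, hh, hh']
        | tmul a'' b'' => simp

instance : Preadditive (AlgTensor 𝕜 A B) where
  homGroup p q := inferInstanceAs (AddCommGroup ((p.fst ⟶ q.fst) ⊗[𝕜] (p.snd ⟶ q.snd)))
  add_comp p q r f f' g :=
    LinearMap.map_add₂ (TensorProduct.map₂ (Linear.comp (S := 𝕜) p.fst q.fst r.fst)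
      (Linear.comp (S := 𝕜) p.snd q.snd r.snd)) f f' g
  comp_add p q r f g g' :=
    (TensorProduct.map₂ (Linear.comp (S := 𝕜) p.fst q.fst r.fst)
      (Linear.comp (S := 𝕜) p.snd q.snd r.snd) f).map_add g g'

instance : Linear 𝕜 (AlgTensor 𝕜 A B) where
  homModule p q := inferInstanceAs (Module 𝕜 ((p.fst ⟶ q.fst) ⊗[𝕜] (p.snd ⟶ q.snd)))
  smul_comp p q r z f g :=
    LinearMap.map_smul₂ (TensorProduct.map₂ (Linear.comp (S := 𝕜) p.fst q.fst r.fst)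
      (Linear.comp (S := 𝕜) p.snd q.snd r.snd)) z f g
  comp_smul p q r f z g :=
    (TensorProduct.map₂ (Linear.comp (S := 𝕜) p.fst q.fst r.fst)
      (Linear.comp (S := 𝕜) p.snd q.snd r.snd) f).map_smul z g

variable {𝕜 A B}

/-- The elementary tensor `a ⊗ b`, an arrow from `(x, y)` to `(x', y')`. -/
def tmul {x x' : A} {y y' : B} (a : x ⟶ x') (b : y ⟶ y') :
    (⟨x, y⟩ : AlgTensor 𝕜 A B) ⟶ ⟨x', y'⟩ :=
  a ⊗ₜ[𝕜] b

/-- The adjoint of a `*`-category as an antilinear map. -/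
def adjMap (𝕜 : Type) [RCLike 𝕜] {A : Type u₁} [Category.{v₁} A] [Preadditive A] [Linear 𝕜 A]
    [StarCategory 𝕜 A] (x y : A) : (x ⟶ y) →ₛₗ[starRingEnd 𝕜] (y ⟶ x) where
  toFun := StarCategory.adj 𝕜
  map_add' := StarCategory.adj_add
  map_smul' := StarCategory.adj_smul

/-- The involution of the algebraic tensor product: `(a ⊗ b)* = a* ⊗ b*`. -/
instance [StarCategory 𝕜 A] [StarCategory 𝕜 B] : StarCategory 𝕜 (AlgTensor 𝕜 A B) where
  adj {p q} f := TensorProduct.map (adjMap 𝕜 p.fst q.fst) (adjMap 𝕜 p.snd q.snd) f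
  adj_add {p q} f g :=
    (TensorProduct.map (adjMap 𝕜 p.fst q.fst) (adjMap 𝕜 p.snd q.snd)).map_add f g
  adj_smul {p q} z f :=
    (TensorProduct.map (adjMap 𝕜 p.fst q.fst) (adjMap 𝕜 p.snd q.snd)).map_smulₛₗ z f
  adj_comp {p q r} f g := by
    change TensorProduct.map (adjMap 𝕜 p.fst r.fst) (adjMap 𝕜 p.snd r.snd)
        (TensorProduct.map₂ (Linear.comp (S := 𝕜) p.fst q.fst r.fst)
          (Linear.comp (S := 𝕜) p.snd q.snd r.snd) f g) =
      TensorProduct.map₂ (Linear.comp (S := 𝕜) r.fst q.fst p.fst)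
        (Linear.comp (S := 𝕜) r.snd q.snd p.snd)
        (TensorProduct.map (adjMap 𝕜 q.fst r.fst) (adjMap 𝕜 q.snd r.snd) g)
        (TensorProduct.map (adjMap 𝕜 p.fst q.fst) (adjMap 𝕜 p.snd q.snd) f)
    induction f using TensorProduct.induction_on with
    | zero => simp
    | add f f' hf hf' => simp only [map_add, LinearMap.add_apply, hf, hf']
    | tmul a b =>
      induction g using TensorProduct.induction_on with
      | zero => simp
      | add g g' hg hg' => simp only [map_add, LinearMap.add_apply, hg, hg']
      | tmul a' b' => simp [adjMap, StarCategory.adj_comp]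
  adj_adj {p q} f := by
    change TensorProduct.map (adjMap 𝕜 q.fst p.fst) (adjMap 𝕜 q.snd p.snd)
      (TensorProduct.map (adjMap 𝕜 p.fst q.fst) (adjMap 𝕜 p.snd q.snd) f) = f
    induction f using TensorProduct.induction_on with
    | zero => simp
    | add f f' hf hf' => simp only [map_add, hf, hf']
    | tmul a b => simp [adjMap, StarCategory.adj_adj]

end AlgTensor

/-! ### The maximal tensor product -/

/-- `ρ : S → U` exhibits the small `C*`-category `U` as the universal enveloping `C*`-category of
the `*`-category `S`: every `*`-functor from `S` to a `C*`-category factors uniquely through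
`ρ`. -/
def IsEnveloping {𝕜 : Type} [RCLike 𝕜] {S : Type u} [Category.{u} S] [Preadditive S] [Linear 𝕜 S]
    [StarCategory 𝕜 S] {U : CStarCat.{u} 𝕜} (ρ : StarFunctor 𝕜 S U) : Prop :=
  ∀ (C : CStarCat.{u} 𝕜) (σ : StarFunctor 𝕜 S C), ∃! τ : StarFunctor 𝕜 U C, ρ.comp τ = σ

/-- The image in `T` of the elementary tensor `a ⊗ b` under a `*`-functor `can` from the algebraic
tensor product of `A` and `B` to `T`. -/
def elemTensor {𝕜 : Type} [RCLike 𝕜] {A B T : CStarCat.{u} 𝕜}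
    (can : StarFunctor 𝕜 (AlgTensor 𝕜 A B) T) (a : Arrow A) (b : Arrow B) : Arrow T :=
  Arrow.mk (can.map (AlgTensor.tmul a.hom b.hom))

/-- The data expressing that a given symmetric monoidal structure on the category of small
`C*`-categories is the one of the maximal tensor product: `A ⊗ B` is the universal enveloping
`C*`-category of the algebraic tensor product of `A` and `B`, the unit is the base field, and the
functoriality and the structure isomorphisms are the evident ones on elementary tensors.
(An identity between elements of some `Arrow T` includes the identities between the sources
and between the targets.) -/
structure MaxTensorStructure (𝕜 : Type) [RCLike 𝕜] [MonoidalCategory (CStarCat.{u} 𝕜)]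
    [SymmetricCategory (CStarCat.{u} 𝕜)] where
  /-- the canonical `*`-functor from the algebraic tensor product -/
  can : ∀ A B : CStarCat.{u} 𝕜, StarFunctor 𝕜 (AlgTensor 𝕜 A B) (A ⊗ B : CStarCat.{u} 𝕜)
  isEnveloping : ∀ A B : CStarCat.{u} 𝕜, IsEnveloping (can A B)
  /-- the identification of the unit with the base field -/
  unitIso : 𝟙_ (CStarCat.{u} 𝕜) ≅ CStarCat.baseField 𝕜
  tensorHom_elem : ∀ {A A' B B' : CStarCat.{u} 𝕜} (F : A ⟶ A') (G : B ⟶ B')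
    (a : Arrow A) (b : Arrow B),
    StarFunctor.onArrow (F ⊗ₘ G) (elemTensor (can A B) a b) =
      elemTensor (can A' B') (StarFunctor.onArrow F a) (StarFunctor.onArrow G b)
  associator_elem : ∀ {A B C : CStarCat.{u} 𝕜} (a : Arrow A) (b : Arrow B) (c : Arrow C),
    StarFunctor.onArrow (α_ A B C).hom
        (elemTensor (can (A ⊗ B) C) (elemTensor (can A B) a b) c) =
      elemTensor (can A (B ⊗ C)) a (elemTensor (can B C) b c)
  leftUnitor_elem : ∀ {A : CStarCat.{u} 𝕜} (z : 𝕜) (a : Arrow A),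
    StarFunctor.onArrow (λ_ A).hom (elemTensor (can (𝟙_ (CStarCat.{u} 𝕜)) A)
        (StarFunctor.onArrow unitIso.inv (Arrow.mk (BaseFieldObj.arrow 𝕜 z))) a) =
      Arrow.mk (z • a.hom)
  rightUnitor_elem : ∀ {A : CStarCat.{u} 𝕜} (z : 𝕜) (a : Arrow A),
    StarFunctor.onArrow (ρ_ A).hom (elemTensor (can A (𝟙_ (CStarCat.{u} 𝕜))) a
        (StarFunctor.onArrow unitIso.inv (Arrow.mk (BaseFieldObj.arrow 𝕜 z)))) =
      Arrow.mk (z • a.hom)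
  braiding_elem : ∀ {A B : CStarCat.{u} 𝕜} (a : Arrow A) (b : Arrow B),
    StarFunctor.onArrow (β_ A B).hom (elemTensor (can A B) a b) = elemTensor (can B A) b a

/-! ### Symmetric monoidal model categories -/

/-- The pushout-product axiom: for cofibrations `F : A ⟶ B` and `F' : A' ⟶ B'`, the morphism
`F □ F' : (B ⊗ A') ⊔_{A ⊗ A'} (A ⊗ B') ⟶ B ⊗ B'` (that is `sq.ι`, for any choice `sq` of the
pushout) is a cofibration, and it is a weak equivalence if `F` or `F'` is one. -/
def PushoutProductAxiom {C : Type u} [Category.{v} C] [MonoidalCategory C]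
    (Cof Weq : MorphismProperty C) : Prop :=
  ∀ {A B A' B' : C} (F : A ⟶ B) (F' : A' ⟶ B') (sq : (curriedTensor C).PushoutObjObj F F'),
    Cof F → Cof F' → Cof sq.ι ∧ ((Weq F ∨ Weq F') → Weq sq.ι)

/-- A closed symmetric monoidal category with a model structure is a symmetric monoidal model
category (in the sense of Hovey, so that a model category is complete and cocomplete and has
functorial factorizations) if the pushout-product axiom and the unit axiom hold. -/
structure IsSymmetricMonoidalModelCategory (C : Type u) [Category.{v} C] [MonoidalCategory C]
    [SymmetricCategory C] [ModelCategory C] : Prop where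
  hasLimits : HasLimits C
  hasColimits : HasColimits C
  factorization₁ :
    MorphismProperty.HasFunctorialFactorization (trivialCofibrations C) (fibrations C)
  factorization₂ :
    MorphismProperty.HasFunctorialFactorization (cofibrations C) (trivialFibrations C)
  closed : Nonempty (MonoidalClosed C)
  pushoutProduct : PushoutProductAxiom (cofibrations C) (weakEquivalences C)
  /-- tensoring a cofibrant replacement of the unit with a cofibrant object gives a weak
  equivalence -/
  unit : ∀ {Q : C} (q : Q ⟶ 𝟙_ C) (X : C), IsCofibrant Q → WeakEquivalence q → IsCofibrant X →
    WeakEquivalence (q ▷ X) ∧ WeakEquivalence (X ◁ q)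

end

/-! The analytic input is a single estimate. If h is a self-adjoint endomorphism, positivity of (h -
s)*(h - s) makes (h - s)² + t² invertible for t ≠ 0. So the complex spectrum of h is real, even when
the base field is ℝ, and the C*-identity together with Gelfand's formula produces a spectral value
of modulus at least ‖h‖ (`exists_norm_le_abs_not_isUnit_sub`, `exists_norm_le_abs_not_isIso`). Two
consequences carry the rest. One is that *-functors are contractive (`norm_map_le`). The other is
that, in the presence of the remaining axioms, positivity of every a*a amounts to ‖‖a‖² - a*a‖ ≤
‖a‖² (`CStarCategory.ofNorm`, `CStarCat.norm_smul_id_sub_le`). This condition survives suprema, so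
suitable closed spaces of bounded families of arrows form C*-categories (`FamilyData.toCStarCat`).

That construction yields limits (bounded compatible families) and internal Homs (bounded natural
transformations). It also yields a universal C*-category for every class of representations bounded
on each arrow, as the closure of the image in a product of sufficiently many representations
(`RepClass.univ`). Contractivity supplies the bounds. Colimits are universal for the representations
of a free *-category that come from cocones, and the maximal tensor product is universal for all
representations of the algebraic one. A morphism out of the tensor product is a *-functor of two
variables (`Bimap`) and is determined by its restrictions to the slices in each variable
(`tens_hom_ext`); coherence and closedness follow from this.

Weak equivalences are the morphisms that become invertible modulo unitary isomorphism; equivalently,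
the fully faithful *-functors that reach every object up to a unitary. Lifts are therefore chosen on
objects and corrected by conjugation with unitaries (`conj`). Both factorizations pull Hom spaces
back along a map of object sets: a mapping cylinder and a mapping path category.

For the pushout-product, injectivity concerns objects only, and a pushout has no objects beyond
those of its two legs. Tensoring preserves unitary isomorphisms, hence all weak equivalences. The
statement on weak equivalences then follows from cobase change of trivial cofibrations and
two-out-of-three, and the unit axiom is immediate. -/

noncomputable section

/-! ### Real spectra of self-adjoint elements of real Banach algebras -/

/-- The real-linear maps from `ℂ` to a real Banach space `E`: a model of the complexification
of `E`, on which `ℂ` acts by precomposition. -/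
def Complexified (E : Type u) [NormedAddCommGroup E] [NormedSpace ℝ E] : Type u := ℂ →L[ℝ] E

namespace Complexified

variable {E : Type u} [NormedAddCommGroup E] [NormedSpace ℝ E]

instance : NormedAddCommGroup (Complexified E) := inferInstanceAs (NormedAddCommGroup (ℂ →L[ℝ] E))

instance [CompleteSpace E] : CompleteSpace (Complexified E) :=
  inferInstanceAs (CompleteSpace (ℂ →L[ℝ] E))

/-- An element of the complexification as a real-linear map. -/
def toMap (f : Complexified E) : ℂ →L[ℝ] E := f

@[ext]
theorem ext {f g : Complexified E} (h : ∀ w, f.toMap w = g.toMap w) : f = g :=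
  ContinuousLinearMap.ext h

instance : SMul ℂ (Complexified E) where
  smul z f := f.toMap.comp (ContinuousLinearMap.mul ℝ ℂ z)

theorem toMap_smul (z : ℂ) (f : Complexified E) (w : ℂ) :
    (z • f).toMap w = f.toMap (z * w) := rfl

theorem toMap_add (f g : Complexified E) (w : ℂ) :
    (f + g).toMap w = f.toMap w + g.toMap w := rfl

instance : Module ℂ (Complexified E) where
  one_smul f := by ext w; simp [toMap_smul]
  mul_smul y z f := by ext w; simp [toMap_smul, mul_comm, mul_left_comm]
  smul_zero z := by ext w; rfl
  zero_smul f := by ext w; rw [toMap_smul, zero_mul, map_zero]; rfl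
  smul_add z f g := by ext w; simp [toMap_smul, toMap_add]
  add_smul y z f := by ext w; simp [toMap_smul, toMap_add, add_mul]

instance : NormedSpace ℂ (Complexified E) where
  norm_smul_le z f := by
    refine ContinuousLinearMap.opNorm_le_bound _ (by positivity) fun w => ?_
    refine (f.toMap.le_opNorm (z * w)).trans (le_of_eq ?_)
    rw [norm_mul]
    change ‖f‖ * _ = _
    ring

/-- Left multiplication by an element of a real Banach algebra on its complexification. -/
def mulLeft {R : Type u} [NormedRing R] [NormedAlgebra ℝ R] (a : R) :
    Complexified R →L[ℂ] Complexified R :=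
  LinearMap.mkContinuous
    { toFun := fun f => (ContinuousLinearMap.mul ℝ R a).comp f.toMap
      map_add' := fun f g => by ext w; exact mul_add a (f.toMap w) (g.toMap w)
      map_smul' := fun z f => rfl } ‖a‖ fun f => by
    refine ContinuousLinearMap.opNorm_le_bound _ (by positivity) fun w => ?_
    refine (norm_mul_le a (f.toMap w)).trans ?_
    rw [mul_assoc]
    exact mul_le_mul_of_nonneg_left (f.toMap.le_opNorm w) (norm_nonneg a)

theorem toMap_mulLeft {R : Type u} [NormedRing R] [NormedAlgebra ℝ R] (a : R)
    (f : Complexified R) (w : ℂ) : (mulLeft a f).toMap w = a * f.toMap w := rfl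

/-- `mulLeft` as a ring homomorphism. -/
def mulLeftHom (R : Type u) [NormedRing R] [NormedAlgebra ℝ R] :
    R →+* (Complexified R →L[ℂ] Complexified R) where
  toFun := mulLeft
  map_one' := by ext f w; simp [toMap_mulLeft]
  map_mul' a b := by ext f w; simp [toMap_mulLeft, mul_assoc]
  map_zero' := by ext f w; rw [toMap_mulLeft, zero_mul]; rfl
  map_add' a b := by ext f w; rw [toMap_mulLeft, add_mul]; rfl

theorem mulLeftHom_algebraMap {R : Type u} [NormedRing R] [NormedAlgebra ℝ R] (s : ℝ) :
    mulLeftHom R (algebraMap ℝ R s) = algebraMap ℂ _ (s : ℂ) := by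
  ext f w
  change algebraMap ℝ R s * f.toMap w = f.toMap ((s : ℂ) * w)
  rw [← Complex.real_smul, map_smul, Algebra.smul_def]

/-- The element of the complexification of an algebra representing its unit. -/
def unit (R : Type u) [NormedRing R] [NormedAlgebra ℝ R] : Complexified R :=
  (ContinuousLinearMap.toSpanSingleton ℝ (1 : R)).comp Complex.reCLM

/-- Applying left multiplication by `a` to the unit and evaluating at 1 recovers `a`. The left
regular representation on the complexification is thus bounded below, so norms of powers of `a` can
be compared with norms of powers of a complex operator. -/
theorem norm_le_mulLeftHom {R : Type u} [NormedRing R] [NormedAlgebra ℝ R] (a : R) :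
    ‖a‖ ≤ ‖unit R‖ * ‖mulLeftHom R a‖ := by
  have h1 : (mulLeftHom R a (unit R)).toMap 1 = a := by
    change a * ((Complex.re 1) • (1 : R)) = a
    simp
  calc ‖a‖ = ‖(mulLeftHom R a (unit R)).toMap 1‖ := by rw [h1]
    _ ≤ ‖mulLeftHom R a (unit R)‖ * ‖(1 : ℂ)‖ := (mulLeftHom R a (unit R)).toMap.le_opNorm 1
    _ = ‖mulLeftHom R a (unit R)‖ := by simp
    _ ≤ ‖mulLeftHom R a‖ * ‖unit R‖ := (mulLeftHom R a).le_opNorm _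
    _ = _ := mul_comm _ _

end Complexified

/-- In a real Banach algebra, let `k` be an element such that `‖k ^ 2 ^ n‖ = ‖k‖ ^ 2 ^ n`
and whose complex spectrum is real.  Then the norm of `k` is attained on the spectrum. -/
theorem exists_norm_le_abs_not_isUnit_sub {R : Type u} [NormedRing R] [NormedAlgebra ℝ R]
    [CompleteSpace R] (k : R) (hk : k ≠ 0) (hpow : ∀ n : ℕ, ‖k ^ (2 ^ n)‖ = ‖k‖ ^ (2 ^ n))
    (hreal : ∀ s t : ℝ, t ≠ 0 →
      IsUnit ((k - algebraMap ℝ R s) ^ 2 + algebraMap ℝ R (t ^ 2))) :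
    ∃ s : ℝ, ‖k‖ ≤ |s| ∧ ¬ IsUnit (k - algebraMap ℝ R s) := by
  set L := Complexified.mulLeftHom R with hL
  have hknorm : 0 < ‖k‖ := norm_pos_iff.2 hk
  have hunit : 0 < ‖Complexified.unit R‖ := by
    by_contra h
    have h0 : ‖Complexified.unit R‖ = 0 := le_antisymm (not_lt.1 h) (norm_nonneg _)
    have := Complexified.norm_le_mulLeftHom k
    rw [h0, zero_mul] at this
    exact absurd this (not_le.2 hknorm)
  have hLk : L k ≠ 0 := by
    intro h
    have := Complexified.norm_le_mulLeftHom k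
    rw [← hL, h, norm_zero, mul_zero] at this
    exact absurd this (not_le.2 hknorm)
  have hnt : Nontrivial (Complexified R →L[ℂ] Complexified R) := ⟨⟨L k, 0, hLk⟩⟩
  -- A point of the complex spectrum whose modulus is the spectral radius; it is shown below to be
  -- real and of modulus at least `‖k‖`.
  obtain ⟨z, hz, hzr⟩ := spectrum.exists_nnnorm_eq_spectralRadius (L k)
  have hzim : z.im = 0 := by
    by_contra him
    refine hz ?_
    -- For z = s + it, the element (k - s)² + t² factors as (z - k)(z̄ - k). The two factors
    -- commute, so invertibility of the product gives that of z - k.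
    have hu := (hreal z.re z.im him).map L
    have e1 : L ((k - algebraMap ℝ R z.re) ^ 2 + algebraMap ℝ R (z.im ^ 2)) =
        (algebraMap ℂ _ z - L k) * (algebraMap ℂ _ (starRingEnd ℂ z) - L k) := by
      rw [map_add, map_pow, map_sub, hL, Complexified.mulLeftHom_algebraMap,
        Complexified.mulLeftHom_algebraMap, ← hL]
      have hc : ∀ w : ℂ, L k * algebraMap ℂ _ w = algebraMap ℂ _ w * L k :=
        fun w => (Algebra.commutes w (L k)).symm
      have e2 : (algebraMap ℂ (Complexified R →L[ℂ] Complexified R)) (starRingEnd ℂ z) =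
          2 • algebraMap ℂ _ (z.re : ℂ) - algebraMap ℂ _ z := by
        rw [two_nsmul, ← map_add, ← map_sub]
        congr 1
        rw [eq_sub_iff_add_eq, add_comm, Complex.add_conj]
        push_cast
        ring
      have e3 : (algebraMap ℂ (Complexified R →L[ℂ] Complexified R)) ((z.im ^ 2 : ℝ) : ℂ) =
          algebraMap ℂ _ (z * starRingEnd ℂ z) - algebraMap ℂ _ (z.re : ℂ) ^ 2 := by
        rw [← map_pow, ← map_sub]
        congr 1
        rw [Complex.mul_conj, Complex.normSq_apply]
        push_cast
        ring
      rw [e3, map_mul, e2]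
      simp only [sq, mul_sub, sub_mul, hc, two_nsmul, mul_add]
      abel
    rw [e1] at hu
    have hcomm : Commute (algebraMap ℂ _ z - L k) (algebraMap ℂ _ (starRingEnd ℂ z) - L k) :=
      ((Algebra.commute_algebraMap_left z _).sub_left
        (((Algebra.commute_algebraMap_right _ (L k)).sub_right (Commute.refl _))))
    exact (hcomm.isUnit_mul_iff.1 hu).1
  have hzre : z = (z.re : ℂ) := by
    apply Complex.ext <;> simp [hzim]
  refine ⟨z.re, ?_, fun hu => hz ?_⟩
  -- Gelfand's formula along the exponents 2 ^ n, for which `hpow` gives the norms of the powers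
  -- exactly. The comparison constant `‖unit R‖⁻¹` enters through its 2 ^ n-th root, which tends to
  -- 1.
  · have hlim := spectrum.pow_norm_pow_one_div_tendsto_nhds_spectralRadius (L k)
    have hsub : Filter.Tendsto (fun n : ℕ => 2 ^ n) Filter.atTop Filter.atTop :=
      tendsto_pow_atTop_atTop_of_one_lt one_lt_two
    have hlim2 := hlim.comp hsub
    have hlow : Filter.Tendsto (fun n : ℕ => ENNReal.ofReal
        (‖k‖ * (‖Complexified.unit R‖⁻¹) ^ (1 / ((2 ^ n : ℕ) : ℝ)))) Filter.atTop
        (nhds (ENNReal.ofReal ‖k‖)) := by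
      refine ENNReal.tendsto_ofReal ?_
      have : Filter.Tendsto (fun n : ℕ => 1 / ((2 ^ n : ℕ) : ℝ)) Filter.atTop (nhds 0) :=
        (tendsto_one_div_atTop_nhds_zero_nat (𝕜 := ℝ)).comp hsub
      have h2 := (Real.continuous_const_rpow (a := ‖Complexified.unit R‖⁻¹)
        (inv_ne_zero hunit.ne')).tendsto 0 |>.comp this
      simpa using h2.const_mul ‖k‖
    have hle := le_of_tendsto_of_tendsto' hlow hlim2 fun n => by
      refine ENNReal.ofReal_le_ofReal ?_
      have hn : ‖k‖ ^ (2 ^ n) * ‖Complexified.unit R‖⁻¹ ≤ ‖L k ^ (2 ^ n)‖ := by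
        rw [← hpow, ← div_eq_mul_inv, div_le_iff₀ hunit, mul_comm, ← map_pow]
        exact Complexified.norm_le_mulLeftHom _
      have hne : ((2 ^ n : ℕ) : ℝ) ≠ 0 := by positivity
      calc ‖k‖ * ‖Complexified.unit R‖⁻¹ ^ (1 / ((2 ^ n : ℕ) : ℝ))
          = (‖k‖ ^ (2 ^ n) * ‖Complexified.unit R‖⁻¹) ^ (1 / ((2 ^ n : ℕ) : ℝ)) := by
            rw [Real.mul_rpow (by positivity) (by positivity), ← Real.rpow_natCast,
              ← Real.rpow_mul (by positivity), mul_one_div_cancel hne, Real.rpow_one]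
        _ ≤ _ := Real.rpow_le_rpow (by positivity) hn (by positivity)
    rw [← hzr] at hle
    have h3 : ‖k‖ ≤ ‖z‖ := by
      rw [← ENNReal.ofReal_coe_nnreal, coe_nnnorm] at hle
      exact (ENNReal.ofReal_le_ofReal_iff (norm_nonneg z)).1 hle
    rw [hzre, Complex.norm_real] at h3
    exact h3
  · rw [hzre, spectrum.mem_resolventSet_iff, ← Complexified.mulLeftHom_algebraMap, ← hL]
    have := hu.map L
    rw [map_sub, ← IsUnit.neg_iff, neg_sub] at this
    exact this

/-! ### Normed algebras of endomorphisms -/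

section EndAlgebra

variable {𝕜 : Type} [RCLike 𝕜] {A : Type u} [Category.{v} A] [Preadditive A] [Linear 𝕜 A]

/-- The endomorphisms of an object of a category with submultiplicative norms form a normed
ring. -/
abbrev endNormedRing (n : ∀ x y : A, Norm (x ⟶ y)) (core : ∀ x y : A, NormedSpace.Core 𝕜 (x ⟶ y))
    (norm_comp_le : ∀ {x y w : A} (a : x ⟶ y) (b : y ⟶ w), ‖a ≫ b‖ ≤ ‖b‖ * ‖a‖) (x : A) :
    NormedRing (End x) :=
  { (inferInstance : Ring (End x)), NormedAddCommGroup.ofCore (core x x) with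
    norm_mul_le := fun a b => norm_comp_le b a }

/-- The endomorphisms of an object of a category with submultiplicative norms form a normed
algebra over the reals. -/
abbrev endNormedAlgebra (n : ∀ x y : A, Norm (x ⟶ y))
    (core : ∀ x y : A, NormedSpace.Core 𝕜 (x ⟶ y))
    (norm_comp_le : ∀ {x y w : A} (a : x ⟶ y) (b : y ⟶ w), ‖a ≫ b‖ ≤ ‖b‖ * ‖a‖) (x : A) :
    letI := endNormedRing n core norm_comp_le x
    NormedAlgebra ℝ (End x) :=
  letI := endNormedRing n core norm_comp_le x
  letI : NormedAlgebra 𝕜 (End x) :=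
    { (inferInstance : Algebra 𝕜 (End x)) with
      norm_smul_le := fun z a => ((core x x).norm_smul z a).le }
  NormedAlgebra.restrictScalars ℝ 𝕜 (End x)

/-- The Neumann series of `z⁻¹ • h`, in the Banach algebra of endomorphisms of `x`. -/
theorem isIso_smul_id_sub (n : ∀ x y : A, Norm (x ⟶ y))
    (core : ∀ x y : A, NormedSpace.Core 𝕜 (x ⟶ y))
    (complete : ∀ x y : A, letI := NormedAddCommGroup.ofCore (core x y); CompleteSpace (x ⟶ y))
    (norm_comp_le : ∀ {x y w : A} (a : x ⟶ y) (b : y ⟶ w), ‖a ≫ b‖ ≤ ‖b‖ * ‖a‖) {x : A}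
    (h : x ⟶ x) (z : 𝕜) (hz : ‖h‖ < ‖z‖) : IsIso (z • 𝟙 x - h) := by
  let _ := endNormedRing n core norm_comp_le x
  have : CompleteSpace (End x) := complete x x
  have hz0 : z ≠ 0 := norm_pos_iff.1
    (((core x x).norm_nonneg h).trans_lt hz)
  have h1 : ‖(z⁻¹ • h : x ⟶ x)‖ < 1 := by
    rw [(core x x).norm_smul, norm_inv, inv_mul_lt_iff₀ (norm_pos_iff.2 hz0), mul_one]
    exact hz
  have h2 : IsUnit ((1 : End x) - (show End x from z⁻¹ • h)) :=
    isUnit_one_sub_of_norm_lt_one h1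
  have h3 : IsIso (𝟙 x - z⁻¹ • h) := (isUnit_iff_isIso _).1 h2
  have h4 : z • 𝟙 x - h = z • (𝟙 x - z⁻¹ • h) := by
    rw [smul_sub, smul_smul, mul_inv_cancel₀ hz0, one_smul]
  rw [h4]
  refine ⟨z⁻¹ • inv (𝟙 x - z⁻¹ • h), ?_, ?_⟩
  · rw [Linear.smul_comp, Linear.comp_smul, smul_smul, mul_inv_cancel₀ hz0, one_smul,
      IsIso.hom_inv_id]
  · rw [Linear.smul_comp, Linear.comp_smul, smul_smul, inv_mul_cancel₀ hz0, one_smul,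
      IsIso.inv_hom_id]

theorem isIso_neg {x y : A} (f : x ⟶ y) [IsIso f] : IsIso (-f) :=
  ⟨-inv f, by simp, by simp⟩

theorem isIso_of_isIso_comp {C : Type u} [Category.{v} C] {x y : C} (f : x ⟶ y) (g : y ⟶ x)
    (h1 : IsIso (f ≫ g)) (h2 : IsIso (g ≫ f)) : IsIso f := by
  have : Mono f := mono_of_mono f g
  have : IsSplitEpi f := ⟨⟨inv (g ≫ f) ≫ g, by simp⟩⟩
  exact isIso_of_mono_of_isSplitEpi f

end EndAlgebra

/-! ### Involutions, and positivity from a norm inequality -/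

namespace StarCategory

variable {𝕜 : Type} [RCLike 𝕜] {A : Type u} [Category.{v} A] [Preadditive A] [Linear 𝕜 A]
  [StarCategory 𝕜 A]

theorem adj_id (x : A) : adj 𝕜 (𝟙 x) = 𝟙 x := by
  have h := adj_comp (𝕜 := 𝕜) (adj 𝕜 (𝟙 x)) (𝟙 x)
  rw [Category.comp_id, adj_adj, Category.comp_id] at h
  exact h.symm

theorem adj_zero (x y : A) : adj 𝕜 (0 : x ⟶ y) = 0 := by
  have h := adj_smul (0 : 𝕜) (0 : x ⟶ y)
  rwa [zero_smul, map_zero, zero_smul] at h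

theorem adj_neg {x y : A} (a : x ⟶ y) : adj 𝕜 (-a) = -adj 𝕜 a := by
  rw [eq_neg_iff_add_eq_zero, ← adj_add, neg_add_cancel, adj_zero]

theorem adj_sub {x y : A} (a b : x ⟶ y) : adj 𝕜 (a - b) = adj 𝕜 a - adj 𝕜 b := by
  rw [sub_eq_add_neg, adj_add, adj_neg, ← sub_eq_add_neg]

theorem adj_eqToHom {x y : A} (h : x = y) : adj 𝕜 (eqToHom h) = eqToHom h.symm := by
  subst h
  exact adj_id x

end StarCategory

open StarCategory in
/-- A constructor for `C*`-categories, in which positivity is replaced by a condition on the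
norms. -/
abbrev CStarCategory.ofNorm {𝕜 : Type} [RCLike 𝕜] {A : Type u} [Category.{v} A] [Preadditive A]
    [Linear 𝕜 A] (S : StarCategory 𝕜 A) (homNorm : ∀ x y : A, Norm (x ⟶ y))
    (core : ∀ x y : A, NormedSpace.Core 𝕜 (x ⟶ y))
    (complete : ∀ x y : A, letI := NormedAddCommGroup.ofCore (core x y); CompleteSpace (x ⟶ y))
    (norm_comp_le : ∀ {x y w : A} (a : x ⟶ y) (b : y ⟶ w), ‖a ≫ b‖ ≤ ‖b‖ * ‖a‖)
    (norm_comp_adj : ∀ {x y : A} (a : x ⟶ y), ‖a ≫ adj 𝕜 a‖ = ‖a‖ ^ 2)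
    (norm_sub_le : ∀ {x y : A} (a : x ⟶ y),
      ‖((‖a‖ ^ 2 : ℝ) : 𝕜) • 𝟙 x - a ≫ adj 𝕜 a‖ ≤ ‖a‖ ^ 2) : CStarCategory 𝕜 A where
  toStarCategory := S
  homNorm := homNorm
  core := core
  complete := complete
  norm_comp_le := norm_comp_le
  norm_comp_adj := norm_comp_adj
  positive := by
    -- With M = ‖a‖², a*a + t = (M + t) - (M - a*a), and the subtracted term has norm at most M < M
    -- + t, so the Neumann series applies.
    have neg : ∀ {x y : A} (a : x ⟶ y) (t : ℝ), 0 < t →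
        IsIso (a ≫ adj 𝕜 a + (t : 𝕜) • 𝟙 x) := by
      intro x y a t ht
      have h := isIso_smul_id_sub homNorm core complete norm_comp_le
        (((‖a‖ ^ 2 : ℝ) : 𝕜) • 𝟙 x - a ≫ adj 𝕜 a) ((‖a‖ ^ 2 + t : ℝ) : 𝕜) (by
          rw [RCLike.norm_of_nonneg (by positivity)]
          exact (norm_sub_le a).trans_lt (lt_add_of_pos_right _ ht))
      convert h using 1
      push_cast
      rw [add_smul]
      abel
    -- Here b = a*a - Re z is self-adjoint, so (a*a - z)(a*a - z̄) = b*b + (Im z)², which is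
    -- invertible by `neg` applied to b.
    have real : ∀ {x y : A} (a : x ⟶ y) (z : 𝕜), RCLike.im z ≠ 0 →
        IsIso (a ≫ adj 𝕜 a - z • 𝟙 x) := by
      intro x y a z hz
      set b : x ⟶ x := a ≫ adj 𝕜 a - (RCLike.re z : 𝕜) • 𝟙 x with hb
      have hbs : adj 𝕜 b = b := by
        rw [hb, adj_sub, adj_comp, adj_adj, adj_smul, adj_id, RCLike.conj_ofReal]
      have key : ∀ w : 𝕜, RCLike.re w = RCLike.re z → RCLike.im w ^ 2 = RCLike.im z ^ 2 →
          IsIso ((a ≫ adj 𝕜 a - w • 𝟙 x) ≫ (a ≫ adj 𝕜 a - (starRingEnd 𝕜 w) • 𝟙 x)) := by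
        intro w hw1 hw2
        have h := neg b (RCLike.im z ^ 2) (by positivity)
        rw [hbs] at h
        convert h using 1
        have e1 : (a ≫ adj 𝕜 a : x ⟶ x) = b + (RCLike.re z : 𝕜) • 𝟙 x := by rw [hb]; abel
        rw [e1, ← hw2, ← hw1, add_sub_assoc, add_sub_assoc, ← sub_smul, ← sub_smul,
          Preadditive.add_comp, Preadditive.comp_add, Preadditive.comp_add]
        simp only [Linear.comp_smul, Linear.smul_comp, Category.id_comp, Category.comp_id,
          smul_smul]
        have e2 : (RCLike.re w : 𝕜) - starRingEnd 𝕜 w = -((RCLike.re w : 𝕜) - w) := by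
          rw [neg_sub, sub_eq_sub_iff_add_eq_add, RCLike.add_conj]
          ring
        have e3 : ((RCLike.re w : 𝕜) - starRingEnd 𝕜 w) * ((RCLike.re w : 𝕜) - w) =
            ((RCLike.im w ^ 2 : ℝ) : 𝕜) := by
          have e4 := RCLike.mul_conj w
          have e5 := RCLike.add_conj w
          have e6 := RCLike.norm_sq_eq_def (z := w)
          rw [← RCLike.ofReal_pow, e6] at e4
          push_cast at e4 ⊢
          linear_combination e4 - (RCLike.re w : 𝕜) * e5
        rw [e3, e2, neg_smul]
        abel
      -- Invertibility of the product is needed in both orders; the other order is `key` at the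
      -- conjugate of `z`, which is why `key` is stated for a variable `w`.
      refine isIso_of_isIso_comp _ _ (key z rfl rfl) ?_
      have h := key (starRingEnd 𝕜 z) (RCLike.conj_re z) (by rw [RCLike.conj_im, neg_sq])
      rwa [RCLike.conj_conj] at h
    intro x y a z hz
    have him : RCLike.im z = 0 := by
      by_contra him
      exact hz (real a z him)
    have hz' : z = (RCLike.re z : 𝕜) := by
      conv_lhs => rw [← RCLike.re_add_im z, him]
      simp
    refine ⟨RCLike.re z, ?_, hz'⟩
    by_contra hre
    refine hz ?_
    have := neg a (-RCLike.re z) (by linarith)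
    rw [hz', sub_eq_add_neg, ← neg_smul]
    simpa using this

/-! ### Norms and spectra in C*-categories -/

namespace CStarCat

variable {𝕜 : Type} [RCLike 𝕜]

instance (A : CStarCat.{u} 𝕜) (x y : A) : NormedAddCommGroup (x ⟶ y) :=
  letI := CStarCategory.homNorm (𝕜 := 𝕜) x y
  NormedAddCommGroup.ofCore (CStarCategory.core (𝕜 := 𝕜) x y)

instance (A : CStarCat.{u} 𝕜) (x y : A) : NormedSpace 𝕜 (x ⟶ y) :=
  letI := CStarCategory.homNorm (𝕜 := 𝕜) x y
  NormedSpace.ofCore (CStarCategory.core (𝕜 := 𝕜) x y)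

instance (A : CStarCat.{u} 𝕜) (x y : A) : CompleteSpace (x ⟶ y) :=
  CStarCategory.complete x y

section

variable {A : CStarCat.{u} 𝕜}

/-- The adjoint in a small `C*`-category. -/
def star {x y : A} (a : x ⟶ y) : y ⟶ x := StarCategory.adj 𝕜 a

theorem star_def {x y : A} (a : x ⟶ y) : star a = StarCategory.adj 𝕜 a := rfl

@[simp] theorem star_star {x y : A} (a : x ⟶ y) : star (star a) = a := StarCategory.adj_adj a

@[simp] theorem star_comp {x y z : A} (a : x ⟶ y) (b : y ⟶ z) :
    star (a ≫ b) = star b ≫ star a := StarCategory.adj_comp a b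

@[simp] theorem star_id (x : A) : star (𝟙 x) = 𝟙 x := StarCategory.adj_id x

@[simp] theorem star_add {x y : A} (a b : x ⟶ y) : star (a + b) = star a + star b :=
  StarCategory.adj_add a b

@[simp] theorem star_sub {x y : A} (a b : x ⟶ y) : star (a - b) = star a - star b :=
  StarCategory.adj_sub a b

@[simp] theorem star_smul {x y : A} (z : 𝕜) (a : x ⟶ y) :
    star (z • a) = starRingEnd 𝕜 z • star a := StarCategory.adj_smul z a

@[simp] theorem star_zero (x y : A) : star (0 : x ⟶ y) = 0 := StarCategory.adj_zero x y

@[simp] theorem star_eqToHom {x y : A} (h : x = y) : star (eqToHom h) = eqToHom h.symm :=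
  StarCategory.adj_eqToHom h

theorem norm_comp_le {x y z : A} (a : x ⟶ y) (b : y ⟶ z) : ‖a ≫ b‖ ≤ ‖a‖ * ‖b‖ :=
  (CStarCategory.norm_comp_le a b).trans_eq (mul_comm _ _)

theorem norm_comp_star {x y : A} (a : x ⟶ y) : ‖a ≫ star a‖ = ‖a‖ ^ 2 :=
  CStarCategory.norm_comp_adj a

theorem norm_le_norm_star {x y : A} (a : x ⟶ y) : ‖a‖ ≤ ‖star a‖ := by
  by_cases h : ‖a‖ = 0
  · rw [h]
    exact norm_nonneg _
  · have h1 := norm_comp_le a (star a)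
    rw [norm_comp_star, sq] at h1
    exact le_of_mul_le_mul_left h1 (lt_of_le_of_ne (norm_nonneg a) (Ne.symm h))

@[simp] theorem norm_star {x y : A} (a : x ⟶ y) : ‖star a‖ = ‖a‖ :=
  le_antisymm ((norm_le_norm_star _).trans_eq (by rw [star_star])) (norm_le_norm_star a)

theorem norm_id_le (x : A) : ‖𝟙 x‖ ≤ 1 := by
  have h := norm_comp_star (𝟙 x)
  rw [star_id, Category.comp_id] at h
  nlinarith [norm_nonneg (𝟙 x)]

theorem continuous_comp {x y z : A} :
    Continuous fun p : (x ⟶ y) × (y ⟶ z) => p.1 ≫ p.2 := by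
  let f : (x ⟶ y) →L[𝕜] (y ⟶ z) →L[𝕜] (x ⟶ z) :=
    LinearMap.mkContinuous₂ (Linear.comp x y z) 1 fun a b => by
      rw [one_mul]; exact norm_comp_le a b
  exact f.isBoundedBilinearMap.continuous

theorem continuous_star {x y : A} : Continuous fun a : x ⟶ y => star a := by
  let f : (x ⟶ y) →+ (y ⟶ x) := ⟨⟨star, star_zero x y⟩, star_add⟩
  exact AddMonoidHomClass.continuous_of_bound f 1 fun a => by
    rw [one_mul]; exact (norm_star a).le

theorem le_norm_of_not_isIso {x : A} {h : x ⟶ x} {r : ℝ}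
    (hr : ¬ IsIso (h - (r : 𝕜) • 𝟙 x)) : |r| ≤ ‖h‖ := by
  by_contra hlt
  refine hr ?_
  have := isIso_smul_id_sub _ CStarCategory.core CStarCategory.complete
    CStarCategory.norm_comp_le h (r : 𝕜) (by rw [RCLike.norm_ofReal]; exact not_le.1 hlt)
  rw [← neg_sub]
  exact isIso_neg _

/-- For self-adjoint `h` the C*-identity gives ‖h ^ 2 ^ n‖ = ‖h‖ ^ 2 ^ n, and positivity makes the
complex spectrum real. The Banach algebra statement then applies to the endomorphisms of `x` with
real scalars. It is the source of all comparisons between norms and spectra below. -/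
theorem exists_norm_le_abs_not_isIso {x : A} (h : x ⟶ x) (h0 : h ≠ 0) (hs : star h = h) :
    ∃ s : ℝ, ‖h‖ ≤ |s| ∧ ¬ IsIso (h - (s : 𝕜) • 𝟙 x) := by
  let n : ∀ x y : A, Norm (x ⟶ y) := CStarCategory.homNorm (𝕜 := 𝕜)
  let _ := endNormedRing n CStarCategory.core CStarCategory.norm_comp_le x
  let _ := endNormedAlgebra n CStarCategory.core CStarCategory.norm_comp_le x
  have : CompleteSpace (End x) := CStarCategory.complete x x
  have halg : ∀ s : ℝ, algebraMap ℝ (End x) s = (s : 𝕜) • 𝟙 x := fun s => by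
    rw [Algebra.algebraMap_eq_smul_one]; rfl
  let k : End x := h
  have hpow : ∀ n : ℕ, star (k ^ n : End x) = (k ^ n : End x) := by
    intro n
    induction n with
    | zero => exact star_id x
    | succ n ih =>
      have : star (k ^ n * k : End x) = (k * k ^ n : End x) := by
        change star (k ≫ (k ^ n : End x)) = (k ^ n : End x) ≫ k
        rw [star_comp, ih]
        exact congrArg _ hs
      rw [pow_succ, this, pow_mul_comm']
  obtain ⟨s, hs1, hs2⟩ := exists_norm_le_abs_not_isUnit_sub k h0 (fun n => by
    induction n with
    | zero => simp
    | succ n ih =>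
      have h2 := norm_comp_star (k ^ 2 ^ n : End x)
      rw [hpow] at h2
      rw [pow_succ, pow_mul, sq, pow_mul, ← ih]
      exact h2) (fun s t ht => by
    rw [halg, halg]
    refine (isUnit_iff_isIso _).2 ?_
    by_contra hi
    -- (h - s)² is of the form a*a because h - s is self-adjoint, so the negative number -t² cannot
    -- lie in its spectrum.
    have hpos := CStarCategory.positive (𝕜 := 𝕜) (h - (s : 𝕜) • 𝟙 x) (-(t ^ 2 : ℝ) : 𝕜) (by
      have : StarCategory.adj 𝕜 (h - (s : 𝕜) • 𝟙 x) = h - (s : 𝕜) • 𝟙 x := by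
        rw [← star_def, star_sub, star_smul, star_id, RCLike.conj_ofReal, hs]
      rw [this, neg_smul, sub_neg_eq_add]
      rw [sq] at hi
      exact hi)
    obtain ⟨r, hr, e⟩ := hpos
    rw [← RCLike.ofReal_neg, RCLike.ofReal_inj] at e
    have : 0 < t ^ 2 := by positivity
    linarith)
  refine ⟨s, hs1, fun hi => hs2 ?_⟩
  rw [halg]
  exact (isUnit_iff_isIso _).2 hi

/-- The spectrum of a*a lies in [0, ‖a‖²], hence that of M - a*a in [0, M], and a spectral value
dominates the norm. This turns the positivity axiom into the inequality required by
`CStarCategory.ofNorm`. -/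
theorem norm_smul_id_sub_le {x y : A} (a : x ⟶ y) (M : ℝ) (hM : ‖a‖ ^ 2 ≤ M) :
    ‖(M : 𝕜) • 𝟙 x - a ≫ star a‖ ≤ M := by
  by_cases h0 : (M : 𝕜) • 𝟙 x - a ≫ star a = 0
  · rw [h0, norm_zero]
    exact (sq_nonneg _).trans hM
  obtain ⟨s, hs, hi⟩ := exists_norm_le_abs_not_isIso _ h0 (by simp)
  have hi' : ¬ IsIso (a ≫ star a - ((M - s : ℝ) : 𝕜) • 𝟙 x) := by
    intro h
    refine hi ?_
    have e : (M : 𝕜) • 𝟙 x - a ≫ star a - (s : 𝕜) • 𝟙 x =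
        -(a ≫ star a - ((M - s : ℝ) : 𝕜) • 𝟙 x) := by
      push_cast
      rw [sub_smul]
      abel
    rw [e]
    exact isIso_neg _
  obtain ⟨r, hr, e⟩ := CStarCategory.positive a _ hi'
  have h2 := le_norm_of_not_isIso hi'
  rw [RCLike.ofReal_inj] at e
  rw [e, norm_comp_star, abs_of_nonneg hr] at h2
  refine hs.trans ?_
  rw [abs_of_nonneg (by linarith)]
  linarith

end

/-- `*`-functors between `C*`-categories are norm-decreasing. -/
theorem norm_map_le {A B : CStarCat.{u} 𝕜} (F : StarFunctor 𝕜 A B) {x y : A} (a : x ⟶ y) :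
    ‖F.map a‖ ≤ ‖a‖ := by
  have hstar : F.map (a ≫ star a) = F.map a ≫ star (F.map a) := by
    rw [F.map_comp]
    exact congrArg _ (F.map_adj a)
  have h1 := norm_comp_star (F.map a)
  -- By the C*-identity it suffices to compare the norms of the self-adjoint arrows `F.map (a ≫ star
  -- a)` and `a ≫ star a`.
  refine le_of_sq_le_sq ?_ (norm_nonneg a)
  rw [← h1, ← hstar, ← norm_comp_star]
  by_cases h0 : F.map (a ≫ star a) = 0
  · rw [h0, norm_zero]
    exact norm_nonneg _
  obtain ⟨s, hs, hi⟩ := exists_norm_le_abs_not_isIso _ h0 (by rw [hstar]; simp)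
  -- `F` preserves invertibility, so a spectral value of the image is one of `a ≫ star a`, and is
  -- bounded by the norm of the latter.
  refine hs.trans (le_norm_of_not_isIso fun h => hi ?_)
  have : F.map (a ≫ star a) - (s : 𝕜) • 𝟙 (F.obj x) =
      F.map (a ≫ star a - (s : 𝕜) • 𝟙 x) := by
    have e : a ≫ star a - (s : 𝕜) • 𝟙 x = a ≫ star a + (-(s : 𝕜)) • 𝟙 x := by
      rw [neg_smul, sub_eq_add_neg]
    rw [e, F.map_add, F.map_smul, F.map_id, neg_smul, sub_eq_add_neg]
  rw [this]
  infer_instance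

end CStarCat

/-! ### `C*`-categories of bounded families -/

open scoped ENNReal

namespace CStarCat

variable {𝕜 : Type} [RCLike 𝕜]

section Families

variable {I : Type u} {C : I → CStarCat.{u} 𝕜}

/-- Bounded families of arrows. -/
abbrev BoundedFamily (p q : ∀ i, C i) : Type u := lp (fun i => p i ⟶ q i) ∞

namespace BoundedFamily

/-- A family of arrows with uniformly bounded norms. -/
def mk {p q : ∀ i, C i} (f : ∀ i, p i ⟶ q i) (K : ℝ) (hK : ∀ i, ‖f i‖ ≤ K) :
    BoundedFamily p q :=
  ⟨f, memℓp_infty ⟨K, by rintro _ ⟨i, rfl⟩; exact hK i⟩⟩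

@[ext]
theorem ext {p q : ∀ i, C i} {f g : BoundedFamily p q} (h : ∀ i, f i = g i) : f = g :=
  Subtype.ext (funext h)

theorem norm_apply_le {p q : ∀ i, C i} (f : BoundedFamily p q) (i : I) : ‖f i‖ ≤ ‖f‖ :=
  lp.norm_apply_le_norm (by simp) f i

theorem norm_le {p q : ∀ i, C i} (f : BoundedFamily p q) {K : ℝ} (hK : 0 ≤ K)
    (h : ∀ i, ‖f i‖ ≤ K) : ‖f‖ ≤ K :=
  lp.norm_le_of_forall_le hK h

@[simp] theorem add_apply {p q : ∀ i, C i} (f g : BoundedFamily p q) (i : I) :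
    (f + g) i = f i + g i := rfl

@[simp] theorem smul_apply {p q : ∀ i, C i} (z : 𝕜) (f : BoundedFamily p q) (i : I) :
    (z • f) i = z • f i := rfl

@[simp] theorem zero_apply {p q : ∀ i, C i} (i : I) : (0 : BoundedFamily p q) i = 0 := rfl

/-- The identity family. -/
def id (p : ∀ i, C i) : BoundedFamily p p := mk (fun i => 𝟙 (p i)) 1 fun _ => norm_id_le _

/-- Composition of bounded families. -/
def comp {p q r : ∀ i, C i} (f : BoundedFamily p q) (g : BoundedFamily q r) :
    BoundedFamily p r :=
  mk (fun i => f i ≫ g i) (‖f‖ * ‖g‖) fun i => (norm_comp_le _ _).trans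
    (mul_le_mul (f.norm_apply_le i) (g.norm_apply_le i) (norm_nonneg _) (norm_nonneg _))

/-- The adjoint of a bounded family. -/
def star {p q : ∀ i, C i} (f : BoundedFamily p q) : BoundedFamily q p :=
  mk (fun i => CStarCat.star (f i)) ‖f‖ fun i => (norm_star _).trans_le (f.norm_apply_le i)

@[simp] theorem id_apply (p : ∀ i, C i) (i : I) : id p i = 𝟙 (p i) := rfl

@[simp] theorem comp_apply {p q r : ∀ i, C i} (f : BoundedFamily p q) (g : BoundedFamily q r)
    (i : I) : f.comp g i = f i ≫ g i := rfl

@[simp] theorem star_apply {p q : ∀ i, C i} (f : BoundedFamily p q) (i : I) :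
    f.star i = CStarCat.star (f i) := rfl

theorem norm_comp_le {p q r : ∀ i, C i} (f : BoundedFamily p q) (g : BoundedFamily q r) :
    ‖f.comp g‖ ≤ ‖f‖ * ‖g‖ :=
  norm_le _ (by positivity) fun i => (CStarCat.norm_comp_le _ _).trans
    (mul_le_mul (f.norm_apply_le i) (g.norm_apply_le i) (norm_nonneg _) (norm_nonneg _))

theorem norm_star_le {p q : ∀ i, C i} (f : BoundedFamily p q) : ‖f.star‖ ≤ ‖f‖ :=
  norm_le _ (norm_nonneg _) fun i => (norm_star _).trans_le (f.norm_apply_le i)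

theorem continuous_comp {p q r : ∀ i, C i} :
    Continuous fun z : BoundedFamily p q × BoundedFamily q r => z.1.comp z.2 := by
  let f : BoundedFamily p q →L[𝕜] BoundedFamily q r →L[𝕜] BoundedFamily p r :=
    LinearMap.mkContinuous₂
      (LinearMap.mk₂ 𝕜 comp (fun _ _ _ => by ext; simp) (fun _ _ _ => by ext; simp)
        (fun _ _ _ => by ext; simp) (fun _ _ _ => by ext; simp)) 1 fun a b => by
      rw [one_mul]; exact norm_comp_le a b
  exact f.isBoundedBilinearMap.continuous

theorem continuous_star {p q : ∀ i, C i} : Continuous fun f : BoundedFamily p q => f.star := by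
  let f : BoundedFamily p q →+ BoundedFamily q p :=
    ⟨⟨star, by ext; simp⟩, fun _ _ => by ext; simp⟩
  exact AddMonoidHomClass.continuous_of_bound f 1 fun a => by
    rw [one_mul]; exact norm_star_le a

theorem norm_comp_star {p q : ∀ i, C i} (f : BoundedFamily p q) :
    ‖f.comp f.star‖ = ‖f‖ ^ 2 := by
  refine le_antisymm ?_ ?_
  · refine norm_le _ (by positivity) fun i => ?_
    rw [comp_apply, star_apply, CStarCat.norm_comp_star]
    exact pow_le_pow_left₀ (norm_nonneg _) (f.norm_apply_le i) 2
  · have : ‖f‖ ≤ √‖f.comp f.star‖ := norm_le _ (Real.sqrt_nonneg _) fun i => by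
      refine Real.le_sqrt_of_sq_le ?_
      rw [← CStarCat.norm_comp_star]
      exact norm_apply_le (f.comp f.star) i
    calc ‖f‖ ^ 2 ≤ √‖f.comp f.star‖ ^ 2 := pow_le_pow_left₀ (norm_nonneg _) this 2
      _ = _ := Real.sq_sqrt (norm_nonneg _)

/-- The inequality holds in every component with the common constant ‖f‖². Invertibility of each
component would not suffice for positivity, since the inverses need not be uniformly bounded; a norm
inequality does pass to the supremum. -/
theorem norm_smul_id_sub_le {p q : ∀ i, C i} (f : BoundedFamily p q) :
    ‖((‖f‖ ^ 2 : ℝ) : 𝕜) • id p - f.comp f.star‖ ≤ ‖f‖ ^ 2 :=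
  norm_le _ (by positivity) fun i => CStarCat.norm_smul_id_sub_le (f i) _
    (pow_le_pow_left₀ (norm_nonneg _) (f.norm_apply_le i) 2)

end BoundedFamily

end Families

/-- Data for a `C*`-category whose arrows are bounded families of arrows of given
`C*`-categories. -/
structure FamilyData (𝕜 : Type) [RCLike 𝕜] where
  /-- the index set of the families -/
  I : Type u
  /-- the `C*`-category in which the components at `i` live -/
  C : I → CStarCat.{u} 𝕜
  /-- the objects -/
  X : Type u
  /-- the components of an object -/
  ev : X → ∀ i, C i
  /-- the arrows -/
  N : ∀ x y : X, Submodule 𝕜 (BoundedFamily (ev x) (ev y))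
  isClosed : ∀ x y, IsClosed (N x y : Set (BoundedFamily (ev x) (ev y)))
  id_mem : ∀ x, BoundedFamily.id (ev x) ∈ N x x
  comp_mem : ∀ {x y z} {f : BoundedFamily (ev x) (ev y)} {g : BoundedFamily (ev y) (ev z)},
    f ∈ N x y → g ∈ N y z → f.comp g ∈ N x z
  star_mem : ∀ {x y} {f : BoundedFamily (ev x) (ev y)}, f ∈ N x y → f.star ∈ N y x

namespace FamilyData

variable (D : FamilyData.{u} 𝕜)

/-- The objects of the `C*`-category of bounded families. -/
structure Obj : Type u where
  val : D.X

instance : Category.{u} D.Obj where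
  Hom x y := D.N x.val y.val
  id x := ⟨BoundedFamily.id _, D.id_mem x.val⟩
  comp f g := ⟨f.1.comp g.1, D.comp_mem f.2 g.2⟩
  id_comp f := by ext; simp
  comp_id f := by ext; simp
  assoc f g h := by ext; simp

/-- The components of an arrow. -/
def app {D : FamilyData.{u} 𝕜} {x y : D.Obj} (f : x ⟶ y) (i : D.I) :
    D.ev x.val i ⟶ D.ev y.val i :=
  (show D.N x.val y.val from f).1 i

/-- An arrow as a bounded family. -/
def toFamily {D : FamilyData.{u} 𝕜} {x y : D.Obj} (f : x ⟶ y) :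
    BoundedFamily (D.ev x.val) (D.ev y.val) :=
  (show D.N x.val y.val from f).1

/-- The arrow given by a bounded family. -/
def homMk {D : FamilyData.{u} 𝕜} {x y : D.Obj} (f : BoundedFamily (D.ev x.val) (D.ev y.val))
    (hf : f ∈ D.N x.val y.val) : x ⟶ y :=
  (⟨f, hf⟩ : D.N x.val y.val)

@[ext]
theorem hom_ext {D : FamilyData.{u} 𝕜} {x y : D.Obj} {f g : x ⟶ y} (h : ∀ i, app f i = app g i) :
    f = g :=
  Subtype.ext (BoundedFamily.ext h)

instance : Preadditive D.Obj where
  homGroup x y := inferInstanceAs (AddCommGroup (D.N x.val y.val))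
  add_comp _ _ _ f f' g := hom_ext fun i =>
    Preadditive.add_comp _ _ _ (app f i) (app f' i) (app g i)
  comp_add _ _ _ f g g' := hom_ext fun i =>
    Preadditive.comp_add _ _ _ (app f i) (app g i) (app g' i)

instance : Linear 𝕜 D.Obj where
  homModule x y := inferInstanceAs (Module 𝕜 (D.N x.val y.val))
  smul_comp _ _ _ z f g := hom_ext fun i => Linear.smul_comp _ _ _ z (app f i) (app g i)
  comp_smul _ _ _ f z g := hom_ext fun i => Linear.comp_smul _ _ _ (app f i) z (app g i)

instance : StarCategory 𝕜 D.Obj where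
  adj {x y} f := homMk (toFamily f).star (D.star_mem (show D.N x.val y.val from f).2)
  adj_add f g := hom_ext fun i => star_add (app f i) (app g i)
  adj_smul z f := hom_ext fun i => star_smul z (app f i)
  adj_comp f g := hom_ext fun i => star_comp (app f i) (app g i)
  adj_adj f := hom_ext fun i => star_star (app f i)

instance (x y : D.Obj) : Norm (x ⟶ y) := ⟨fun f => ‖toFamily f‖⟩

theorem core (x y : D.Obj) : NormedSpace.Core 𝕜 (x ⟶ y) where
  norm_nonneg f := norm_nonneg (toFamily f)
  norm_smul c f := norm_smul c (toFamily f)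
  norm_triangle f g := norm_add_le (toFamily f) (toFamily g)
  norm_eq_zero_iff f := (norm_eq_zero (a := toFamily f)).trans
    ⟨fun h => Subtype.ext h, fun h => congrArg toFamily h⟩

instance : CStarCategory 𝕜 D.Obj :=
  CStarCategory.ofNorm inferInstance (fun _ _ => inferInstance) (core D)
    (fun x y => by
      let _ : NormedAddCommGroup (x ⟶ y) := NormedAddCommGroup.ofCore (core D x y)
      let e : (x ⟶ y) ≃ D.N x.val y.val := Equiv.refl _
      have he : Isometry e := Isometry.of_dist_eq fun a b => by
        rw [dist_eq_norm, dist_eq_norm]; rfl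
      have : CompleteSpace (D.N x.val y.val) := (D.isClosed x.val y.val).completeSpace_coe
      exact (completeSpace_congr he.isUniformEmbedding).2 this)
    (fun a b => (BoundedFamily.norm_comp_le (toFamily a) (toFamily b)).trans_eq (mul_comm _ _))
    (fun a => BoundedFamily.norm_comp_star (toFamily a))
    (fun a => BoundedFamily.norm_smul_id_sub_le (toFamily a))

/-- The `C*`-category of bounded families. -/
def toCStarCat : CStarCat.{u} 𝕜 where
  carrier := D.Obj

/-- The projections from the `C*`-category of bounded families. -/
def proj (i : D.I) : StarFunctor 𝕜 D.toCStarCat (D.C i) where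
  obj x := D.ev x.val i
  map f := app f i
  map_id _ := rfl
  map_comp _ _ := rfl
  map_add _ _ := rfl
  map_smul _ _ := rfl
  map_adj _ := rfl

end FamilyData

end CStarCat

/-! ### Extensionality of `*`-functors -/

namespace StarFunctor

variable {𝕜 : Type} [RCLike 𝕜]
  {A : Type u₁} [Category.{v₁} A] [Preadditive A] [Linear 𝕜 A] [StarCategory 𝕜 A]
  {B : Type u₂} [Category.{v₂} B] [Preadditive B] [Linear 𝕜 B] [StarCategory 𝕜 B]
  {C : Type u₃} [Category.{v₃} C] [Preadditive C] [Linear 𝕜 C] [StarCategory 𝕜 C]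

theorem ext_toFunctor {F G : StarFunctor 𝕜 A B} (h : F.toFunctor = G.toFunctor) : F = G := by
  cases F
  cases G
  cases h
  rfl

theorem ext_map {F G : StarFunctor 𝕜 A B} (hobj : ∀ x, F.obj x = G.obj x)
    (hmap : ∀ {x y : A} (a : x ⟶ y),
      F.map a = eqToHom (hobj x) ≫ G.map a ≫ eqToHom (hobj y).symm) : F = G :=
  ext_toFunctor (CategoryTheory.Functor.ext hobj fun _ _ a => hmap a)

theorem congr_obj {F G : StarFunctor 𝕜 A B} (h : F = G) (x : A) : F.obj x = G.obj x := by
  rw [h]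

theorem congr_map {F G : StarFunctor 𝕜 A B} (h : F = G) {x y : A} (a : x ⟶ y) :
    F.map a = eqToHom (congr_obj h x) ≫ G.map a ≫ eqToHom (congr_obj h y).symm := by
  subst h
  simp

/-- Agreement on identity arrows, taken with their endpoints, already contains agreement on objects,
so no transports have to be supplied. -/
theorem ext_onArrow {F G : StarFunctor 𝕜 A B} (h : ∀ a : Arrow A, F.onArrow a = G.onArrow a) :
    F = G := by
  refine ext_map (fun x => congrArg (fun a : Arrow B => a.left) (h (Arrow.mk (𝟙 x))))
    fun {x y} a => ?_
  obtain ⟨_, _, e⟩ := (Arrow.mk_eq_mk_iff _ _).1 (h (Arrow.mk a))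
  exact e

/-- A `*`-functor on a Hom space, as a linear map. -/
def mapLinear (F : StarFunctor 𝕜 A B) (x y : A) : (x ⟶ y) →ₗ[𝕜] (F.obj x ⟶ F.obj y) where
  toFun a := F.map a
  map_add' := F.map_add
  map_smul' := F.map_smul

theorem map_zero (F : StarFunctor 𝕜 A B) (x y : A) : F.map (0 : x ⟶ y) = 0 :=
  (F.mapLinear x y).map_zero

end StarFunctor

theorem CStarCat.continuous_map {𝕜 : Type} [RCLike 𝕜] {A B : CStarCat.{u} 𝕜}
    (F : StarFunctor 𝕜 A B) {x y : A} : Continuous fun a : x ⟶ y => F.map a :=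
  AddMonoidHomClass.continuous_of_bound (F.mapLinear x y) 1 fun a => by
    rw [one_mul]; exact norm_map_le F a

/-! ### Universal `C*`-categories for a class of representations -/

namespace CStarCat

variable {𝕜 : Type} [RCLike 𝕜]

/-- A class of `*`-functors from a `*`-category to small `C*`-categories, uniformly bounded on
every arrow. -/
structure RepClass (𝕜 : Type) [RCLike 𝕜] (S : Type u) [Category.{u} S] [Preadditive S]
    [Linear 𝕜 S] [StarCategory 𝕜 S] where
  /-- the class -/
  P : ∀ C : CStarCat.{u} 𝕜, StarFunctor 𝕜 S C → Prop
  bdd : ∀ {x y : S} (a : x ⟶ y), ∃ K : ℝ, ∀ C σ, P C σ → ‖σ.map a‖ ≤ K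

namespace RepClass

variable {S : Type u} [Category.{u} S] [Preadditive S] [Linear 𝕜 S] [StarCategory 𝕜 S]
  (R : RepClass.{u} 𝕜 S)

/-- An index set for sufficiently many representations in the class. -/
def Index : Type u :=
  -- All representations together are too many to index a small product. One representation is
  -- chosen for each arrow and each rational strictly below a norm attained on that arrow, which
  -- keeps the index set in `Type u`.
  {p : (Σ x y : S, x ⟶ y) × ℚ //
    ∃ (C : CStarCat.{u} 𝕜) (σ : StarFunctor 𝕜 S C), R.P C σ ∧ (p.2 : ℝ) < ‖σ.map p.1.2.2‖}

/-- The target of a representation in the family. -/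
def target (i : R.Index) : CStarCat.{u} 𝕜 := i.2.choose

/-- A representation in the family. -/
def rep (i : R.Index) : StarFunctor 𝕜 S (R.target i) := i.2.choose_spec.choose

theorem rep_mem (i : R.Index) : R.P _ (R.rep i) := i.2.choose_spec.choose_spec.1

theorem lt_norm_rep (i : R.Index) : (i.1.2 : ℝ) < ‖(R.rep i).map i.1.1.2.2‖ :=
  i.2.choose_spec.choose_spec.2

/-- The bounded family of the images of an arrow. -/
def family (x y : S) :
    (x ⟶ y) →ₗ[𝕜] BoundedFamily (fun i => (R.rep i).obj x) (fun i => (R.rep i).obj y) where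
  toFun a := BoundedFamily.mk (fun i => (R.rep i).map a) (R.bdd a).choose
    fun i => (R.bdd a).choose_spec _ _ (R.rep_mem i)
  map_add' a b := BoundedFamily.ext fun i => (R.rep i).map_add a b
  map_smul' z a := BoundedFamily.ext fun i => (R.rep i).map_smul z a

/-- Each rational below `‖σ.map a‖` is, together with `a`, an index whose chosen representation
exceeds that rational at `a`. The chosen representations therefore dominate every representation in
the class. -/
theorem norm_map_le_family {C : CStarCat.{u} 𝕜} {σ : StarFunctor 𝕜 S C} (hσ : R.P C σ) {x y : S}
    (a : x ⟶ y) : ‖σ.map a‖ ≤ ‖R.family x y a‖ := by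
  refine le_of_forall_rat_lt_imp_le fun q hq => ?_
  let i : R.Index := ⟨(⟨x, y, a⟩, q), C, σ, hσ, hq⟩
  exact (R.lt_norm_rep i).le.trans ((R.family x y a).norm_apply_le i)

/-- The data defining the universal `C*`-category. -/
def data : FamilyData.{u} 𝕜 where
  I := R.Index
  C := R.target
  X := S
  ev x i := (R.rep i).obj x
  N x y := (LinearMap.range (R.family x y)).topologicalClosure
  isClosed _ _ := Submodule.isClosed_topologicalClosure _
  id_mem x := Submodule.le_topologicalClosure _
    ⟨𝟙 x, BoundedFamily.ext fun i => (R.rep i).map_id x⟩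
  comp_mem {x y z f g} hf hg := by
    refine map_mem_closure₂ (f := fun a b => BoundedFamily.comp a b)
      BoundedFamily.continuous_comp hf hg ?_
    rintro _ ⟨a, rfl⟩ _ ⟨b, rfl⟩
    exact ⟨a ≫ b, BoundedFamily.ext fun i => (R.rep i).map_comp a b⟩
  star_mem {x y f} hf := by
    refine map_mem_closure BoundedFamily.continuous_star hf ?_
    rintro _ ⟨a, rfl⟩
    exact ⟨StarCategory.adj 𝕜 a, BoundedFamily.ext fun i => (R.rep i).map_adj a⟩

/-- The universal `C*`-category of a class of representations. -/
def univ : CStarCat.{u} 𝕜 := R.data.toCStarCat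

/-- The object of the universal `C*`-category given by an object of `S`. -/
def mkObj (x : S) : R.univ := FamilyData.Obj.mk (D := R.data) x

theorem family_mem {x y : S} (a : x ⟶ y) : R.family x y a ∈ R.data.N x y :=
  Submodule.le_topologicalClosure (LinearMap.range (R.family x y)) (LinearMap.mem_range_self _ a)

/-- The canonical `*`-functor. -/
def can : StarFunctor 𝕜 S R.univ where
  obj x := R.mkObj x
  map {x y} a := FamilyData.homMk (D := R.data) (R.family x y a)
    (R.family_mem a)
  map_id x := FamilyData.hom_ext (D := R.data) fun i => (R.rep i).map_id x
  map_comp a b := FamilyData.hom_ext (D := R.data) fun i => (R.rep i).map_comp a b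
  map_add a b := FamilyData.hom_ext (D := R.data) fun i => (R.rep i).map_add a b
  map_smul z a := FamilyData.hom_ext (D := R.data) fun i => (R.rep i).map_smul z a
  map_adj a := FamilyData.hom_ext (D := R.data) fun i => (R.rep i).map_adj a

/-- Arrows of the universal C*-category are families of values of representations. Relations can
therefore be imposed by restricting the class of representations, without forming a quotient of `S`.
-/
theorem can_map_eq {x y : S} {a b : x ⟶ y}
    (h : ∀ (C : CStarCat.{u} 𝕜) (σ : StarFunctor 𝕜 S C), R.P C σ → σ.map a = σ.map b) :
    R.can.map a = R.can.map b :=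
  FamilyData.hom_ext (D := R.data) fun i => h _ _ (R.rep_mem i)

theorem norm_map_le {C : CStarCat.{u} 𝕜} {σ : StarFunctor 𝕜 S C} (hσ : R.P C σ) {x y : S}
    (a : x ⟶ y) : ‖σ.map a‖ ≤ ‖R.can.map a‖ :=
  R.norm_map_le_family hσ a

/-- The object of `S` underlying an object of the universal `C*`-category. -/
def objVal (x : R.univ) : S := FamilyData.Obj.val (D := R.data) x

/-- The canonical `*`-functor on a Hom space, as a linear map. -/
def canLinear (x y : S) : (x ⟶ y) →ₗ[𝕜] (R.mkObj x ⟶ R.mkObj y) where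
  toFun a := R.can.map a
  map_add' := R.can.map_add
  map_smul' := R.can.map_smul

theorem denseRange_can (x y : S) : DenseRange (R.canLinear x y) := by
  intro f
  obtain ⟨f, hf⟩ := f
  change f ∈ closure (LinearMap.range (R.family x y) :
    Set (BoundedFamily (fun i => (R.rep i).obj x) (fun i => (R.rep i).obj y))) at hf
  refine Metric.mem_closure_range_iff.2 fun ε hε => ?_
  obtain ⟨_, ⟨a, rfl⟩, ha⟩ := Metric.mem_closure_iff.1 hf ε hε
  exact ⟨a, (dist_eq_norm _ _).trans_lt ((dist_eq_norm _ _).symm.trans_lt ha)⟩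

theorem hom_induction {x y : S} {p : (R.mkObj x ⟶ R.mkObj y) → Prop}
    (hp : IsClosed {f | p f}) (h : ∀ a : x ⟶ y, p (R.canLinear x y a))
    (f : R.mkObj x ⟶ R.mkObj y) : p f :=
  (R.denseRange_can x y).induction_on f hp h

/-- The extension of a `*`-functor to the universal `C*`-category, on Hom spaces. -/
def liftMap {C : CStarCat.{u} 𝕜} (σ : StarFunctor 𝕜 S C) (x y : S) :
    (R.mkObj x ⟶ R.mkObj y) →L[𝕜] (σ.obj x ⟶ σ.obj y) :=
  (σ.mapLinear x y).extendOfNorm (R.canLinear x y)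

section

variable {R} {C : CStarCat.{u} 𝕜} {σ : StarFunctor 𝕜 S C}

/-- The norm of `R.can.map a` dominates that of `σ.map a`, so `σ` extends by continuity from the
dense image of `can`. -/
theorem liftMap_can (hσ : R.P C σ) {x y : S} (a : x ⟶ y) :
    R.liftMap σ x y (R.canLinear x y a) = σ.map a :=
  LinearMap.extendOfNorm_eq (R.denseRange_can x y)
    ⟨1, fun a => by rw [one_mul]; exact R.norm_map_le hσ a⟩ a

theorem liftMap_id (hσ : R.P C σ) (x : S) :
    R.liftMap σ x x (𝟙 (R.mkObj x)) = 𝟙 (σ.obj x) :=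
  ((congrArg (R.liftMap σ x x) (R.can.map_id x).symm).trans (liftMap_can hσ (𝟙 x))).trans
    (σ.map_id x)

theorem liftMap_comp (hσ : R.P C σ) {x y z : S} (f : R.mkObj x ⟶ R.mkObj y)
    (g : R.mkObj y ⟶ R.mkObj z) :
    R.liftMap σ x z (f ≫ g) = R.liftMap σ x y f ≫ R.liftMap σ y z g := by
  induction f using R.hom_induction with
  | hp =>
    exact isClosed_eq ((R.liftMap σ x z).continuous.comp
        (continuous_comp.comp (continuous_id.prodMk continuous_const)))
      (continuous_comp.comp ((R.liftMap σ x y).continuous.prodMk continuous_const))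
  | h a =>
    induction g using R.hom_induction with
    | hp =>
      exact isClosed_eq ((R.liftMap σ x z).continuous.comp
          (continuous_comp.comp (continuous_const.prodMk continuous_id)))
        (continuous_comp.comp (continuous_const.prodMk (R.liftMap σ y z).continuous))
    | h b =>
      have e : R.canLinear x y a ≫ R.canLinear y z b = R.canLinear x z (a ≫ b) :=
        (R.can.map_comp a b).symm
      rw [e, liftMap_can hσ, liftMap_can hσ, liftMap_can hσ, σ.map_comp]

theorem liftMap_star (hσ : R.P C σ) {x y : S} (f : R.mkObj x ⟶ R.mkObj y) :
    R.liftMap σ y x (star f) = star (R.liftMap σ x y f) := by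
  induction f using R.hom_induction with
  | hp =>
    exact isClosed_eq ((R.liftMap σ y x).continuous.comp continuous_star)
      (continuous_star.comp (R.liftMap σ x y).continuous)
  | h a =>
    have e : star (R.canLinear x y a) = R.canLinear y x (StarCategory.adj 𝕜 a) :=
      (R.can.map_adj a).symm
    rw [e, liftMap_can hσ, liftMap_can hσ, σ.map_adj]
    rfl

end

/-- The extension of a `*`-functor to the universal `C*`-category. -/
def lift {C : CStarCat.{u} 𝕜} (σ : StarFunctor 𝕜 S C) (hσ : R.P C σ) :
    StarFunctor 𝕜 R.univ C where
  obj x := σ.obj (R.objVal x)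
  map {x y} f := R.liftMap σ (R.objVal x) (R.objVal y) f
  map_id x := liftMap_id hσ (R.objVal x)
  map_comp f g := liftMap_comp hσ f g
  map_add f g := (R.liftMap σ _ _).map_add f g
  map_smul z f := (R.liftMap σ _ _).map_smul z f
  map_adj f := liftMap_star hσ f

theorem lift_map_can {C : CStarCat.{u} 𝕜} (σ : StarFunctor 𝕜 S C) (hσ : R.P C σ) {x y : S}
    (a : x ⟶ y) : (R.lift σ hσ).map (R.can.map a) = σ.map a :=
  liftMap_can hσ a

theorem can_comp_lift {C : CStarCat.{u} 𝕜} (σ : StarFunctor 𝕜 S C) (hσ : R.P C σ) :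
    R.can.comp (R.lift σ hσ) = σ :=
  StarFunctor.ext_onArrow fun a => congrArg Arrow.mk (R.lift_map_can σ hσ a.hom)

/-- The objects of the universal C*-category are those of `S` and the image of `can` is dense in
each Hom space, so continuity of *-functors gives uniqueness. -/
theorem hom_ext {C : CStarCat.{u} 𝕜} {τ τ' : StarFunctor 𝕜 R.univ C}
    (h : R.can.comp τ = R.can.comp τ') : τ = τ' := by
  have hobj : ∀ x : S, τ.obj (R.mkObj x) = τ'.obj (R.mkObj x) := StarFunctor.congr_obj h
  have hmap : ∀ (x y : S) (f : R.mkObj x ⟶ R.mkObj y),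
      τ.map f = eqToHom (hobj x) ≫ τ'.map f ≫ eqToHom (hobj y).symm := by
    intro x y f
    induction f using R.hom_induction with
    | hp =>
      exact isClosed_eq (continuous_map τ) (continuous_comp.comp (continuous_const.prodMk
        (continuous_comp.comp ((continuous_map τ').prodMk continuous_const))))
    | h a => exact StarFunctor.congr_map h a
  exact StarFunctor.ext_map (fun x => hobj (R.objVal x)) fun {x y} f =>
    hmap (R.objVal x) (R.objVal y) f

end RepClass

end CStarCat

/-! ### Limits -/

namespace CStarCat

variable {𝕜 : Type} [RCLike 𝕜]

theorem eq_eqToHom_comp {C : Type u} [Category.{v} C] {a b a' b' : C} {f : a ⟶ b} {g : a' ⟶ b'}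
    (ha : a' = a) (hb : b' = b) (h : g = eqToHom ha ≫ f ≫ eqToHom hb.symm) :
    f = eqToHom ha.symm ≫ g ≫ eqToHom hb := by
  subst ha hb
  simpa using h.symm

section Limits

variable {J : Type u} [Category.{u} J] (D : J ⥤ CStarCat.{u} 𝕜)

/-- The `*`-functor of an arrow of a diagram. -/
def diagMap {i j : J} (φ : i ⟶ j) : StarFunctor 𝕜 (D.obj i) (D.obj j) := D.map φ

/-- The limit of a diagram consists of the bounded compatible families. -/
def limitData : FamilyData.{u} 𝕜 where
  I := J
  C j := D.obj j
  X := {x : ∀ j, D.obj j // ∀ {i j : J} (φ : i ⟶ j), (diagMap D φ).obj (x i) = x j}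
  ev x := x.1
  N x y :=
    { carrier := {f | ∀ {i j : J} (φ : i ⟶ j), (diagMap D φ).map (f i) =
        eqToHom (x.2 φ) ≫ f j ≫ eqToHom (y.2 φ).symm}
      zero_mem' := fun φ => by simp [StarFunctor.map_zero]
      add_mem' := fun hf hg i j φ => by
        simp [StarFunctor.map_add, hf φ, hg φ]
      smul_mem' := fun z f hf i j φ => by
        simp [StarFunctor.map_smul, hf φ] }
  isClosed x y := by
    have h : ∀ (i j : J) (φ : i ⟶ j),
        IsClosed {f : BoundedFamily x.1 y.1 | (diagMap D φ).map (f i) =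
          eqToHom (x.2 φ) ≫ f j ≫ eqToHom (y.2 φ).symm} := fun i j φ => by
      have hc : ∀ i, Continuous fun f : BoundedFamily x.1 y.1 => f i := fun i =>
        AddMonoidHomClass.continuous_of_bound
          (⟨⟨fun f => f i, rfl⟩, fun _ _ => rfl⟩ : BoundedFamily x.1 y.1 →+ (x.1 i ⟶ y.1 i)) 1
          fun f => by rw [one_mul]; exact f.norm_apply_le i
      exact isClosed_eq ((continuous_map _).comp (hc i)) (continuous_comp.comp
        (continuous_const.prodMk (continuous_comp.comp ((hc j).prodMk continuous_const))))
    have e : {f : BoundedFamily x.1 y.1 | ∀ {i j : J} (φ : i ⟶ j), (diagMap D φ).map (f i) =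
        eqToHom (x.2 φ) ≫ f j ≫ eqToHom (y.2 φ).symm} =
        ⋂ (i : J) (j : J) (φ : i ⟶ j), {f : BoundedFamily x.1 y.1 | (diagMap D φ).map (f i) =
          eqToHom (x.2 φ) ≫ f j ≫ eqToHom (y.2 φ).symm} := by
      ext f
      simp only [Set.mem_ofPred_eq, Set.mem_iInter]
    change IsClosed {f : BoundedFamily x.1 y.1 | ∀ {i j : J} (φ : i ⟶ j),
      (diagMap D φ).map (f i) = eqToHom (x.2 φ) ≫ f j ≫ eqToHom (y.2 φ).symm}
    rw [e]
    exact isClosed_iInter fun i => isClosed_iInter fun j => isClosed_iInter fun φ => h i j φ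
  id_mem x i j φ := by simp
  comp_mem hf hg i j φ := by simp [hf φ, hg φ]
  star_mem {x y f} hf i j φ := by
    have h := congrArg star (hf φ)
    rw [star_def, ← StarFunctor.map_adj] at h
    rw [BoundedFamily.star_apply, star_def, h]
    simp only [star_comp, star_eqToHom, Category.assoc]
    rfl

theorem limit_arrow_ext {a b : Arrow (limitData D).toCStarCat}
    (h : ∀ j : J, ((limitData D).proj j).onArrow a = ((limitData D).proj j).onArrow b) :
    a = b := by
  obtain ⟨⟨x⟩, ⟨y⟩, f⟩ := a
  obtain ⟨⟨x'⟩, ⟨y'⟩, g⟩ := b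
  have hx : x = x' := Subtype.ext (funext fun j => congrArg (fun a : Arrow _ => a.left) (h j))
  have hy : y = y' := Subtype.ext (funext fun j => congrArg (fun a : Arrow _ => a.right) (h j))
  subst hx hy
  have hf : f = g := FamilyData.hom_ext (D := limitData D) fun j =>
    Arrow.mk_injective _ _ (h j)
  rw [hf]

/-- The limit cone. -/
def limitCone : Cone D where
  pt := (limitData D).toCStarCat
  π :=
    { app := fun j => (limitData D).proj j
      naturality := fun i j φ => by
        refine (StarFunctor.ext_map (fun x => ?_) fun {x y} f => ?_ :
          (limitData D).proj j = ((limitData D).proj i).comp (diagMap D φ))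
        · exact (x.1.2 φ).symm
        · exact eq_eqToHom_comp (x.1.2 φ) (y.1.2 φ)
            ((show (limitData D).N x.1 y.1 from f).2 φ) }

/-- The limit cone is a limit cone. -/
def limitConeIsLimit : IsLimit (limitCone D) where
  lift s :=
    let σ : ∀ j, StarFunctor 𝕜 s.pt (D.obj j) := fun j => s.π.app j
    have hσ : ∀ {i j : J} (φ : i ⟶ j), (σ i).comp (diagMap D φ) = σ j := fun φ => s.w φ
    ({  obj := fun x => ⟨⟨fun j => (σ j).obj x, fun φ => StarFunctor.congr_obj (hσ φ) x⟩⟩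
        map := fun f => FamilyData.homMk (D := limitData D)
          -- Contractivity of the legs makes the family of images bounded; this is why bounded
          -- compatible families suffice for the universal property.
          (BoundedFamily.mk (fun j => (σ j).map f) ‖f‖ fun j => norm_map_le (σ j) f)
          fun φ => StarFunctor.congr_map (hσ φ) f
        map_id := fun x => FamilyData.hom_ext (D := limitData D) fun j => (σ j).map_id x
        map_comp := fun f g => FamilyData.hom_ext (D := limitData D) fun j => (σ j).map_comp f g
        map_add := fun f g => FamilyData.hom_ext (D := limitData D) fun j => (σ j).map_add f g
        map_smul := fun z f => FamilyData.hom_ext (D := limitData D) fun j => (σ j).map_smul z f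
        map_adj := fun f => FamilyData.hom_ext (D := limitData D) fun j => (σ j).map_adj f } :
      StarFunctor 𝕜 s.pt (limitData D).toCStarCat)
  fac s j := rfl
  uniq s m hm := by
    refine (StarFunctor.ext_onArrow fun a => limit_arrow_ext D fun j => ?_ :
      (Hom.toStar m) = _)
    exact congrArg (fun F : StarFunctor 𝕜 s.pt (D.obj j) => F.onArrow a) (hm j)

end Limits

instance : HasLimits (CStarCat.{u} 𝕜) where
  has_limits_of_shape _ _ := ⟨fun D => ⟨⟨⟨limitCone D, limitConeIsLimit D⟩⟩⟩⟩

end CStarCat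

/-! ### Free `*`-categories -/

/-- The free `*`-category over `𝕜` on a quiver with involution. -/
def FreeStar (𝕜 : Type) (V : Type u) : Type u := Free 𝕜 (Paths V)

namespace FreeStar

variable {𝕜 : Type} [RCLike 𝕜] {V : Type u} [Quiver.{u} V]

instance : Category.{u} (FreeStar 𝕜 V) := inferInstanceAs (Category (Free 𝕜 (Paths V)))

instance : Preadditive (FreeStar 𝕜 V) := inferInstanceAs (Preadditive (Free 𝕜 (Paths V)))

instance : Linear 𝕜 (FreeStar 𝕜 V) := inferInstanceAs (Linear 𝕜 (Free 𝕜 (Paths V)))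

/-- A vertex, as an object. -/
def ob (𝕜 : Type) {V : Type u} (x : V) : FreeStar 𝕜 V := x

/-- The additive map sending a scalar to the corresponding multiple of a path. -/
def single {x y : V} (p : Quiver.Path x y) : 𝕜 →+ (ob 𝕜 x ⟶ ob 𝕜 y) :=
  Finsupp.singleAddHom (M := 𝕜) (p : (show Paths V from x) ⟶ (show Paths V from y))

/-- An arrow of the quiver, as an arrow of the free `*`-category. -/
def gen {x y : V} (e : x ⟶ y) : ob 𝕜 x ⟶ ob 𝕜 y := single e.toPath 1

theorem single_comp_single {x y z : V} (p : Quiver.Path x y) (q : Quiver.Path y z) (r s : 𝕜) :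
    single p r ≫ single q s = single (p.comp q) (r * s) :=
  Free.single_comp_single 𝕜 (C := Paths V) p q r s

theorem smul_single {x y : V} (p : Quiver.Path x y) (r s : 𝕜) :
    r • single p s = single p (r * s) :=
  Finsupp.smul_single' r (p : (show Paths V from x) ⟶ (show Paths V from y)) s

theorem single_nil (x : V) : single Quiver.Path.nil (1 : 𝕜) = 𝟙 (ob 𝕜 x) := rfl

theorem induction {x y : V} {P : (ob 𝕜 x ⟶ ob 𝕜 y) → Prop} (f : ob 𝕜 x ⟶ ob 𝕜 y) (zero : P 0)
    (add : ∀ f g, P f → P g → P (f + g)) (single : ∀ p r, P (single p r)) : P f :=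
  Finsupp.induction_linear f zero (fun f g hf hg => add f g hf hg) single

theorem single_cons {x y z : V} (p : Quiver.Path x y) (e : y ⟶ z) (r : 𝕜) :
    single (p.cons e) r = single p r ≫ gen e := by
  rw [gen, single_comp_single, mul_one]
  rfl

/-- Paths are built by appending edges and composition is bilinear, so every arrow arises from
scalar multiples of identities by composing with generators on the right and adding. -/
theorem gen_induction {P : ∀ {x y : V}, (ob 𝕜 x ⟶ ob 𝕜 y) → Prop}
    (zero : ∀ {x y : V}, P (0 : ob 𝕜 x ⟶ ob 𝕜 y))
    (add : ∀ {x y : V} (f g : ob 𝕜 x ⟶ ob 𝕜 y), P f → P g → P (f + g))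
    (id : ∀ (x : V) (r : 𝕜), P (r • 𝟙 (ob 𝕜 x)))
    (comp_gen : ∀ {x y z : V} (f : ob 𝕜 x ⟶ ob 𝕜 y) (e : y ⟶ z), P f → P (f ≫ gen e))
    {x y : V} (f : ob 𝕜 x ⟶ ob 𝕜 y) : P f := by
  induction f using induction with
  | zero => exact zero
  | add f g hf hg => exact add f g hf hg
  | single p r =>
    induction p with
    | nil =>
      have := id x r
      rwa [← single_nil, smul_single, mul_one] at this
    | cons p e ih =>
      rw [single_cons]
      exact comp_gen _ e ih

/-- The linear functor induced by a morphism of quivers. -/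
def liftFunctor (𝕜 : Type) [RCLike 𝕜] {C : CStarCat.{u} 𝕜} (φ : V ⥤q C) : FreeStar 𝕜 V ⥤ C :=
  (Free.lift 𝕜 (Paths.lift φ) : Free 𝕜 (Paths V) ⥤ C)

section

variable {C : CStarCat.{u} 𝕜} (φ : V ⥤q C)

theorem liftFunctor_map_add {x y : FreeStar 𝕜 V} (f g : x ⟶ y) :
    (liftFunctor 𝕜 φ).map (f + g) = (liftFunctor 𝕜 φ).map f + (liftFunctor 𝕜 φ).map g :=
  (Free.lift 𝕜 (Paths.lift φ)).map_add

theorem liftFunctor_map_smul {x y : FreeStar 𝕜 V} (z : 𝕜) (f : x ⟶ y) :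
    (liftFunctor 𝕜 φ).map (z • f) = z • (liftFunctor 𝕜 φ).map f :=
  Functor.Linear.map_smul (F := Free.lift 𝕜 (Paths.lift φ)) f z

theorem liftFunctor_map_gen {x y : V} (e : x ⟶ y) :
    (liftFunctor 𝕜 φ).map (gen e) = φ.map e :=
  (Free.lift_map_single 𝕜 (Paths.lift φ) (e.toPath) 1).trans
    ((one_smul _ _).trans (Paths.lift_toPath φ e))

theorem liftFunctor_map_zero (x y : FreeStar 𝕜 V) :
    (liftFunctor 𝕜 φ).map (0 : x ⟶ y) = 0 := by
  rw [← zero_smul 𝕜 (0 : x ⟶ y), liftFunctor_map_smul, zero_smul]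

end

variable [Quiver.HasInvolutiveReverse V]

/-- The involution of the free `*`-category. -/
def adjHom (x y : V) : (ob 𝕜 x ⟶ ob 𝕜 y) →+ (ob 𝕜 y ⟶ ob 𝕜 x) :=
  Finsupp.liftAddHom fun p : Quiver.Path x y =>
    (single (𝕜 := 𝕜) p.reverse).comp (starRingEnd 𝕜).toAddMonoidHom

theorem adjHom_single {x y : V} (p : Quiver.Path x y) (r : 𝕜) :
    adjHom x y (single p r) = single p.reverse (starRingEnd 𝕜 r) :=
  Finsupp.liftAddHom_apply_single _ p r

theorem path_reverse_reverse {x y : V} (p : Quiver.Path x y) : p.reverse.reverse = p := by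
  induction p with
  | nil => rfl
  | cons p e ih => simp [Quiver.Path.reverse, ih]

theorem adjHom_smul {x y : V} (z : 𝕜) (f : ob 𝕜 x ⟶ ob 𝕜 y) :
    adjHom x y (z • f) = starRingEnd 𝕜 z • adjHom x y f := by
  induction f using induction with
  | zero => rw [smul_zero, map_zero, smul_zero]
  | add f g hf hg => rw [smul_add, map_add, map_add, smul_add, hf, hg]
  | single p r => rw [smul_single, adjHom_single, adjHom_single, smul_single, map_mul]

theorem adjHom_comp {x y w : V} (f : ob 𝕜 x ⟶ ob 𝕜 y) (g : ob 𝕜 y ⟶ ob 𝕜 w) :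
    adjHom x w (f ≫ g) = adjHom y w g ≫ adjHom x y f := by
  induction f using induction with
  | zero => rw [zero_comp, map_zero, map_zero, comp_zero]
  | add f f' hf hf' =>
    rw [Preadditive.add_comp, map_add, map_add, Preadditive.comp_add, hf, hf']
  | single p r =>
    induction g using induction with
    | zero => rw [comp_zero, map_zero, map_zero, zero_comp]
    | add g g' hg hg' =>
      rw [Preadditive.comp_add, map_add, map_add, Preadditive.add_comp, hg, hg']
    | single q s =>
      rw [single_comp_single, adjHom_single, adjHom_single, adjHom_single, single_comp_single,
        Quiver.Path.reverse_comp, map_mul, mul_comm]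

theorem adjHom_adjHom {x y : V} (f : ob 𝕜 x ⟶ ob 𝕜 y) : adjHom y x (adjHom x y f) = f := by
  induction f using induction with
  | zero => rw [map_zero, map_zero]
  | add f g hf hg => rw [map_add, map_add, hf, hg]
  | single p r => rw [adjHom_single, adjHom_single, path_reverse_reverse, RCLike.conj_conj]

instance : StarCategory 𝕜 (FreeStar 𝕜 V) where
  adj {x y} f := adjHom (𝕜 := 𝕜) (V := V) x y f
  adj_add {x y} f g := (adjHom (𝕜 := 𝕜) (V := V) x y).map_add f g
  adj_smul z f := adjHom_smul (𝕜 := 𝕜) (V := V) z f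
  adj_comp f g := adjHom_comp (𝕜 := 𝕜) (V := V) f g
  adj_adj f := adjHom_adjHom (𝕜 := 𝕜) (V := V) f

theorem adj_single {x y : V} (p : Quiver.Path x y) (r : 𝕜) :
    StarCategory.adj 𝕜 (single p r) = single p.reverse (starRingEnd 𝕜 r) :=
  adjHom_single p r

theorem adj_gen {x y : V} (e : x ⟶ y) :
    StarCategory.adj 𝕜 (gen (𝕜 := 𝕜) e) = gen (Quiver.reverse e) := by
  rw [gen, adj_single, map_one, Quiver.Path.reverse_toPath]
  rfl

theorem hom_ext {C : CStarCat.{u} 𝕜} {F G : StarFunctor 𝕜 (FreeStar 𝕜 V) C}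
    (hobj : ∀ x : V, F.obj (ob 𝕜 x) = G.obj (ob 𝕜 x))
    (hgen : ∀ {x y : V} (e : x ⟶ y),
      F.map (gen e) = eqToHom (hobj x) ≫ G.map (gen e) ≫ eqToHom (hobj y).symm) : F = G := by
  refine StarFunctor.ext_map hobj fun {x y} f => ?_
  exact gen_induction (𝕜 := 𝕜) (V := V)
    (P := fun {x y} f => F.map f = eqToHom (hobj x) ≫ G.map f ≫ eqToHom (hobj y).symm)
    (by simp [StarFunctor.map_zero])
    (fun f g hf hg => by simp [StarFunctor.map_add, hf, hg])
    (fun x r => by simp [StarFunctor.map_smul])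
    (fun f e hf => by simp [hf, hgen]) f

section

variable {C : CStarCat.{u} 𝕜} (φ : V ⥤q C)

theorem liftFunctor_map_adj
    (hφ : ∀ {x y : V} (e : x ⟶ y), φ.map (Quiver.reverse e) = CStarCat.star (φ.map e))
    {x y : V} (f : ob 𝕜 x ⟶ ob 𝕜 y) :
    (liftFunctor 𝕜 φ).map (StarCategory.adj 𝕜 f) =
      StarCategory.adj 𝕜 ((liftFunctor 𝕜 φ).map f) :=
  gen_induction (𝕜 := 𝕜) (V := V) (P := fun {x y} f =>
      (liftFunctor 𝕜 φ).map (StarCategory.adj 𝕜 f) =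
        StarCategory.adj 𝕜 ((liftFunctor 𝕜 φ).map f))
    (by simp [liftFunctor_map_zero, StarCategory.adj_zero])
    (fun f g hf hg => by
      simp only [liftFunctor_map_add, StarCategory.adj_add, hf, hg])
    (fun x r => by
      simp only [liftFunctor_map_smul, StarCategory.adj_smul, StarCategory.adj_id,
        CategoryTheory.Functor.map_id])
    (fun f e hf => by
      rw [StarCategory.adj_comp, CategoryTheory.Functor.map_comp, adj_gen,
        CategoryTheory.Functor.map_comp, StarCategory.adj_comp, hf, liftFunctor_map_gen,
        liftFunctor_map_gen, hφ]
      rfl) f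

/-- The `*`-functor induced by a morphism of quivers compatible with the involutions. -/
def lift (hφ : ∀ {x y : V} (e : x ⟶ y), φ.map (Quiver.reverse e) = CStarCat.star (φ.map e)) :
    StarFunctor 𝕜 (FreeStar 𝕜 V) C where
  toFunctor := liftFunctor 𝕜 φ
  map_add := liftFunctor_map_add φ
  map_smul := liftFunctor_map_smul φ
  map_adj f := liftFunctor_map_adj φ hφ f

end

end FreeStar

/-! ### Colimits -/

namespace CStarCat

variable {𝕜 : Type} [RCLike 𝕜]

section Colimits

variable {J : Type u} [Category.{u} J] (D : J ⥤ CStarCat.{u} 𝕜)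

/-- The relation defining the objects of a colimit. -/
inductive ColimitRel : (Σ j : J, D.obj j) → (Σ j : J, D.obj j) → Prop
  | map {i j : J} (φ : i ⟶ j) (x : D.obj i) : ColimitRel ⟨i, x⟩ ⟨j, (diagMap D φ).obj x⟩

/-- The objects of a colimit. -/
def ColimitObj : Type u := Quot (ColimitRel D)

/-- The object of the colimit given by an object of the diagram. -/
def ColimitObj.mk {D : J ⥤ CStarCat.{u} 𝕜} {j : J} (x : D.obj j) : ColimitObj D :=
  Quot.mk _ ⟨j, x⟩

/-- The generating arrows of a colimit. -/
inductive ColimitGen : ColimitObj D → ColimitObj D → Type u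
  | mk {j : J} {x y : D.obj j} (a : x ⟶ y) : ColimitGen (ColimitObj.mk x) (ColimitObj.mk y)

instance : Quiver.{u} (ColimitObj D) := ⟨ColimitGen D⟩

instance : Quiver.HasInvolutiveReverse (ColimitObj D) where
  reverse' := fun ⟨a⟩ => ⟨star a⟩
  inv' := by
    rintro _ _ ⟨a⟩
    exact congrArg ColimitGen.mk (star_star a)

/-- A generating arrow of a colimit. -/
def colimitGen {D : J ⥤ CStarCat.{u} 𝕜} {j : J} {x y : D.obj j} (a : x ⟶ y) :
    ColimitObj.mk x ⟶ ColimitObj.mk y := ColimitGen.mk a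

/-- The morphism of quivers given by a cocone. -/
def colimitPrefunctor {C : CStarCat.{u} 𝕜} (γ : D ⟶ (Functor.const J).obj C) :
    ColimitObj D ⥤q C where
  obj := Quot.lift (fun p => (Hom.toStar (γ.app p.1)).obj p.2) (by
    rintro _ _ ⟨φ, x⟩
    exact (StarFunctor.congr_obj
      ((γ.naturality φ).trans (Category.comp_id _) : D.map φ ≫ γ.app _ = γ.app _) x).symm)
  map := fun ⟨a⟩ => (Hom.toStar (γ.app _)).map a

/-- The representation given by a cocone. -/
def colimitRep {C : CStarCat.{u} 𝕜} (γ : D ⟶ (Functor.const J).obj C) :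
    StarFunctor 𝕜 (FreeStar 𝕜 (ColimitObj D)) C :=
  FreeStar.lift (colimitPrefunctor D γ) (by
    rintro _ _ ⟨a⟩
    exact (Hom.toStar (γ.app _)).map_adj a)

theorem colimitRep_gen {C : CStarCat.{u} 𝕜} (γ : D ⟶ (Functor.const J).obj C) {j : J}
    {x y : D.obj j} (a : x ⟶ y) :
    (colimitRep D γ).map (FreeStar.gen (colimitGen a)) = (Hom.toStar (γ.app j)).map a :=
  FreeStar.liftFunctor_map_gen (colimitPrefunctor D γ) (colimitGen a)

/-- The class of the representations given by cocones. -/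
def colimitClass : RepClass.{u} 𝕜 (FreeStar 𝕜 (ColimitObj D)) where
  P C σ := ∃ γ : D ⟶ (Functor.const J).obj C, σ = colimitRep D γ
  bdd {x y} f := by
    refine FreeStar.gen_induction (𝕜 := 𝕜) (V := ColimitObj D)
      (P := fun {x y} f => ∃ K : ℝ, ∀ (C : CStarCat.{u} 𝕜)
        (σ : StarFunctor 𝕜 (FreeStar 𝕜 (ColimitObj D)) C),
        (∃ γ : D ⟶ (Functor.const J).obj C, σ = colimitRep D γ) → ‖σ.map f‖ ≤ K)
      ?_ ?_ ?_ ?_ f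
    · exact ⟨0, fun C σ _ => by rw [StarFunctor.map_zero, norm_zero]⟩
    · rintro x y f g ⟨K, hK⟩ ⟨L, hL⟩
      exact ⟨K + L, fun C σ h => by
        rw [σ.map_add]
        exact (norm_add_le _ _).trans (add_le_add (hK C σ h) (hL C σ h))⟩
    · intro x r
      exact ⟨‖r‖ * 1, fun C σ h => by
        rw [σ.map_smul, norm_smul, σ.map_id]
        exact mul_le_mul_of_nonneg_left (norm_id_le _) (norm_nonneg _)⟩
    -- A generator is an arrow `a` of some category of the diagram, on which every cocone is
    -- contractive; each appended generator costs a factor ‖a‖.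
    · rintro x _ _ f ⟨a⟩ ⟨K, hK⟩
      refine ⟨K * ‖a‖, ?_⟩
      rintro C σ ⟨γ, rfl⟩
      have h1 := hK C _ ⟨γ, rfl⟩
      rw [CategoryTheory.Functor.map_comp]
      refine (norm_comp_le _ _).trans (mul_le_mul h1 ?_ (norm_nonneg _) ((norm_nonneg _).trans h1))
      refine (le_of_eq (congrArg norm (colimitRep_gen D γ a))).trans (norm_map_le _ a)

/-- The free *-category forgets sums, composites and adjoints in the categories of the diagram. An
identity between its arrows holds in the colimit once every cocone satisfies it, and this is how the
legs become *-functors compatible with the diagram. -/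
theorem colimit_map_eq {x y : FreeStar 𝕜 (ColimitObj D)} {f g : x ⟶ y}
    (h : ∀ (C : CStarCat.{u} 𝕜) (γ : D ⟶ (Functor.const J).obj C),
      (colimitRep D γ).map f = (colimitRep D γ).map g) :
    (colimitClass D).can.map f = (colimitClass D).can.map g :=
  (colimitClass D).can_map_eq (by
    rintro C _ ⟨γ, rfl⟩
    exact h C γ)

/-- The `*`-functors to the colimit. -/
def colimitι (j : J) : StarFunctor 𝕜 (D.obj j) ((colimitClass D).univ) where
  obj x := (colimitClass D).can.obj (FreeStar.ob 𝕜 (ColimitObj.mk x))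
  map a := (colimitClass D).can.map (FreeStar.gen (colimitGen a))
  map_id x := by
    rw [← CategoryTheory.Functor.map_id]
    refine colimit_map_eq D fun C γ => ?_
    rw [colimitRep_gen, CategoryTheory.Functor.map_id, CategoryTheory.Functor.map_id]
    rfl
  map_comp a b := by
    rw [← CategoryTheory.Functor.map_comp]
    refine colimit_map_eq D fun C γ => ?_
    rw [colimitRep_gen, CategoryTheory.Functor.map_comp, CategoryTheory.Functor.map_comp,
      colimitRep_gen, colimitRep_gen]
    rfl
  map_add a b := by
    rw [← StarFunctor.map_add]
    refine colimit_map_eq D fun C γ => ?_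
    rw [colimitRep_gen, StarFunctor.map_add, StarFunctor.map_add, colimitRep_gen, colimitRep_gen]
    rfl
  map_smul z a := by
    rw [← StarFunctor.map_smul]
    refine colimit_map_eq D fun C γ => ?_
    rw [colimitRep_gen, StarFunctor.map_smul, StarFunctor.map_smul, colimitRep_gen]
    rfl
  map_adj a := by
    rw [← StarFunctor.map_adj]
    refine colimit_map_eq D fun C γ => ?_
    rw [colimitRep_gen, StarFunctor.map_adj, StarFunctor.map_adj, colimitRep_gen]
    rfl

theorem colimitι_naturality {i j : J} (φ : i ⟶ j) :
    (diagMap D φ).comp (colimitι D j) = colimitι D i := by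
  have hobj : ∀ x : D.obj i, FreeStar.ob 𝕜 (ColimitObj.mk ((diagMap D φ).obj x)) =
      FreeStar.ob 𝕜 (ColimitObj.mk (D := D) x) := fun x =>
    (Quot.sound (ColimitRel.map φ x)).symm
  refine StarFunctor.ext_map (fun x => congrArg _ (hobj x)) fun {x y} a => ?_
  have h := colimit_map_eq D
    (f := FreeStar.gen (𝕜 := 𝕜) (colimitGen ((diagMap D φ).map a)))
    (g := eqToHom (hobj x) ≫ FreeStar.gen (colimitGen a) ≫ eqToHom (hobj y).symm) fun C γ => by
      have hγ : (diagMap D φ).comp (γ.app j) = γ.app i :=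
        (γ.naturality φ).trans (Category.comp_id _)
      have h1 := StarFunctor.congr_map hγ a
      rw [CategoryTheory.Functor.map_comp, CategoryTheory.Functor.map_comp, colimitRep_gen,
        colimitRep_gen, eqToHom_map, eqToHom_map]
      exact h1
  rw [CategoryTheory.Functor.map_comp, CategoryTheory.Functor.map_comp, eqToHom_map,
    eqToHom_map] at h
  exact h

/-- The colimit cocone. -/
def colimitCocone : Cocone D where
  pt := (colimitClass D).univ
  ι :=
    { app := fun j => colimitι D j
      naturality := fun i _ φ =>
        (colimitι_naturality D φ).trans
          (Category.comp_id (show D.obj i ⟶ (colimitClass D).univ from colimitι D i)).symm }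

/-- The colimit cocone is a colimit cocone. -/
def colimitCoconeIsColimit : IsColimit (colimitCocone D) where
  desc s := (colimitClass D).lift (colimitRep D s.ι) ⟨s.ι, rfl⟩
  fac s j := by
    refine (StarFunctor.ext_onArrow fun a => ?_ : (colimitι D j).comp
      ((colimitClass D).lift (colimitRep D s.ι) ⟨s.ι, rfl⟩) = s.ι.app j)
    exact congrArg Arrow.mk (((colimitClass D).lift_map_can (colimitRep D s.ι) ⟨s.ι, rfl⟩
      (FreeStar.gen (colimitGen a.hom))).trans (colimitRep_gen D s.ι a.hom))
  uniq s m hm := by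
    refine (colimitClass D).hom_ext (Eq.trans ?_
      ((colimitClass D).can_comp_lift (colimitRep D s.ι) ⟨s.ι, rfl⟩).symm)
    refine FreeStar.hom_ext ?_ ?_
    · rintro ⟨j, x⟩
      exact StarFunctor.congr_obj (hm j) x
    · rintro _ _ ⟨a⟩
      refine (StarFunctor.congr_map (hm _) a).trans ?_
      rw [← colimitRep_gen]
      rfl

end Colimits

instance : HasColimits (CStarCat.{u} 𝕜) where
  has_colimits_of_shape _ _ := ⟨fun D => ⟨⟨⟨colimitCocone D, colimitCoconeIsColimit D⟩⟩⟩⟩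

end CStarCat

/-! ### The maximal tensor product -/

namespace AlgTensor

variable {𝕜 : Type} [RCLike 𝕜]
  {A : Type u₁} [Category.{v₁} A] [Preadditive A] [Linear 𝕜 A]
  {B : Type u₂} [Category.{v₂} B] [Preadditive B] [Linear 𝕜 B]

theorem tmul_comp {x x' x'' : A} {y y' y'' : B} (a : x ⟶ x') (a' : x' ⟶ x'') (b : y ⟶ y')
    (b' : y' ⟶ y'') :
    tmul (𝕜 := 𝕜) a b ≫ tmul a' b' = tmul (a ≫ a') (b ≫ b') := rfl

theorem tmul_id (x : A) (y : B) : tmul (𝕜 := 𝕜) (𝟙 x) (𝟙 y) = 𝟙 _ := rfl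

theorem tmul_eq {x x' : A} {y y' : B} (a : x ⟶ x') (b : y ⟶ y') :
    tmul (𝕜 := 𝕜) a b = tmul a (𝟙 y) ≫ tmul (𝟙 x') b := by
  rw [tmul_comp, Category.comp_id, Category.id_comp]

theorem induction {p q : AlgTensor 𝕜 A B} {P : (p ⟶ q) → Prop} (f : p ⟶ q) (zero : P 0)
    (add : ∀ f g, P f → P g → P (f + g))
    (tmul : ∀ (a : p.fst ⟶ q.fst) (b : p.snd ⟶ q.snd), P (tmul a b)) : P f :=
  TensorProduct.induction_on f zero tmul add

variable [StarCategory 𝕜 A] [StarCategory 𝕜 B]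

theorem adj_tmul {x x' : A} {y y' : B} (a : x ⟶ x') (b : y ⟶ y') :
    StarCategory.adj 𝕜 (tmul (𝕜 := 𝕜) a b) =
      tmul (StarCategory.adj 𝕜 a) (StarCategory.adj 𝕜 b) := rfl

/-- The embedding of the first factor at an object of the second one. -/
def inl (y : B) : StarFunctor 𝕜 A (AlgTensor 𝕜 A B) where
  obj x := ⟨x, y⟩
  map a := tmul a (𝟙 y)
  map_id _ := rfl
  map_comp a a' := by rw [tmul_comp, Category.comp_id]
  map_add a a' := TensorProduct.add_tmul a a' (𝟙 y)
  map_smul z a := (TensorProduct.smul_tmul' z a (𝟙 y)).symm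
  map_adj a := by rw [adj_tmul, StarCategory.adj_id]

/-- The embedding of the second factor at an object of the first one. -/
def inr (x : A) : StarFunctor 𝕜 B (AlgTensor 𝕜 A B) where
  obj y := ⟨x, y⟩
  map b := tmul (𝟙 x) b
  map_id _ := rfl
  map_comp b b' := by rw [tmul_comp, Category.comp_id]
  map_add b b' := TensorProduct.tmul_add (𝟙 x) b b'
  map_smul z b := TensorProduct.tmul_smul z (𝟙 x) b
  map_adj b := by rw [adj_tmul, StarCategory.adj_id]

end AlgTensor

namespace CStarCat

variable {𝕜 : Type} [RCLike 𝕜]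

/-- All `*`-functors from the algebraic tensor product. -/
def tensClass (A B : CStarCat.{u} 𝕜) : RepClass.{u} 𝕜 (AlgTensor 𝕜 A B) where
  P _ _ := True
  bdd {p q} f := by
    induction f using AlgTensor.induction with
    | zero => exact ⟨0, fun C σ _ => by rw [StarFunctor.map_zero, norm_zero]⟩
    | add f g hf hg =>
      obtain ⟨K, hK⟩ := hf
      obtain ⟨L, hL⟩ := hg
      exact ⟨K + L, fun C σ h => by
        rw [σ.map_add]
        exact (norm_add_le _ _).trans (add_le_add (hK C σ h) (hL C σ h))⟩
    | tmul a b =>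
      -- Since a ⊗ b = (a ⊗ 1)(1 ⊗ b), and σ restricted to either factor is a *-functor between
      -- C*-categories, contractivity bounds σ(a ⊗ b) independently of σ.
      refine ⟨‖a‖ * ‖b‖, fun C σ _ => ?_⟩
      rw [AlgTensor.tmul_eq, CategoryTheory.Functor.map_comp]
      exact (norm_comp_le _ _).trans (mul_le_mul
        (norm_map_le ((AlgTensor.inl (𝕜 := 𝕜) p.snd).comp σ) a)
        (norm_map_le ((AlgTensor.inr (𝕜 := 𝕜) q.fst).comp σ) b) (norm_nonneg _) (norm_nonneg _))

/-- The maximal tensor product. -/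
def tens (A B : CStarCat.{u} 𝕜) : CStarCat.{u} 𝕜 := (tensClass A B).univ

/-- The canonical `*`-functor from the algebraic tensor product to the maximal one. -/
def tensCan (A B : CStarCat.{u} 𝕜) : StarFunctor 𝕜 (AlgTensor 𝕜 A B) (tens A B) :=
  (tensClass A B).can

/-- The factorization of a `*`-functor through the maximal tensor product. -/
def tensLift {A B C : CStarCat.{u} 𝕜} (σ : StarFunctor 𝕜 (AlgTensor 𝕜 A B) C) :
    tens A B ⟶ C :=
  (tensClass A B).lift σ trivial

theorem tensCan_comp_tensLift {A B C : CStarCat.{u} 𝕜}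
    (σ : StarFunctor 𝕜 (AlgTensor 𝕜 A B) C) : (tensCan A B).comp (tensLift σ) = σ :=
  (tensClass A B).can_comp_lift σ trivial

theorem tensCan_hom_ext {A B C : CStarCat.{u} 𝕜} {F G : StarFunctor 𝕜 (tens A B) C}
    (h : (tensCan A B).comp F = (tensCan A B).comp G) : F = G :=
  (tensClass A B).hom_ext h

theorem isEnveloping_tensCan (A B : CStarCat.{u} 𝕜) : IsEnveloping (tensCan A B) :=
  fun _ σ => ⟨tensLift σ, tensCan_comp_tensLift σ,
    fun _ hτ => tensCan_hom_ext (hτ.trans (tensCan_comp_tensLift σ).symm)⟩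

/-- The object map of a morphism. -/
def ob {A B : CStarCat.{u} 𝕜} (F : A ⟶ B) (x : A) : B := (Hom.toStar F).obj x

@[simp] theorem ob_id {A : CStarCat.{u} 𝕜} (x : A) : ob (𝟙 A) x = x := rfl

@[simp] theorem ob_comp {A B C : CStarCat.{u} 𝕜} (F : A ⟶ B) (G : B ⟶ C) (x : A) :
    ob (F ≫ G) x = ob G (ob F x) := rfl

section

variable {A B C D : CStarCat.{u} 𝕜}

/-- A pair of objects, as an object of the tensor product. -/
def tpair (x : A) (y : B) : tens A B := (tensCan A B).obj ⟨x, y⟩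

/-- The first component of an object of the tensor product. -/
def tfst (p : tens A B) : A := ((tensClass A B).objVal p).fst

/-- The second component of an object of the tensor product. -/
def tsnd (p : tens A B) : B := ((tensClass A B).objVal p).snd

@[simp] theorem tfst_tpair (x : A) (y : B) : tfst (tpair x y) = x := rfl

@[simp] theorem tsnd_tpair (x : A) (y : B) : tsnd (tpair x y) = y := rfl

@[simp] theorem tpair_eta (p : tens A B) : tpair (tfst p) (tsnd p) = p := rfl

/-- The embedding of the first factor at an object of the second one. -/
def tinl (A : CStarCat.{u} 𝕜) {B : CStarCat.{u} 𝕜} (y : B) : A ⟶ tens A B :=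
  (AlgTensor.inl y).comp (tensCan A B)

/-- The embedding of the second factor at an object of the first one. -/
def tinr {A : CStarCat.{u} 𝕜} (x : A) (B : CStarCat.{u} 𝕜) : B ⟶ tens A B :=
  (AlgTensor.inr x).comp (tensCan A B)

@[simp] theorem ob_tinl (x : A) (y : B) : ob (tinl A y) x = tpair x y := rfl

@[simp] theorem ob_tinr (x : A) (y : B) : ob (tinr x B) y = tpair x y := rfl

/-- The arrow `a ⊗ 1` of the tensor product. -/
def mapl {x x' : A} (a : x ⟶ x') (y : B) : tpair x y ⟶ tpair x' y := (Hom.toStar (tinl A y)).map a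

/-- The arrow `1 ⊗ b` of the tensor product. -/
def mapr (x : A) {y y' : B} (b : y ⟶ y') : tpair x y ⟶ tpair x y' := (Hom.toStar (tinr x B)).map b

theorem tensCan_tmul {x x' : A} {y y' : B} (a : x ⟶ x') (b : y ⟶ y') :
    (tensCan A B).map (AlgTensor.tmul a b) = mapl a y ≫ mapr x' b := by
  rw [AlgTensor.tmul_eq, CategoryTheory.Functor.map_comp]
  rfl

theorem mapl_comp_mapr {x x' : A} {y y' : B} (a : x ⟶ x') (b : y ⟶ y') :
    mapl a y ≫ mapr x' b = mapr x b ≫ mapl a y' := by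
  have h := AlgTensor.tmul_comp (𝕜 := 𝕜) (𝟙 x) a b (𝟙 y')
  rw [Category.id_comp, Category.comp_id] at h
  rw [← tensCan_tmul, ← h, CategoryTheory.Functor.map_comp]
  rfl

theorem tens_induction {x x' : A} {y y' : B} {P : (tpair x y ⟶ tpair x' y') → Prop}
    (hP : IsClosed {f | P f}) (zero : P 0) (add : ∀ f g, P f → P g → P (f + g))
    (elem : ∀ (a : x ⟶ x') (b : y ⟶ y'), P (mapl a y ≫ mapr x' b))
    (f : tpair x y ⟶ tpair x' y') : P f := by
  refine (tensClass A B).hom_induction (x := ⟨x, y⟩) (y := ⟨x', y'⟩) hP (fun f => ?_) f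
  induction f using AlgTensor.induction with
  | zero => rw [map_zero]; exact zero
  | add f g hf hg => rw [map_add]; exact add _ _ hf hg
  | tmul a b =>
    have h := elem a b
    rw [← tensCan_tmul] at h
    exact h

/-- A family of arrows between `*`-functors on a tensor product is natural if it is natural in
each variable. -/
theorem tens_natural {L L' : StarFunctor 𝕜 (tens A B) C} (r : ∀ p, L.obj p ⟶ L'.obj p)
    (hl : ∀ (y : B) {x x' : A} (a : x ⟶ x'),
      L.map (mapl a y) ≫ r (tpair x' y) = r (tpair x y) ≫ L'.map (mapl a y))
    (hr : ∀ (x : A) {y y' : B} (b : y ⟶ y'),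
      L.map (mapr x b) ≫ r (tpair x y') = r (tpair x y) ≫ L'.map (mapr x b))
    {p q : tens A B} (f : p ⟶ q) : L.map f ≫ r q = r p ≫ L'.map f := by
  have key : ∀ {x x' : A} {y y' : B} (f : tpair x y ⟶ tpair x' y'),
      L.map f ≫ r _ = r _ ≫ L'.map f := by
    intro x x' y y' f
    induction f using tens_induction with
    | hP =>
      exact isClosed_eq (continuous_comp.comp ((continuous_map L).prodMk continuous_const))
        (continuous_comp.comp (continuous_const.prodMk (continuous_map L')))
    | zero => rw [StarFunctor.map_zero, StarFunctor.map_zero, zero_comp, comp_zero]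
    | add f g hf hg =>
      rw [L.map_add, L'.map_add, Preadditive.add_comp, Preadditive.comp_add, hf, hg]
    | elem a b =>
      rw [CategoryTheory.Functor.map_comp, CategoryTheory.Functor.map_comp, Category.assoc, hr,
        ← Category.assoc, hl, Category.assoc]
  exact key (x := tfst p) (x' := tfst q) (y := tsnd p) (y' := tsnd q) f

/-- The arrows (a ⊗ 1)(1 ⊗ b) span a dense subspace of each Hom space, so the slices in the two
variables determine a morphism. Every coherence identity is reduced by this to identities between
composites with slice embeddings. -/
theorem tens_hom_ext {F G : tens A B ⟶ C} (hl : ∀ y : B, tinl A y ≫ F = tinl A y ≫ G)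
    (hr : ∀ x : A, tinr x B ≫ F = tinr x B ≫ G) : F = G := by
  have hobj : ∀ x y, (Hom.toStar F).obj (tpair x y) = (Hom.toStar G).obj (tpair x y) :=
    fun x y => StarFunctor.congr_obj (hl y) x
  have key : ∀ {x x' : A} {y y' : B} (f : tpair x y ⟶ tpair x' y'), (Hom.toStar F).map f =
      eqToHom (hobj x y) ≫ (Hom.toStar G).map f ≫ eqToHom (hobj x' y').symm := by
    intro x x' y y' f
    induction f using tens_induction with
    | hP =>
      exact isClosed_eq (continuous_map _) (continuous_comp.comp (continuous_const.prodMk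
        (continuous_comp.comp ((continuous_map _).prodMk continuous_const))))
    | zero => simp [StarFunctor.map_zero]
    | add f g hf hg =>
      rw [StarFunctor.map_add, StarFunctor.map_add, Preadditive.add_comp, Preadditive.comp_add,
        hf, hg]
    | elem a b =>
      have h1 : (Hom.toStar F).map (mapl a y) = eqToHom (hobj _ _) ≫
        (Hom.toStar G).map (mapl a y) ≫ eqToHom (hobj _ _).symm :=
          StarFunctor.congr_map (hl y) a
      have h2 : (Hom.toStar F).map (mapr x' b) = eqToHom (hobj _ _) ≫
        (Hom.toStar G).map (mapr x' b) ≫ eqToHom (hobj _ _).symm :=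
          StarFunctor.congr_map (hr x') b
      rw [CategoryTheory.Functor.map_comp, CategoryTheory.Functor.map_comp, h1, h2]
      simp
  exact StarFunctor.ext_map (fun p => hobj (tfst p) (tsnd p)) fun {p q} f =>
    key (x := tfst p) (x' := tfst q) (y := tsnd p) (y' := tsnd q) f

end

/-! ### *-functors of two variables -/

/-- A `*`-functor of two variables. -/
structure Bimap (A B C : CStarCat.{u} 𝕜) where
  obj : A → B → C
  left : ∀ (y : B) {x x' : A}, (x ⟶ x') → (obj x y ⟶ obj x' y)
  right : ∀ (x : A) {y y' : B}, (y ⟶ y') → (obj x y ⟶ obj x y')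
  left_id : ∀ y x, left y (𝟙 x) = 𝟙 _
  left_comp : ∀ y {x x' x'' : A} (a : x ⟶ x') (a' : x' ⟶ x''),
    left y (a ≫ a') = left y a ≫ left y a'
  left_add : ∀ y {x x' : A} (a a' : x ⟶ x'), left y (a + a') = left y a + left y a'
  left_smul : ∀ y {x x' : A} (z : 𝕜) (a : x ⟶ x'), left y (z • a) = z • left y a
  left_star : ∀ y {x x' : A} (a : x ⟶ x'), left y (star a) = star (left y a)
  right_id : ∀ x y, right x (𝟙 y) = 𝟙 _
  right_comp : ∀ x {y y' y'' : B} (b : y ⟶ y') (b' : y' ⟶ y''),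
    right x (b ≫ b') = right x b ≫ right x b'
  right_add : ∀ x {y y' : B} (b b' : y ⟶ y'), right x (b + b') = right x b + right x b'
  right_smul : ∀ x {y y' : B} (z : 𝕜) (b : y ⟶ y'), right x (z • b) = z • right x b
  right_star : ∀ x {y y' : B} (b : y ⟶ y'), right x (star b) = star (right x b)
  comm : ∀ {x x' : A} {y y' : B} (a : x ⟶ x') (b : y ⟶ y'),
    left y a ≫ right x' b = right x b ≫ left y' a

namespace Bimap

variable {A B C : CStarCat.{u} 𝕜} (β : Bimap A B C)

/-- A `*`-functor of two variables with the second variable fixed. -/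
def fixRight (y : B) : A ⟶ C :=
  { obj := fun x => β.obj x y
    map := fun a => β.left y a
    map_id := β.left_id y
    map_comp := β.left_comp y
    map_add := β.left_add y
    map_smul := β.left_smul y
    map_adj := β.left_star y : StarFunctor 𝕜 A C }

/-- A `*`-functor of two variables with the first variable fixed. -/
def fixLeft (x : A) : B ⟶ C :=
  { obj := fun y => β.obj x y
    map := fun b => β.right x b
    map_id := β.right_id x
    map_comp := β.right_comp x
    map_add := β.right_add x
    map_smul := β.right_smul x
    map_adj := β.right_star x : StarFunctor 𝕜 B C }

/-- The linear map on a Hom space of the algebraic tensor product. -/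
def mapLinear (p q : AlgTensor 𝕜 A B) :
    (p ⟶ q) →ₗ[𝕜] (β.obj p.fst p.snd ⟶ β.obj q.fst q.snd) :=
  TensorProduct.lift (LinearMap.mk₂ 𝕜 (fun a b => β.left p.snd a ≫ β.right q.fst b)
    (fun a a' b => by rw [β.left_add, Preadditive.add_comp])
    (fun z a b => by rw [β.left_smul, Linear.smul_comp])
    (fun a b b' => by rw [β.right_add, Preadditive.comp_add])
    (fun z a b => by rw [β.right_smul, Linear.comp_smul]))

theorem mapLinear_tmul {x x' : A} {y y' : B} (a : x ⟶ x') (b : y ⟶ y') :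
    β.mapLinear ⟨x, y⟩ ⟨x', y'⟩ (AlgTensor.tmul a b) = β.left y a ≫ β.right x' b := rfl

/-- The `*`-functor on the algebraic tensor product. -/
def toStarFunctor : StarFunctor 𝕜 (AlgTensor 𝕜 A B) C where
  obj p := β.obj p.fst p.snd
  map {p q} f := β.mapLinear p q f
  map_id p := by
    rw [← AlgTensor.tmul_id, mapLinear_tmul, β.left_id, β.right_id, Category.comp_id]
  map_comp {p q r} f g := by
    induction f using AlgTensor.induction with
    | zero => rw [zero_comp, map_zero, map_zero, zero_comp]
    | add f f' hf hf' =>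
      rw [Preadditive.add_comp, map_add, map_add, Preadditive.add_comp, hf, hf']
    | tmul a b =>
      induction g using AlgTensor.induction with
      | zero => rw [comp_zero, map_zero, map_zero, comp_zero]
      | add g g' hg hg' =>
        rw [Preadditive.comp_add, map_add, map_add, Preadditive.comp_add, hg, hg']
      -- Multiplicativity on elementary tensors requires moving b past a', which is the exchange law
      -- `comm`.
      | tmul a' b' =>
        rw [AlgTensor.tmul_comp, mapLinear_tmul, mapLinear_tmul, mapLinear_tmul, β.left_comp,
          β.right_comp, Category.assoc, Category.assoc, ← Category.assoc (β.right _ b), ← β.comm,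
          Category.assoc]
  map_add f g := map_add _ f g
  map_smul z f := map_smul _ z f
  map_adj {p q} f := by
    induction f using AlgTensor.induction with
    | zero => rw [StarCategory.adj_zero, map_zero, map_zero, StarCategory.adj_zero]
    | add f g hf hg =>
      rw [StarCategory.adj_add, map_add, map_add, StarCategory.adj_add, hf, hg]
    -- The adjoint reverses the order of the two factors and `comm` restores it.
    | tmul a b =>
      rw [AlgTensor.adj_tmul, mapLinear_tmul, mapLinear_tmul, β.comm, ← star_def, ← star_def,
        ← star_def, star_comp, β.left_star, β.right_star]

/-- The induced morphism on the maximal tensor product. -/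
def lift : tens A B ⟶ C := tensLift β.toStarFunctor

theorem lift_mapl {x x' : A} (a : x ⟶ x') (y : B) :
    (Hom.toStar β.lift).map (mapl a y) = β.left y a := by
  refine ((tensClass A B).lift_map_can β.toStarFunctor trivial
    (AlgTensor.tmul a (𝟙 y))).trans ?_
  change β.left y a ≫ β.right x' (𝟙 y) = β.left y a
  rw [β.right_id, Category.comp_id]

theorem lift_mapr (x : A) {y y' : B} (b : y ⟶ y') :
    (Hom.toStar β.lift).map (mapr x b) = β.right x b := by
  refine ((tensClass A B).lift_map_can β.toStarFunctor trivial
    (AlgTensor.tmul (𝟙 x) b)).trans ?_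
  change β.left y (𝟙 x) ≫ β.right x b = β.right x b
  rw [β.left_id, Category.id_comp]

theorem tinl_lift (y : B) : tinl A y ≫ β.lift = β.fixRight y :=
  StarFunctor.ext_onArrow fun a => congrArg Arrow.mk (β.lift_mapl a.hom y)

theorem tinr_lift (x : A) : tinr x B ≫ β.lift = β.fixLeft x :=
  StarFunctor.ext_onArrow fun b => congrArg Arrow.mk (β.lift_mapr x b.hom)

end Bimap

end CStarCat

/-! ### The symmetric monoidal structure -/

namespace CStarCat

variable {𝕜 : Type} [RCLike 𝕜]

section

variable {A B C D A' B' C' : CStarCat.{u} 𝕜}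

/-- Functoriality of the tensor product, as a `*`-functor of two variables. -/
def homBimap (F : A ⟶ A') (G : B ⟶ B') : Bimap A B (tens A' B') where
  obj x y := tpair (ob F x) (ob G y)
  left y _ _ a := mapl ((Hom.toStar F).map a) (ob G y)
  right x _ _ b := mapr (ob F x) ((Hom.toStar G).map b)
  left_id y := (Hom.toStar (F ≫ tinl A' (ob G y))).map_id
  left_comp y _ _ _ := (Hom.toStar (F ≫ tinl A' (ob G y))).map_comp
  left_add y _ _ := (Hom.toStar (F ≫ tinl A' (ob G y))).map_add
  left_smul y _ _ := (Hom.toStar (F ≫ tinl A' (ob G y))).map_smul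
  left_star y _ _ := (Hom.toStar (F ≫ tinl A' (ob G y))).map_adj
  right_id x := (Hom.toStar (G ≫ tinr (ob F x) B')).map_id
  right_comp x _ _ _ := (Hom.toStar (G ≫ tinr (ob F x) B')).map_comp
  right_add x _ _ := (Hom.toStar (G ≫ tinr (ob F x) B')).map_add
  right_smul x _ _ := (Hom.toStar (G ≫ tinr (ob F x) B')).map_smul
  right_star x _ _ := (Hom.toStar (G ≫ tinr (ob F x) B')).map_adj
  comm _ _ := mapl_comp_mapr _ _

/-- Functoriality of the tensor product. -/
def tensHom (F : A ⟶ A') (G : B ⟶ B') : tens A B ⟶ tens A' B' := (homBimap F G).lift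

@[simp] theorem ob_tensHom (F : A ⟶ A') (G : B ⟶ B') (p : tens A B) :
    ob (tensHom F G) p = tpair (ob F (tfst p)) (ob G (tsnd p)) := rfl

@[simp] theorem tinl_tensHom (F : A ⟶ A') (G : B ⟶ B') (y : B) :
    tinl A y ≫ tensHom F G = F ≫ tinl A' (ob G y) := (homBimap F G).tinl_lift y

@[simp] theorem tinr_tensHom (F : A ⟶ A') (G : B ⟶ B') (x : A) :
    tinr x B ≫ tensHom F G = G ≫ tinr (ob F x) B' := (homBimap F G).tinr_lift x

/-- The symmetry, as a `*`-functor of two variables. -/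
def braidBimap (A B : CStarCat.{u} 𝕜) : Bimap A B (tens B A) where
  obj x y := tpair y x
  left y _ _ a := mapr y a
  right x _ _ b := mapl b x
  left_id y := (Hom.toStar (tinr y A)).map_id
  left_comp y _ _ _ := (Hom.toStar (tinr y A)).map_comp
  left_add y _ _ := (Hom.toStar (tinr y A)).map_add
  left_smul y _ _ := (Hom.toStar (tinr y A)).map_smul
  left_star y _ _ := (Hom.toStar (tinr y A)).map_adj
  right_id x := (Hom.toStar (tinl B x)).map_id
  right_comp x _ _ _ := (Hom.toStar (tinl B x)).map_comp
  right_add x _ _ := (Hom.toStar (tinl B x)).map_add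
  right_smul x _ _ := (Hom.toStar (tinl B x)).map_smul
  right_star x _ _ := (Hom.toStar (tinl B x)).map_adj
  comm _ _ := (mapl_comp_mapr _ _).symm

/-- The symmetry of the tensor product. -/
def braid (A B : CStarCat.{u} 𝕜) : tens A B ⟶ tens B A := (braidBimap A B).lift

@[simp] theorem ob_braid (p : tens A B) : ob (braid A B) p = tpair (tsnd p) (tfst p) := rfl

@[simp] theorem tinl_braid (y : B) : tinl A y ≫ braid A B = tinr y A :=
  (braidBimap A B).tinl_lift y

@[simp] theorem tinr_braid (x : A) : tinr x B ≫ braid A B = tinl B x :=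
  (braidBimap A B).tinr_lift x

/-- The associativity with fixed third variable, as a `*`-functor of two variables. -/
def assocLeftBimap (A B : CStarCat.{u} 𝕜) {C : CStarCat.{u} 𝕜} (z : C) :
    Bimap A B (tens A (tens B C)) where
  obj x y := tpair x (tpair y z)
  left y _ _ a := mapl a (tpair y z)
  right x _ _ b := (Hom.toStar (tinl B z ≫ tinr x (tens B C))).map b
  left_id y := (Hom.toStar (tinl A (tpair y z))).map_id
  left_comp y _ _ _ := (Hom.toStar (tinl A (tpair y z))).map_comp
  left_add y _ _ := (Hom.toStar (tinl A (tpair y z))).map_add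
  left_smul y _ _ := (Hom.toStar (tinl A (tpair y z))).map_smul
  left_star y _ _ := (Hom.toStar (tinl A (tpair y z))).map_adj
  right_id x := (Hom.toStar (tinl B z ≫ tinr x (tens B C))).map_id
  right_comp x _ _ _ := (Hom.toStar (tinl B z ≫ tinr x (tens B C))).map_comp
  right_add x _ _ := (Hom.toStar (tinl B z ≫ tinr x (tens B C))).map_add
  right_smul x _ _ := (Hom.toStar (tinl B z ≫ tinr x (tens B C))).map_smul
  right_star x _ _ := (Hom.toStar (tinl B z ≫ tinr x (tens B C))).map_adj
  comm _ _ := mapl_comp_mapr _ _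

/-- The associativity with fixed third variable. -/
def assocLeft (A B : CStarCat.{u} 𝕜) {C : CStarCat.{u} 𝕜} (z : C) :
    tens A B ⟶ tens A (tens B C) := (assocLeftBimap A B z).lift

@[simp] theorem ob_assocLeft (z : C) (p : tens A B) :
    ob (assocLeft A B z) p = tpair (tfst p) (tpair (tsnd p) z) := rfl

@[simp] theorem tinl_assocLeft (y : B) (z : C) :
    tinl A y ≫ assocLeft A B z = tinl A (tpair y z) :=
  (assocLeftBimap A B z).tinl_lift y

@[simp] theorem tinr_assocLeft (x : A) (z : C) :
    tinr x B ≫ assocLeft A B z = tinl B z ≫ tinr x (tens B C) :=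
  (assocLeftBimap A B z).tinr_lift x

theorem assocLeft_mapl (z : C) {x x' : A} (a : x ⟶ x') (y : B) :
    (Hom.toStar (assocLeft A B z)).map (mapl a y) = mapl a (tpair y z) :=
  (assocLeftBimap A B z).lift_mapl a y

theorem assocLeft_mapr (z : C) (x : A) {y y' : B} (b : y ⟶ y') :
    (Hom.toStar (assocLeft A B z)).map (mapr x b) = mapr x (mapl b z) :=
  (assocLeftBimap A B z).lift_mapr x b

/-- An arrow in the third variable of an iterated tensor product. -/
def assocRight (p : tens A B) {z z' : C} (c : z ⟶ z') :
    (Hom.toStar (assocLeft A B z)).obj p ⟶ (Hom.toStar (assocLeft A B z')).obj p :=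
  mapr (tfst p) (mapr (tsnd p) c)

/-- This is the exchange law for `assocBimap`. By `tens_natural` it is enough to test a ⊗ 1 and 1 ⊗
b: the former is the exchange law in A ⊗ (B ⊗ C), the latter the one in B ⊗ C embedded at a fixed
object of A. -/
theorem assocLeft_comp_assocRight {p q : tens A B} (f : p ⟶ q) {z z' : C} (c : z ⟶ z') :
    (Hom.toStar (assocLeft A B z)).map f ≫ assocRight q c =
      assocRight p c ≫ (Hom.toStar (assocLeft A B z')).map f := by
  refine tens_natural (fun p => assocRight p c) (fun y x x' a => ?_) (fun x y y' b => ?_) f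
  · rw [assocLeft_mapl, assocLeft_mapl]
    exact mapl_comp_mapr a (mapr y c)
  · rw [assocLeft_mapr, assocLeft_mapr]
    refine ((Hom.toStar (tinr x (tens B C))).map_comp (mapl b z) (mapr y' c)).symm.trans
      (Eq.trans ?_ ((Hom.toStar (tinr x (tens B C))).map_comp (mapr y c) (mapl b z')))
    rw [mapl_comp_mapr]

/-- The associativity, as a `*`-functor of two variables. -/
def assocBimap (A B C : CStarCat.{u} 𝕜) : Bimap (tens A B) C (tens A (tens B C)) where
  obj p z := tpair (tfst p) (tpair (tsnd p) z)
  left z _ _ f := (Hom.toStar (assocLeft A B z)).map f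
  right p _ _ c := (Hom.toStar (tinr (tsnd p) C ≫ tinr (tfst p) (tens B C))).map c
  left_id z := (Hom.toStar (assocLeft A B z)).map_id
  left_comp z _ _ _ := (Hom.toStar (assocLeft A B z)).map_comp
  left_add z _ _ := (Hom.toStar (assocLeft A B z)).map_add
  left_smul z _ _ := (Hom.toStar (assocLeft A B z)).map_smul
  left_star z _ _ := (Hom.toStar (assocLeft A B z)).map_adj
  right_id p := (Hom.toStar (tinr (tsnd p) C ≫ tinr (tfst p) (tens B C))).map_id
  right_comp p _ _ _ := (Hom.toStar (tinr (tsnd p) C ≫ tinr (tfst p) (tens B C))).map_comp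
  right_add p _ _ := (Hom.toStar (tinr (tsnd p) C ≫ tinr (tfst p) (tens B C))).map_add
  right_smul p _ _ := (Hom.toStar (tinr (tsnd p) C ≫ tinr (tfst p) (tens B C))).map_smul
  right_star p _ _ := (Hom.toStar (tinr (tsnd p) C ≫ tinr (tfst p) (tens B C))).map_adj
  comm f c := assocLeft_comp_assocRight f c

/-- The associativity of the tensor product. -/
def assoc (A B C : CStarCat.{u} 𝕜) : tens (tens A B) C ⟶ tens A (tens B C) :=
  (assocBimap A B C).lift

@[simp] theorem ob_assoc (p : tens (tens A B) C) :
    ob (assoc A B C) p = tpair (tfst (tfst p)) (tpair (tsnd (tfst p)) (tsnd p)) := rfl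

@[simp] theorem tinl_assoc (z : C) : tinl (tens A B) z ≫ assoc A B C = assocLeft A B z :=
  (assocBimap A B C).tinl_lift z

@[simp] theorem tinr_assoc (p : tens A B) :
    tinr p C ≫ assoc A B C = tinr (tsnd p) C ≫ tinr (tfst p) (tens B C) :=
  (assocBimap A B C).tinr_lift p

/-- The `*`-functor from the base field given by an object. -/
def scal (x : A) : baseField 𝕜 ⟶ A :=
  { obj := fun _ => x
    map := fun f => (ULift.down f : 𝕜) • 𝟙 x
    map_id := fun _ => one_smul 𝕜 (𝟙 x)
    map_comp := fun f g => by
      rw [Linear.smul_comp, Linear.comp_smul, smul_smul, Category.comp_id, mul_comm]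
      rfl
    map_add := fun f g => add_smul (ULift.down f : 𝕜) (ULift.down g) (𝟙 x)
    map_smul := fun z f => mul_smul z (ULift.down f : 𝕜) (𝟙 x)
    map_adj := fun f => by
      rw [StarCategory.adj_smul, StarCategory.adj_id]
      rfl : StarFunctor 𝕜 (baseField 𝕜) A }

@[simp] theorem ob_scal (x : A) (p : baseField.{u} 𝕜) : ob (scal x) p = x := rfl

/-- The object of the base field. -/
def basePt : baseField.{u} 𝕜 := BaseFieldObj.pt

theorem eq_basePt (p : baseField.{u} 𝕜) : p = basePt := by cases p; rfl

/-- Every arrow of the base field is a scalar multiple of an identity, so linearity leaves only the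
image of the object free. -/
theorem baseField_hom_ext {F G : baseField 𝕜 ⟶ A}
    (h : ob F basePt = ob G basePt) : F = G := by
  have key : ∀ F : baseField 𝕜 ⟶ A, F = scal (ob F basePt) := by
    intro F
    refine (StarFunctor.ext_onArrow fun a => ?_ : Hom.toStar F = _)
    refine congrArg Arrow.mk ?_
    have e : a.hom = (ULift.down a.hom : 𝕜) • 𝟙 _ :=
      ULift.ext _ _ (mul_one (ULift.down a.hom : 𝕜)).symm
    exact (congrArg (Hom.toStar F).map e).trans (((Hom.toStar F).map_smul _ _).trans
      (congrArg _ ((Hom.toStar F).map_id _)))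
  rw [key F, key G, h]

@[simp] theorem scal_comp (x : A) (F : A ⟶ B) : scal x ≫ F = scal (ob F x) :=
  baseField_hom_ext rfl

@[simp] theorem tinl_baseField (x : A) :
    tinl (baseField 𝕜) x = scal (tpair basePt x) := baseField_hom_ext rfl

@[simp] theorem tinr_baseField (x : A) :
    tinr x (baseField 𝕜) = scal (tpair x basePt) := baseField_hom_ext rfl

/-- The left unit, as a `*`-functor of two variables. -/
def unitBimap (A : CStarCat.{u} 𝕜) : Bimap (baseField 𝕜) A A where
  obj _ x := x
  left x _ _ f := (Hom.toStar (scal x)).map f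
  right _ _ _ a := a
  left_id x := (Hom.toStar (scal x)).map_id
  left_comp x _ _ _ := (Hom.toStar (scal x)).map_comp
  left_add x _ _ := (Hom.toStar (scal x)).map_add
  left_smul x _ _ := (Hom.toStar (scal x)).map_smul
  left_star x _ _ := (Hom.toStar (scal x)).map_adj
  right_id _ _ := rfl
  right_comp _ _ _ _ _ _ := rfl
  right_add _ _ _ _ _ := rfl
  right_smul _ _ _ _ _ := rfl
  right_star _ _ _ _ := rfl
  comm {_ _ y y'} f a := by
    change ((ULift.down f : 𝕜) • 𝟙 y) ≫ a = a ≫ ((ULift.down f : 𝕜) • 𝟙 y')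
    rw [Linear.smul_comp, Linear.comp_smul, Category.id_comp, Category.comp_id]

/-- The left unit isomorphism. -/
def lunit (A : CStarCat.{u} 𝕜) : tens (baseField 𝕜) A ⟶ A := (unitBimap A).lift

@[simp] theorem ob_lunit (p : tens (baseField 𝕜) A) : ob (lunit A) p = tsnd p := rfl

@[simp] theorem tinr_lunit (p : baseField.{u} 𝕜) : tinr p A ≫ lunit A = 𝟙 A :=
  (unitBimap A).tinr_lift p

end

end CStarCat

/-! ### Coherence identities, checked on the slices -/

namespace CStarCat

variable {𝕜 : Type} [RCLike 𝕜]

section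

variable {A B C D E A' B' C' : CStarCat.{u} 𝕜}

theorem tens_hom_ext₃ {F G : tens (tens A B) C ⟶ D}
    (h1 : ∀ z y, tinl A y ≫ tinl (tens A B) z ≫ F = tinl A y ≫ tinl (tens A B) z ≫ G)
    (h2 : ∀ z x, tinr x B ≫ tinl (tens A B) z ≫ F = tinr x B ≫ tinl (tens A B) z ≫ G)
    (h3 : ∀ p, tinr p C ≫ F = tinr p C ≫ G) : F = G :=
  tens_hom_ext (fun z => tens_hom_ext (h1 z) (h2 z)) h3

-- Together with the analogous rules below, this lets `simp` push a slice embedding through a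
-- right-nested composite. After `tens_hom_ext`, such rewriting settles the coherence identities.
@[simp] theorem tinl_tensHom_comp (F : A ⟶ A') (G : B ⟶ B') (y : B) (H : tens A' B' ⟶ C) :
    tinl A y ≫ tensHom F G ≫ H = F ≫ tinl A' (ob G y) ≫ H := by
  rw [← Category.assoc, tinl_tensHom, Category.assoc]

@[simp] theorem tinr_tensHom_comp (F : A ⟶ A') (G : B ⟶ B') (x : A) (H : tens A' B' ⟶ C) :
    tinr x B ≫ tensHom F G ≫ H = G ≫ tinr (ob F x) B' ≫ H := by
  rw [← Category.assoc, tinr_tensHom, Category.assoc]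

@[simp] theorem tinl_braid_comp (y : B) (H : tens B A ⟶ C) :
    tinl A y ≫ braid A B ≫ H = tinr y A ≫ H := by
  rw [← Category.assoc, tinl_braid]

@[simp] theorem tinr_braid_comp (x : A) (H : tens B A ⟶ C) :
    tinr x B ≫ braid A B ≫ H = tinl B x ≫ H := by
  rw [← Category.assoc, tinr_braid]

@[simp] theorem tinl_assocLeft_comp (y : B) (z : C) (H : tens A (tens B C) ⟶ D) :
    tinl A y ≫ assocLeft A B z ≫ H = tinl A (tpair y z) ≫ H := by
  rw [← Category.assoc, tinl_assocLeft]

@[simp] theorem tinr_assocLeft_comp (x : A) (z : C) (H : tens A (tens B C) ⟶ D) :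
    tinr x B ≫ assocLeft A B z ≫ H = tinl B z ≫ tinr x (tens B C) ≫ H := by
  rw [← Category.assoc, tinr_assocLeft, Category.assoc]

@[simp] theorem tinl_assoc_comp (z : C) (H : tens A (tens B C) ⟶ D) :
    tinl (tens A B) z ≫ assoc A B C ≫ H = assocLeft A B z ≫ H := by
  rw [← Category.assoc, tinl_assoc]

@[simp] theorem tinr_assoc_comp (p : tens A B) (H : tens A (tens B C) ⟶ D) :
    tinr p C ≫ assoc A B C ≫ H = tinr (tsnd p) C ≫ tinr (tfst p) (tens B C) ≫ H := by
  rw [← Category.assoc, tinr_assoc, Category.assoc]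

@[simp] theorem tinr_lunit_comp (p : baseField.{u} 𝕜) (H : A ⟶ B) :
    tinr p A ≫ lunit A ≫ H = H := by
  rw [← Category.assoc, tinr_lunit, Category.id_comp]

@[simp] theorem braid_braid (A B : CStarCat.{u} 𝕜) : braid A B ≫ braid B A = 𝟙 _ :=
  tens_hom_ext (fun y => by simp) fun x => by simp

@[simp] theorem braid_braid_comp (H : tens A B ⟶ C) : braid A B ≫ braid B A ≫ H = H := by
  rw [← Category.assoc, braid_braid, Category.id_comp]

/-- The inverse of the associativity. -/
def assocInv (A B C : CStarCat.{u} 𝕜) : tens A (tens B C) ⟶ tens (tens A B) C :=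
  -- The associativity for the reversed triple C, B, A, conjugated by symmetries.
  braid A (tens B C) ≫ tensHom (braid B C) (𝟙 A) ≫ assoc C B A ≫ braid C (tens B A) ≫
    tensHom (braid B A) (𝟙 C)

theorem assoc_assocInv (A B C : CStarCat.{u} 𝕜) : assoc A B C ≫ assocInv A B C = 𝟙 _ :=
  tens_hom_ext₃ (fun z y => by simp [assocInv]) (fun z x => by simp [assocInv])
    fun p => by simp [assocInv]

theorem assocInv_assoc (A B C : CStarCat.{u} 𝕜) : assocInv A B C ≫ assoc A B C = 𝟙 _ :=
  tens_hom_ext (fun p => by simp [assocInv]) fun x =>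
    tens_hom_ext (fun z => by simp [assocInv]) fun y => by simp [assocInv]

theorem lunit_tinr (A : CStarCat.{u} 𝕜) : lunit A ≫ tinr basePt A = 𝟙 _ :=
  tens_hom_ext (fun y => by simp) fun p => by rw [eq_basePt p]; simp

theorem runit_tinl (A : CStarCat.{u} 𝕜) :
    (braid A (baseField 𝕜) ≫ lunit A) ≫ tinl A basePt = 𝟙 _ :=
  tens_hom_ext (fun p => by rw [eq_basePt p]; simp) fun y => by simp

theorem tinl_runit (A : CStarCat.{u} 𝕜) (p : baseField.{u} 𝕜) :
    tinl A p ≫ braid A (baseField 𝕜) ≫ lunit A = 𝟙 A := by simp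

instance : MonoidalCategoryStruct (CStarCat.{u} 𝕜) where
  tensorObj := tens
  tensorUnit := baseField 𝕜
  tensorHom F G := tensHom F G
  whiskerLeft A _ _ F := tensHom (𝟙 A) F
  whiskerRight F B := tensHom F (𝟙 B)
  associator A B C := ⟨assoc A B C, assocInv A B C, assoc_assocInv A B C, assocInv_assoc A B C⟩
  leftUnitor A := ⟨lunit A, tinr basePt A, lunit_tinr A, tinr_lunit basePt⟩
  rightUnitor A := ⟨braid A (baseField 𝕜) ≫ lunit A, tinl A basePt, runit_tinl A,
    tinl_runit A basePt⟩

theorem tensHom_id (A B : CStarCat.{u} 𝕜) : tensHom (𝟙 A) (𝟙 B) = 𝟙 (tens A B) :=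
  tens_hom_ext (fun y => by simp) fun x => by simp

theorem tensHom_comp {A'' B'' : CStarCat.{u} 𝕜} (F : A ⟶ A') (F' : A' ⟶ A'') (G : B ⟶ B')
    (G' : B' ⟶ B'') : tensHom F G ≫ tensHom F' G' = tensHom (F ≫ F') (G ≫ G') :=
  tens_hom_ext (fun y => by simp) fun x => by simp

theorem assoc_naturality (F : A ⟶ A') (G : B ⟶ B') (H : C ⟶ C') :
    tensHom (tensHom F G) H ≫ assoc A' B' C' = assoc A B C ≫ tensHom F (tensHom G H) :=
  tens_hom_ext₃ (fun z y => by simp) (fun z x => by simp) fun p => by simp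

theorem lunit_naturality (F : A ⟶ B) :
    tensHom (𝟙 (baseField 𝕜)) F ≫ lunit B = lunit A ≫ F :=
  tens_hom_ext (fun y => by simp) fun x => by simp

theorem braid_naturality (F : A ⟶ A') (G : B ⟶ B') :
    tensHom F G ≫ braid A' B' = braid A B ≫ tensHom G F :=
  tens_hom_ext (fun y => by simp) fun x => by simp

theorem runit_naturality (F : A ⟶ B) :
    tensHom F (𝟙 (baseField 𝕜)) ≫ braid B (baseField 𝕜) ≫ lunit B =
      (braid A (baseField 𝕜) ≫ lunit A) ≫ F :=
  tens_hom_ext (fun y => by simp) fun x => by simp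

theorem assoc_pentagon (A B C D : CStarCat.{u} 𝕜) :
    tensHom (assoc A B C) (𝟙 D) ≫ assoc A (tens B C) D ≫ tensHom (𝟙 A) (assoc B C D) =
      assoc (tens A B) C D ≫ assoc A B (tens C D) :=
  tens_hom_ext₃ (fun w z => tens_hom_ext (fun y => by simp) fun x => by simp)
    (fun w p => by simp) fun q => by simp

theorem unit_triangle (A B : CStarCat.{u} 𝕜) :
    assoc A (baseField 𝕜) B ≫ tensHom (𝟙 A) (lunit B) =
      tensHom (braid A (baseField 𝕜) ≫ lunit A) (𝟙 B) :=
  tens_hom_ext₃ (fun w z => by simp) (fun w z => by simp) fun q => by simp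

theorem braid_hexagon (A B C : CStarCat.{u} 𝕜) :
    assoc A B C ≫ braid A (tens B C) ≫ assoc B C A =
      tensHom (braid A B) (𝟙 C) ≫ assoc B A C ≫ tensHom (𝟙 B) (braid A C) :=
  tens_hom_ext₃ (fun w z => by simp) (fun w z => by simp) fun q => by simp

instance : MonoidalCategory (CStarCat.{u} 𝕜) :=
  MonoidalCategory.ofTensorHom
    (id_tensorHom_id := tensHom_id)
    (tensorHom_comp_tensorHom := fun _ _ _ _ => tensHom_comp _ _ _ _)
    (associator_naturality := assoc_naturality)
    (leftUnitor_naturality := lunit_naturality)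
    (rightUnitor_naturality := runit_naturality)
    (pentagon := assoc_pentagon)
    (triangle := unit_triangle)

theorem braid_hexagon_reverse (A B C : CStarCat.{u} 𝕜) :
    assocInv A B C ≫ braid (tens A B) C ≫ assocInv C A B =
      tensHom (𝟙 A) (braid B C) ≫ assocInv A C B ≫ tensHom (braid A C) (𝟙 B) :=
  tens_hom_ext (fun q => by simp [assocInv]) fun x =>
    tens_hom_ext (fun w => by simp [assocInv]) fun w => by simp [assocInv]

instance : SymmetricCategory (CStarCat.{u} 𝕜) where
  braiding A B := ⟨braid A B, braid B A, braid_braid A B, braid_braid B A⟩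
  braiding_naturality_right A _ _ F := braid_naturality (𝟙 A) F
  braiding_naturality_left F B := braid_naturality F (𝟙 B)
  hexagon_forward := braid_hexagon
  hexagon_reverse := braid_hexagon_reverse
  symmetry := braid_braid

/-! ### Structure morphisms on elementary tensors -/

theorem onArrow_lift_elemTensor (β : Bimap A B C) (a : Arrow A) (b : Arrow B) :
    StarFunctor.onArrow β.lift (elemTensor (tensCan A B) a b) =
      Arrow.mk (β.left b.left a.hom ≫ β.right a.right b.hom) :=
  congrArg Arrow.mk ((tensClass A B).lift_map_can β.toStarFunctor trivial
    (AlgTensor.tmul a.hom b.hom))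

theorem elemTensor_tensCan (a : Arrow A) (b : Arrow B) :
    elemTensor (tensCan A B) a b = Arrow.mk (mapl a.hom b.left ≫ mapr a.right b.hom) :=
  congrArg Arrow.mk (tensCan_tmul a.hom b.hom)

theorem onArrow_braid (a : Arrow A) (b : Arrow B) :
    StarFunctor.onArrow (braid A B) (elemTensor (tensCan A B) a b) =
      elemTensor (tensCan B A) b a := by
  refine (onArrow_lift_elemTensor (braidBimap A B) a b).trans ?_
  rw [elemTensor_tensCan]
  exact congrArg Arrow.mk (mapl_comp_mapr b.hom a.hom).symm

theorem onArrow_tensHom (F : A ⟶ A') (G : B ⟶ B') (a : Arrow A) (b : Arrow B) :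
    StarFunctor.onArrow (tensHom F G) (elemTensor (tensCan A B) a b) =
      elemTensor (tensCan A' B') (StarFunctor.onArrow F a) (StarFunctor.onArrow G b) := by
  refine Eq.trans ?_ (elemTensor_tensCan _ _).symm
  exact onArrow_lift_elemTensor (homBimap F G) a b

theorem onArrow_assoc (a : Arrow A) (b : Arrow B) (c : Arrow C) :
    StarFunctor.onArrow (assoc A B C)
        (elemTensor (tensCan (tens A B) C) (elemTensor (tensCan A B) a b) c) =
      elemTensor (tensCan A (tens B C)) a (elemTensor (tensCan B C) b c) := by
  refine (onArrow_lift_elemTensor (assocBimap A B C) _ c).trans ?_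
  refine Eq.trans ?_ (elemTensor_tensCan _ _).symm
  refine congrArg Arrow.mk ?_
  have h1 : (Hom.toStar (assocLeft A B c.left)).map
      ((tensCan A B).map (AlgTensor.tmul a.hom b.hom)) =
      mapl a.hom (tpair b.left c.left) ≫ mapr a.right (mapl b.hom c.left) :=
    (tensClass A B).lift_map_can (assocLeftBimap A B c.left).toStarFunctor trivial
      (AlgTensor.tmul a.hom b.hom)
  have h2 : mapr a.right ((tensCan B C).map (AlgTensor.tmul b.hom c.hom)) =
      mapr a.right (mapl b.hom c.left) ≫ mapr a.right (mapr b.right c.hom) :=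
    (congrArg (mapr a.right) (tensCan_tmul b.hom c.hom)).trans
      ((Hom.toStar (tinr a.right (tens B C))).map_comp _ _)
  exact (congrArg (· ≫ mapr a.right (mapr b.right c.hom)) h1).trans ((Category.assoc _ _ _).trans
    (congrArg (mapl a.hom (tpair b.left c.left) ≫ ·) h2.symm))

theorem onArrow_lunit (z : 𝕜) (a : Arrow A) :
    StarFunctor.onArrow (lunit A)
        (elemTensor (tensCan (baseField 𝕜) A) (Arrow.mk (BaseFieldObj.arrow 𝕜 z)) a) =
      Arrow.mk (z • a.hom) := by
  refine (onArrow_lift_elemTensor (unitBimap A) _ a).trans (congrArg Arrow.mk ?_)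
  change (z • 𝟙 a.left) ≫ a.hom = z • a.hom
  rw [Linear.smul_comp, Category.id_comp]

/-- The symmetric monoidal structure on small `C*`-categories is the one of the maximal tensor
product. -/
def maxTensorStructure (𝕜 : Type) [RCLike 𝕜] : MaxTensorStructure.{u} 𝕜 where
  can := tensCan
  isEnveloping := isEnveloping_tensCan
  unitIso := Iso.refl _
  tensorHom_elem := onArrow_tensHom
  associator_elem := onArrow_assoc
  leftUnitor_elem := onArrow_lunit
  rightUnitor_elem {A} z a :=
    (congrArg (StarFunctor.onArrow (lunit A)) (onArrow_braid a
      (Arrow.mk (BaseFieldObj.arrow 𝕜 z) : Arrow (baseField 𝕜)))).trans (onArrow_lunit z a)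
  braiding_elem := onArrow_braid

end

end CStarCat

/-! ### Internal homs -/

namespace CStarCat

variable {𝕜 : Type} [RCLike 𝕜]

section

variable {A B C D : CStarCat.{u} 𝕜}

/-- The bounded natural transformations between two `*`-functors. -/
def natSubmodule (F G : StarFunctor 𝕜 A C) :
    Submodule 𝕜 (BoundedFamily (C := fun _ : A => C) F.obj G.obj) where
  carrier := {f | ∀ {x x' : A} (a : x ⟶ x'), F.map a ≫ f x' = f x ≫ G.map a}
  add_mem' {f g} hf hg x x' a := by
    rw [BoundedFamily.add_apply, BoundedFamily.add_apply, Preadditive.comp_add,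
      Preadditive.add_comp, hf a, hg a]
  zero_mem' {x x'} a := by
    rw [BoundedFamily.zero_apply, BoundedFamily.zero_apply, comp_zero, zero_comp]
  smul_mem' z f hf x x' a := by
    rw [BoundedFamily.smul_apply, BoundedFamily.smul_apply, Linear.comp_smul, Linear.smul_comp,
      hf a]

theorem continuous_apply_boundedFamily {I : Type u} {C : I → CStarCat.{u} 𝕜} {p q : ∀ i, C i}
    (i : I) : Continuous fun f : BoundedFamily p q => f i := by
  let φ : BoundedFamily p q →+ (p i ⟶ q i) := ⟨⟨fun f => f i, rfl⟩, fun _ _ => rfl⟩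
  exact AddMonoidHomClass.continuous_of_bound φ 1 fun f => by
    rw [one_mul]; exact f.norm_apply_le i

/-- Bounded natural transformations between `*`-functors form a `C*`-category. -/
def homData (A C : CStarCat.{u} 𝕜) : FamilyData.{u} 𝕜 where
  I := A
  C _ := C
  X := StarFunctor 𝕜 A C
  ev F := F.obj
  N := natSubmodule
  isClosed F G := by
    have : (natSubmodule F G : Set (BoundedFamily (C := fun _ : A => C) F.obj G.obj)) =
        ⋂ (x : A) (x' : A) (a : x ⟶ x'), {f | F.map a ≫ f x' = f x ≫ G.map a} := by
      ext f
      simp only [Set.mem_iInter]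
      exact ⟨fun h x x' a => h a, fun h x x' a => h x x' a⟩
    rw [this]
    exact isClosed_iInter fun x => isClosed_iInter fun x' => isClosed_iInter fun a =>
      isClosed_eq (continuous_comp.comp
        (continuous_const.prodMk (continuous_apply_boundedFamily x')))
        (continuous_comp.comp ((continuous_apply_boundedFamily x).prodMk continuous_const))
  id_mem F x x' a := by
    rw [BoundedFamily.id_apply, BoundedFamily.id_apply, Category.id_comp, Category.comp_id]
  comp_mem {F G H f g} hf hg x x' a := by
    rw [BoundedFamily.comp_apply, BoundedFamily.comp_apply, ← Category.assoc, hf a,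
      Category.assoc, hg a, Category.assoc]
  star_mem {F G f} hf x x' a := by
    -- The adjoint of the naturality square at a* is the square of the adjoint family at a.
    have h := congrArg star (hf (star a))
    rw [star_comp, star_comp] at h
    have hF : star (F.map (star a)) = F.map a :=
      (F.map_adj (star a)).symm.trans (congrArg F.map (star_star a))
    have hG : star (G.map (star a)) = G.map a :=
      (G.map_adj (star a)).symm.trans (congrArg G.map (star_star a))
    rw [hF, hG] at h
    exact h.symm

/-- The internal Hom. -/
def homCat (A C : CStarCat.{u} 𝕜) : CStarCat.{u} 𝕜 := (homData A C).toCStarCat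

theorem homCat_arrow_ext {F F' G G' : (homData A C).Obj} (f : F ⟶ G) (f' : F' ⟶ G')
    (hF : F.val = F'.val) (hG : G.val = G'.val)
    (h : ∀ x, Arrow.mk (FamilyData.app f x) = Arrow.mk (FamilyData.app f' x)) :
    Arrow.mk f = Arrow.mk f' := by
  obtain ⟨F⟩ := F
  obtain ⟨F'⟩ := F'
  obtain ⟨G⟩ := G
  obtain ⟨G'⟩ := G'
  obtain rfl : F = F' := hF
  obtain rfl : G = G' := hG
  exact congrArg Arrow.mk (FamilyData.hom_ext fun x => (Arrow.mk_inj _ _).1 (h x))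

/-- The transpose of a morphism out of a tensor product. -/
def curryHom (Φ : tens A B ⟶ C) : B ⟶ homCat A C :=
  { obj := fun y => ⟨tinl A y ≫ Φ⟩
    map := fun b => FamilyData.homMk
      -- The bound ‖b‖ is uniform in x by contractivity on the slices; naturality in x is the
      -- exchange law for a ⊗ 1 and 1 ⊗ b.
      (BoundedFamily.mk (fun x => (Hom.toStar (tinr x B ≫ Φ)).map b) ‖b‖
        fun x => norm_map_le (tinr x B ≫ Φ) b)
      fun a => ((Hom.toStar Φ).map_comp (mapl a _) (mapr _ b)).symm.trans
        ((congrArg (Hom.toStar Φ).map (mapl_comp_mapr a b)).trans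
          ((Hom.toStar Φ).map_comp (mapr _ b) (mapl a _)))
    map_id := fun y => FamilyData.hom_ext fun x => (Hom.toStar (tinr x B ≫ Φ)).map_id y
    map_comp := fun b b' => FamilyData.hom_ext fun x =>
      (Hom.toStar (tinr x B ≫ Φ)).map_comp b b'
    map_add := fun b b' => FamilyData.hom_ext fun x => (Hom.toStar (tinr x B ≫ Φ)).map_add b b'
    map_smul := fun z b => FamilyData.hom_ext fun x => (Hom.toStar (tinr x B ≫ Φ)).map_smul z b
    map_adj := fun b => FamilyData.hom_ext fun x => (Hom.toStar (tinr x B ≫ Φ)).map_adj b :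
    StarFunctor 𝕜 B (homCat A C) }

/-- The `*`-functor of two variables given by a morphism to an internal Hom. -/
def uncurryBimap (Ψ : B ⟶ homCat A C) : Bimap A B C where
  obj x y := ((Hom.toStar Ψ).obj y).val.obj x
  left y _ _ a := ((Hom.toStar Ψ).obj y).val.map a
  right x _ _ b := FamilyData.app ((Hom.toStar Ψ).map b) x
  left_id y := ((Hom.toStar Ψ).obj y).val.map_id
  left_comp y _ _ _ := ((Hom.toStar Ψ).obj y).val.map_comp
  left_add y _ _ := ((Hom.toStar Ψ).obj y).val.map_add
  left_smul y _ _ := ((Hom.toStar Ψ).obj y).val.map_smul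
  left_star y _ _ := ((Hom.toStar Ψ).obj y).val.map_adj
  right_id x y := congrArg (FamilyData.app · x) ((Hom.toStar Ψ).map_id y)
  right_comp x _ _ _ b b' := congrArg (FamilyData.app · x) ((Hom.toStar Ψ).map_comp b b')
  right_add x _ _ b b' := congrArg (FamilyData.app · x) ((Hom.toStar Ψ).map_add b b')
  right_smul x _ _ z b := congrArg (FamilyData.app · x) ((Hom.toStar Ψ).map_smul z b)
  right_star x _ _ b := congrArg (FamilyData.app · x) ((Hom.toStar Ψ).map_adj b)
  comm a b := (show (homData A C).N _ _ from (Hom.toStar Ψ).map b).2 a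

/-- The transpose of a morphism to an internal Hom. -/
def uncurryHom (Ψ : B ⟶ homCat A C) : tens A B ⟶ C := (uncurryBimap Ψ).lift

theorem uncurryHom_curryHom (Φ : tens A B ⟶ C) : uncurryHom (curryHom Φ) = Φ :=
  tens_hom_ext (fun y => (uncurryBimap (curryHom Φ)).tinl_lift y)
    fun x => (uncurryBimap (curryHom Φ)).tinr_lift x

theorem curryHom_uncurryHom (Ψ : B ⟶ homCat A C) : curryHom (uncurryHom Ψ) = Ψ :=
  StarFunctor.ext_onArrow fun b => homCat_arrow_ext _ _
    ((uncurryBimap Ψ).tinl_lift _) ((uncurryBimap Ψ).tinl_lift _)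
    fun x => congrArg Arrow.mk ((uncurryBimap Ψ).lift_mapr x b.hom)

/-- The adjunction bijection for the internal Hom. -/
def homCatEquiv (A B C : CStarCat.{u} 𝕜) : (tens A B ⟶ C) ≃ (B ⟶ homCat A C) where
  toFun := curryHom
  invFun := uncurryHom
  left_inv := uncurryHom_curryHom
  right_inv := curryHom_uncurryHom

theorem curryHom_naturality (G : D ⟶ B) (Φ : tens A B ⟶ C) :
    curryHom (tensHom (𝟙 A) G ≫ Φ) = G ≫ curryHom Φ := by
  have hl : ∀ y, tinl A y ≫ tensHom (𝟙 A) G ≫ Φ = tinl A (ob G y) ≫ Φ := fun y => by simp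
  have hr : ∀ x, tinr x D ≫ tensHom (𝟙 A) G ≫ Φ = G ≫ tinr x B ≫ Φ := fun x => by simp
  exact StarFunctor.ext_onArrow fun b => homCat_arrow_ext _ _ (hl _) (hl _)
    fun x => congrArg (fun F : D ⟶ C => (Hom.toStar F).onArrow b) (hr x)

instance : MonoidalClosed (CStarCat.{u} 𝕜) where
  closed A :=
    { rightAdj := Adjunction.rightAdjointOfEquiv (F := tensorLeft A) (homCatEquiv A)
        fun _ _ _ G Φ => curryHom_naturality G Φ
      adj := Adjunction.adjunctionOfEquivRight (F := tensorLeft A) (homCatEquiv A)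
        fun _ _ _ G Φ => curryHom_naturality G Φ }

end

end CStarCat

/-! ### Unitary arrows and conjugation of `*`-functors -/

section

variable {𝕜 : Type} [RCLike 𝕜] {A : Type u} [Category.{v} A] [Preadditive A] [Linear 𝕜 A]
  [StarCategory 𝕜 A]

namespace IsUnitaryArrow

theorem eqToHom {x y : A} (h : x = y) : IsUnitaryArrow 𝕜 (eqToHom h) := by
  subst h
  simp [IsUnitaryArrow, StarCategory.adj_id]

theorem id (x : A) : IsUnitaryArrow 𝕜 (𝟙 x) := eqToHom rfl

theorem comp {x y z : A} {a : x ⟶ y} {b : y ⟶ z} (ha : IsUnitaryArrow 𝕜 a)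
    (hb : IsUnitaryArrow 𝕜 b) : IsUnitaryArrow 𝕜 (a ≫ b) := by
  constructor
  · rw [StarCategory.adj_comp, Category.assoc, ← Category.assoc b, hb.1, Category.id_comp, ha.1]
  · rw [StarCategory.adj_comp, Category.assoc, ← Category.assoc _ a, ha.2, Category.id_comp, hb.2]

theorem adj {x y : A} {a : x ⟶ y} (ha : IsUnitaryArrow 𝕜 a) :
    IsUnitaryArrow 𝕜 (StarCategory.adj 𝕜 a) := by
  rw [IsUnitaryArrow, StarCategory.adj_adj]
  exact ⟨ha.2, ha.1⟩

theorem map {B : Type u₁} [Category.{v₁} B] [Preadditive B] [Linear 𝕜 B] [StarCategory 𝕜 B]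
    (F : StarFunctor 𝕜 A B) {x y : A} {a : x ⟶ y} (ha : IsUnitaryArrow 𝕜 a) :
    IsUnitaryArrow 𝕜 (F.map a) := by
  constructor
  · rw [← F.map_adj, ← F.map_comp, ha.1, F.map_id]
  · rw [← F.map_adj, ← F.map_comp, ha.2, F.map_id]

theorem comp_adj_comp {x y z : A} {a : x ⟶ y} (ha : IsUnitaryArrow 𝕜 a) (b : x ⟶ z) :
    a ≫ StarCategory.adj 𝕜 a ≫ b = b := by
  rw [← Category.assoc, ha.1, Category.id_comp]

theorem adj_comp_comp {x y z : A} {a : x ⟶ y} (ha : IsUnitaryArrow 𝕜 a) (b : y ⟶ z) :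
    StarCategory.adj 𝕜 a ≫ a ≫ b = b := by
  rw [← Category.assoc, ha.2, Category.id_comp]

end IsUnitaryArrow

end

namespace CStarCat

variable {𝕜 : Type} [RCLike 𝕜]

section

variable {A B C D X Y : CStarCat.{u} 𝕜}

/-- The action of a morphism on arrows. -/
def arr (F : A ⟶ B) (a : Arrow A) : Arrow B := (Hom.toStar F).onArrow a

theorem congr_arr {F G : A ⟶ B} (h : F = G) (a : Arrow A) : arr F a = arr G a := by rw [h]

theorem congr_ob {F G : A ⟶ B} (h : F = G) (a : A) : ob F a = ob G a := by rw [h]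

/-- The action of a morphism on an arrow, with endpoints given by `ob`. -/
def mor (F : A ⟶ B) {x y : A} (a : x ⟶ y) : ob F x ⟶ ob F y := (Hom.toStar F).map a

theorem mor_id (F : A ⟶ B) (x : A) : mor F (𝟙 x) = 𝟙 (ob F x) := (Hom.toStar F).map_id x

theorem mor_comp (F : A ⟶ B) {x y z : A} (a : x ⟶ y) (b : y ⟶ z) :
    mor F (a ≫ b) = mor F a ≫ mor F b := (Hom.toStar F).map_comp a b

theorem mor_add (F : A ⟶ B) {x y : A} (a b : x ⟶ y) : mor F (a + b) = mor F a + mor F b :=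
  (Hom.toStar F).map_add a b

theorem mor_smul (F : A ⟶ B) {x y : A} (z : 𝕜) (a : x ⟶ y) : mor F (z • a) = z • mor F a :=
  (Hom.toStar F).map_smul z a

theorem mor_star (F : A ⟶ B) {x y : A} (a : x ⟶ y) : mor F (star a) = star (mor F a) :=
  (Hom.toStar F).map_adj a

theorem mor_eqToHom (F : A ⟶ B) {x y : A} (h : x = y) :
    mor F (eqToHom h) = eqToHom (congrArg (ob F) h) := by
  subst h
  exact mor_id F x

theorem isUnitaryArrow_mor (F : A ⟶ B) {x y : A} {a : x ⟶ y} (ha : IsUnitaryArrow 𝕜 a) :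
    IsUnitaryArrow 𝕜 (mor F a) := ha.map (Hom.toStar F)

theorem congr_mor {F G : A ⟶ B} (h : F = G) {x y : A} (a : x ⟶ y) :
    mor F a = eqToHom (congr_ob h x) ≫ mor G a ≫ eqToHom (congr_ob h y).symm :=
  StarFunctor.congr_map h a

theorem hom_ext_mor {F G : A ⟶ B} (hobj : ∀ x, ob F x = ob G x)
    (hmor : ∀ {x y : A} (a : x ⟶ y),
      mor F a = eqToHom (hobj x) ≫ mor G a ≫ eqToHom (hobj y).symm) : F = G :=
  StarFunctor.ext_map hobj hmor

/-- The `*`-functor obtained by conjugation with a family of unitary arrows. -/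
def conj (K : A ⟶ B) (t : A → B) (v : ∀ x, ob K x ⟶ t x) (hv : ∀ x, IsUnitaryArrow 𝕜 (v x)) :
    A ⟶ B :=
  { obj := t
    map := fun {x y} a => star (v x) ≫ mor K a ≫ v y
    map_id := fun x => by
      rw [mor_id, Category.id_comp]
      exact (hv x).2
    map_comp := fun {x y z} a b => by
      rw [mor_comp, Category.assoc, Category.assoc, Category.assoc, star_def (v y),
        (hv y).comp_adj_comp]
    map_add := fun a b => by rw [mor_add, Preadditive.add_comp, Preadditive.comp_add]
    map_smul := fun z a => by rw [mor_smul, Linear.smul_comp, Linear.comp_smul]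
    map_adj := fun {x y} a => by
      rw [← star_def, ← star_def, star_comp, star_comp, star_star, mor_star, Category.assoc] :
    StarFunctor 𝕜 A B }

theorem mor_conj (K : A ⟶ B) (t : A → B) (v : ∀ x, ob K x ⟶ t x)
    (hv : ∀ x, IsUnitaryArrow 𝕜 (v x)) {x y : A} (a : x ⟶ y) :
    mor (conj K t v hv) a = star (v x) ≫ mor K a ≫ v y := rfl

/-- Comparing the unitaries as arrows with their endpoints allows target families that agree only
propositionally. With the other rules for `conj`, it lets strict equalities of *-functors be
verified without transports. -/
theorem conj_congr {K K' : A ⟶ B} (hK : K = K') {t t' : A → B} {v : ∀ x, ob K x ⟶ t x}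
    {v' : ∀ x, ob K' x ⟶ t' x} {hv : ∀ x, IsUnitaryArrow 𝕜 (v x)}
    {hv' : ∀ x, IsUnitaryArrow 𝕜 (v' x)} (h : ∀ x, Arrow.mk (v x) = Arrow.mk (v' x)) :
    conj K t v hv = conj K' t' v' hv' := by
  subst hK
  obtain rfl : t = t' := funext fun x => congrArg (fun a : Arrow B => a.right) (h x)
  obtain rfl : v = v' := funext fun x => (Arrow.mk_inj _ _).1 (h x)
  rfl

theorem conj_id (K : A ⟶ B) : conj K (ob K) (fun _ => 𝟙 _) (fun _ => .id _) = K :=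
  StarFunctor.ext_onArrow fun a => congrArg Arrow.mk (a₁ := mor (conj K (ob K) _ _) a.hom)
    (a₂ := mor K a.hom) (by rw [mor_conj, star_id, Category.id_comp, Category.comp_id])

theorem conj_eq_self (K : A ⟶ B) {t : A → B} {v : ∀ x, ob K x ⟶ t x}
    {hv : ∀ x, IsUnitaryArrow 𝕜 (v x)} (h : ∀ x, Arrow.mk (v x) = Arrow.mk (𝟙 (ob K x))) :
    conj K t v hv = K :=
  (conj_congr rfl h).trans (conj_id K)

theorem conj_conj (K : A ⟶ B) (t : A → B) (v : ∀ x, ob K x ⟶ t x)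
    (hv : ∀ x, IsUnitaryArrow 𝕜 (v x)) (t' : A → B) (w : ∀ x, t x ⟶ t' x)
    (hw : ∀ x, IsUnitaryArrow 𝕜 (w x)) :
    conj (conj K t v hv) t' w hw = conj K t' (fun x => v x ≫ w x) fun x => (hv x).comp (hw x) :=
  StarFunctor.ext_onArrow fun a => congrArg Arrow.mk
    (a₁ := star (w a.left) ≫ (star (v a.left) ≫ mor K a.hom ≫ v a.right) ≫ w a.right)
    (a₂ := star (v a.left ≫ w a.left) ≫ mor K a.hom ≫ v a.right ≫ w a.right)
    (by rw [star_comp, Category.assoc, Category.assoc, Category.assoc])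

theorem comp_conj (F : C ⟶ A) (K : A ⟶ B) (t : A → B) (v : ∀ x, ob K x ⟶ t x)
    (hv : ∀ x, IsUnitaryArrow 𝕜 (v x)) :
    F ≫ conj K t v hv =
      conj (F ≫ K) (fun x => t (ob F x)) (fun x => v (ob F x)) fun _ => hv _ := rfl

theorem conj_comp (K : A ⟶ B) (t : A → B) (v : ∀ x, ob K x ⟶ t x)
    (hv : ∀ x, IsUnitaryArrow 𝕜 (v x)) (F : B ⟶ C) :
    conj K t v hv ≫ F = conj (K ≫ F) (fun x => ob F (t x)) (fun x => mor F (v x))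
      fun x => isUnitaryArrow_mor F (hv x) :=
  StarFunctor.ext_onArrow fun a => congrArg Arrow.mk <|
    (mor_comp F (star (v a.left)) (mor K a.hom ≫ v a.right)).trans <|
      congrArg₂ (· ≫ ·) (mor_star F _) (mor_comp F (mor K a.hom) (v a.right))

/-! ### Unitary isomorphism of *-functors -/

/-- Two `*`-functors are unitarily isomorphic if there is a natural isomorphism with unitary
components between them. -/
def unitaryIso (𝕜 : Type) [RCLike 𝕜] : HomRel (CStarCat.{u} 𝕜) := fun A _ F G =>
  ∃ v : ∀ x : A, ob F x ⟶ ob G x, (∀ x, IsUnitaryArrow 𝕜 (v x)) ∧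
    ∀ {x y : A} (a : x ⟶ y), mor F a ≫ v y = v x ≫ mor G a

theorem unitaryIso_conj (K : A ⟶ B) (t : A → B) (v : ∀ x, ob K x ⟶ t x)
    (hv : ∀ x, IsUnitaryArrow 𝕜 (v x)) : unitaryIso 𝕜 K (conj K t v hv) :=
  ⟨v, hv, fun {x _} _ => ((hv x).comp_adj_comp _).symm⟩

theorem unitaryIso_refl (F : A ⟶ B) : unitaryIso 𝕜 F F :=
  ⟨fun _ => 𝟙 _, fun _ => .id _, fun a => by rw [Category.comp_id, Category.id_comp]⟩

theorem unitaryIso_of_eq {F G : A ⟶ B} (h : F = G) : unitaryIso 𝕜 F G := by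
  rw [h]
  exact unitaryIso_refl G

theorem unitaryIso.symm {F G : A ⟶ B} (h : unitaryIso 𝕜 F G) : unitaryIso 𝕜 G F := by
  obtain ⟨v, hv, h⟩ := h
  refine ⟨fun x => star (v x), fun x => (hv x).adj, fun {x y} a => ?_⟩
  have e := congrArg star (h (star a))
  rw [mor_star, mor_star, star_comp, star_comp, star_star, star_star] at e
  exact e.symm

theorem unitaryIso.trans {F G H : A ⟶ B} (h : unitaryIso 𝕜 F G) (h' : unitaryIso 𝕜 G H) :
    unitaryIso 𝕜 F H := by
  obtain ⟨v, hv, h⟩ := h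
  obtain ⟨w, hw, h'⟩ := h'
  exact ⟨fun x => v x ≫ w x, fun x => (hv x).comp (hw x), fun {x y} a => by
    rw [← Category.assoc, h, Category.assoc, h', Category.assoc]⟩

instance : Congruence (unitaryIso.{u} 𝕜) where
  equivalence := ⟨unitaryIso_refl, unitaryIso.symm, unitaryIso.trans⟩
  comp_left F _ _ := by
    rintro ⟨v, hv, h⟩
    exact ⟨fun x => v (ob F x), fun x => hv _, fun a => h (mor F a)⟩
  comp_right H := by
    rintro ⟨v, hv, h⟩
    exact ⟨fun x => mor H (v x), fun x => isUnitaryArrow_mor H (hv x), fun a =>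
      (mor_comp H _ _).symm.trans ((congrArg (mor H) (h a)).trans (mor_comp H _ _))⟩

theorem unitaryIso_iff_exists_iso {F G : A ⟶ B} : unitaryIso 𝕜 F G ↔
    ∃ e : (Hom.toStar F).toFunctor ≅ (Hom.toStar G).toFunctor,
      ∀ x, IsUnitaryArrow 𝕜 (e.hom.app x) := by
  constructor
  · rintro ⟨v, hv, h⟩
    exact ⟨NatIso.ofComponents (fun x => ⟨v x, star (v x), (hv x).1, (hv x).2⟩) h, hv⟩
  · rintro ⟨e, he⟩
    exact ⟨fun x => e.hom.app x, he, fun a => e.hom.naturality a⟩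

/-! ### Unitary equivalences -/

theorem unitaryEquivalences_iff (F : A ⟶ B) : unitaryEquivalences 𝕜 F ↔
    ∃ G : B ⟶ A, unitaryIso 𝕜 (F ≫ G) (𝟙 A) ∧ unitaryIso 𝕜 (G ≫ F) (𝟙 B) := by
  constructor
  · rintro ⟨G, s, t, hs, ht⟩
    exact ⟨G, unitaryIso_iff_exists_iso.2 ⟨s, hs⟩, unitaryIso_iff_exists_iso.2 ⟨t, ht⟩⟩
  · rintro ⟨G, h, h'⟩
    obtain ⟨s, hs⟩ := unitaryIso_iff_exists_iso.1 h
    obtain ⟨t, ht⟩ := unitaryIso_iff_exists_iso.1 h'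
    exact ⟨G, s, t, hs, ht⟩

/-- Unitary isomorphism is a congruence, and an inverse in the quotient category lifts to a
quasi-inverse. Two-out-of-three and stability under retracts are then inherited from isomorphisms.
-/
theorem unitaryEquivalences_eq_inverseImage : unitaryEquivalences 𝕜 =
    (MorphismProperty.isomorphisms _).inverseImage (Quotient.functor (unitaryIso.{u} 𝕜)) := by
  ext A B F
  rw [unitaryEquivalences_iff, MorphismProperty.inverseImage_iff,
    MorphismProperty.isomorphisms.iff]
  constructor
  · rintro ⟨G, h, h'⟩
    refine ⟨(Quotient.functor (unitaryIso 𝕜)).map G, ?_, ?_⟩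
    · rw [← CategoryTheory.Functor.map_comp, ← CategoryTheory.Functor.map_id,
        Quotient.functor_map_eq_iff]
      exact h
    · rw [← CategoryTheory.Functor.map_comp, ← CategoryTheory.Functor.map_id,
        Quotient.functor_map_eq_iff]
      exact h'
  · rintro ⟨g, h, h'⟩
    obtain ⟨G, rfl⟩ := (Quotient.functor (unitaryIso 𝕜)).map_surjective g
    rw [← CategoryTheory.Functor.map_comp, ← CategoryTheory.Functor.map_id,
      Quotient.functor_map_eq_iff] at h h'
    exact ⟨G, h, h'⟩

instance : (unitaryEquivalences.{u} 𝕜).HasTwoOutOfThreeProperty := by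
  rw [unitaryEquivalences_eq_inverseImage]
  infer_instance

instance : (unitaryEquivalences.{u} 𝕜).IsStableUnderRetracts := by
  rw [unitaryEquivalences_eq_inverseImage]
  exact ⟨fun h hg => MorphismProperty.of_retract (P := MorphismProperty.isomorphisms _)
    (h.map (Quotient.functor (unitaryIso.{u} 𝕜))) hg⟩

/-! ### Fully faithful *-functors -/

/-- A `*`-functor is fully faithful. -/
def FullyFaithful (F : A ⟶ B) : Prop :=
  ∀ x y : A, Function.Bijective fun a : x ⟶ y => mor F a

theorem fullyFaithful_of_unitaryEquivalence {F : A ⟶ B} (hF : unitaryEquivalences 𝕜 F) :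
    FullyFaithful F := by
  obtain ⟨G, s, t, -, -⟩ := hF
  let e := CategoryTheory.Equivalence.mk (Hom.toStar F).toFunctor G.toFunctor s.symm t
  have : (Hom.toStar F).toFunctor.IsEquivalence := e.isEquivalence_functor
  exact fun x y => ⟨(Hom.toStar F).toFunctor.map_injective,
    (Hom.toStar F).toFunctor.map_surjective⟩

theorem exists_unitary_of_unitaryEquivalence {F : A ⟶ B} (hF : unitaryEquivalences 𝕜 F) (y : B) :
    ∃ (x : A) (v : ob F x ⟶ y), IsUnitaryArrow 𝕜 v := by
  obtain ⟨G, s, t, -, ht⟩ := hF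
  exact ⟨G.obj y, t.hom.app y, ht y⟩

namespace FullyFaithful

variable {F : A ⟶ B}

/-- The preimage of an arrow under a fully faithful `*`-functor. -/
def preimage (hF : FullyFaithful F) {x y : A} (b : ob F x ⟶ ob F y) : x ⟶ y :=
  ((hF x y).2 b).choose

@[simp] theorem mor_preimage (hF : FullyFaithful F) {x y : A} (b : ob F x ⟶ ob F y) :
    mor F (hF.preimage b) = b :=
  ((hF x y).2 b).choose_spec

theorem mor_injective (hF : FullyFaithful F) {x y : A} {a b : x ⟶ y} (h : mor F a = mor F b) :
    a = b := (hF x y).1 h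

theorem preimage_id (hF : FullyFaithful F) (x : A) : hF.preimage (𝟙 (ob F x)) = 𝟙 x :=
  hF.mor_injective (by rw [mor_preimage, mor_id])

theorem preimage_comp (hF : FullyFaithful F) {x y z : A} (a : ob F x ⟶ ob F y)
    (b : ob F y ⟶ ob F z) : hF.preimage (a ≫ b) = hF.preimage a ≫ hF.preimage b :=
  hF.mor_injective (by rw [mor_comp, mor_preimage, mor_preimage, mor_preimage])

theorem preimage_add (hF : FullyFaithful F) {x y : A} (a b : ob F x ⟶ ob F y) :
    hF.preimage (a + b) = hF.preimage a + hF.preimage b :=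
  hF.mor_injective (by rw [mor_add, mor_preimage, mor_preimage, mor_preimage])

theorem preimage_smul (hF : FullyFaithful F) {x y : A} (z : 𝕜) (a : ob F x ⟶ ob F y) :
    hF.preimage (z • a) = z • hF.preimage a :=
  hF.mor_injective (by rw [mor_smul, mor_preimage, mor_preimage])

theorem preimage_star (hF : FullyFaithful F) {x y : A} (a : ob F x ⟶ ob F y) :
    hF.preimage (star a) = star (hF.preimage a) :=
  hF.mor_injective (by rw [mor_star, mor_preimage, mor_preimage])

theorem isUnitaryArrow_preimage (hF : FullyFaithful F) {x y : A} {b : ob F x ⟶ ob F y}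
    (hb : IsUnitaryArrow 𝕜 b) : IsUnitaryArrow 𝕜 (hF.preimage b) := by
  rw [IsUnitaryArrow, ← star_def, ← preimage_star, ← preimage_comp, ← preimage_comp, star_def,
    hb.1, hb.2, preimage_id, preimage_id]
  exact ⟨rfl, rfl⟩

/-- The factorization through a fully faithful `*`-functor `F` of a `*`-functor whose values on
objects are given as values of `F`. -/
def liftConj (hF : FullyFaithful F) (K : C ⟶ B) (o : C → A) (v : ∀ x, ob K x ⟶ ob F (o x))
    (hv : ∀ x, IsUnitaryArrow 𝕜 (v x)) : C ⟶ A :=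
  { obj := o
    map := fun c => hF.preimage (mor (conj K (fun x => ob F (o x)) v hv) c)
    map_id := fun x => (congrArg hF.preimage (mor_id (conj K _ v hv) x)).trans
      (hF.preimage_id (o x))
    map_comp := fun a b => (congrArg hF.preimage (mor_comp (conj K _ v hv) a b)).trans
      (hF.preimage_comp _ _)
    map_add := fun a b => (congrArg hF.preimage (mor_add (conj K _ v hv) a b)).trans
      (hF.preimage_add _ _)
    map_smul := fun z a => (congrArg hF.preimage (mor_smul (conj K _ v hv) z a)).trans
      (hF.preimage_smul z _)
    map_adj := fun a => (congrArg hF.preimage (mor_star (conj K _ v hv) a)).trans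
      (hF.preimage_star _) : StarFunctor 𝕜 C A }

theorem liftConj_comp (hF : FullyFaithful F) (K : C ⟶ B) (o : C → A)
    (v : ∀ x, ob K x ⟶ ob F (o x)) (hv : ∀ x, IsUnitaryArrow 𝕜 (v x)) :
    hF.liftConj K o v hv ≫ F = conj K (fun x => ob F (o x)) v hv :=
  StarFunctor.ext_onArrow fun _ => congrArg Arrow.mk (hF.mor_preimage _)

/-- The factorization of a `*`-functor through a fully faithful one, when the factorization is
given on objects. -/
def lift (hF : FullyFaithful F) (K : C ⟶ B) (o : C → A) (h : ∀ x, ob K x = ob F (o x)) : C ⟶ A :=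
  hF.liftConj K o (fun x => eqToHom (h x)) fun x => .eqToHom (h x)

@[simp] theorem lift_comp (hF : FullyFaithful F) (K : C ⟶ B) (o : C → A)
    (h : ∀ x, ob K x = ob F (o x)) : hF.lift K o h ≫ F = K := by
  refine (hF.liftConj_comp _ _ _ _).trans (conj_eq_self K fun x => ?_)
  generalize_proofs e
  revert e
  generalize ob F (o x) = y
  rintro rfl
  rfl

theorem hom_ext (hF : FullyFaithful F) {K L : C ⟶ A} (h : ∀ x, ob K x = ob L x)
    (e : K ≫ F = L ≫ F) : K = L := by
  refine hom_ext_mor h fun {x y} c => hF.mor_injective ?_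
  rw [mor_comp, mor_comp, mor_eqToHom, mor_eqToHom]
  exact congr_mor e c

theorem unitaryIso_of_comp (hF : FullyFaithful F) {K L : C ⟶ A}
    (h : unitaryIso 𝕜 (K ≫ F) (L ≫ F)) : unitaryIso 𝕜 K L := by
  obtain ⟨v, hv, h⟩ := h
  change ∀ x, ob F (ob K x) ⟶ ob F (ob L x) at v
  refine ⟨fun x => hF.preimage (v x), fun x => hF.isUnitaryArrow_preimage (hv x),
    fun {x y} a => hF.mor_injective ?_⟩
  rw [mor_comp, mor_comp, mor_preimage, mor_preimage]
  exact h a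

end FullyFaithful

/-- A quasi-inverse `G` is the identity of `B`, conjugated by the chosen unitaries so that its
values on objects are values of `F`, and then factored through `F`. -/
theorem unitaryEquivalences_of_fullyFaithful {F : A ⟶ B} (hF : FullyFaithful F)
    (h : ∀ y : B, ∃ (x : A) (v : ob F x ⟶ y), IsUnitaryArrow 𝕜 v) :
    unitaryEquivalences 𝕜 F := by
  choose o v hv using h
  let G : B ⟶ A := hF.liftConj (𝟙 B) o (fun y => star (v y)) fun y => (hv y).adj
  have hG : unitaryIso 𝕜 (G ≫ F) (𝟙 B) :=
    (unitaryIso_of_eq (hF.liftConj_comp _ _ _ _)).trans (unitaryIso_conj _ _ _ _).symm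
  -- Precomposing the isomorphism `hG` with `F` relates F ≫ G ≫ F to F; since `F` reflects unitary
  -- isomorphisms, F ≫ G is unitarily isomorphic to the identity.
  exact (unitaryEquivalences_iff F).2 ⟨G, hF.unitaryIso_of_comp
    (HomRel.IsStableUnderPrecomp.comp_left F hG), hG⟩

end

end CStarCat

/-! ### The unitary model structure -/

namespace CStarCat

variable {𝕜 : Type} [RCLike 𝕜]

section

variable {A B C D X Y : CStarCat.{u} 𝕜}

theorem arrow_eqToHom_comp {C : Type u} [Category.{v} C] {x y z : C} (h : x = y) (f : y ⟶ z) :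
    Arrow.mk (eqToHom h ≫ f) = Arrow.mk f := by
  subst h
  rw [eqToHom_refl, Category.id_comp]

theorem unitaryFibrations_iff (F : A ⟶ B) : unitaryFibrations 𝕜 F ↔
    ∀ (x : A) (t : Arrow B), t.left = ob F x → IsUnitaryArrow 𝕜 t.hom →
      ∃ s : Arrow A, s.left = x ∧ IsUnitaryArrow 𝕜 s.hom ∧ arr F s = t := by
  constructor
  · rintro h x ⟨_, y, t⟩ rfl ht
    obtain ⟨x', s, rfl, hs, e⟩ := h x y t ht
    refine ⟨Arrow.mk s, rfl, hs, congrArg Arrow.mk ?_⟩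
    exact (Category.comp_id _).symm.trans e
  · intro h x y t ht
    obtain ⟨⟨_, x', s⟩, rfl, hs, e⟩ := h x (Arrow.mk t) rfl ht
    obtain rfl : ob F x' = y := congrArg (fun a : Arrow B => a.right) e
    exact ⟨x', s, rfl, hs, (Category.comp_id _).trans ((Arrow.mk_inj _ _).1 e)⟩

instance : (unitaryCofibrations.{u} 𝕜).IsStableUnderRetracts where
  of_retract {A B C D F G} h hG x y hxy := by
    have hi : ∀ x, ob h.r.left (ob h.i.left x) = x := fun x =>
      congr_ob (show h.i.left ≫ h.r.left = 𝟙 _ from by simp) x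
    have hw : ∀ x, ob G (ob h.i.left x) = ob h.i.right (ob F x) := fun x =>
      congr_ob (show h.i.left ≫ G = F ≫ h.i.right from by simp) x
    rw [← hi x, ← hi y]
    refine congrArg _ (hG ?_)
    exact (hw x).trans ((congrArg (ob h.i.right) hxy).trans (hw y).symm)

instance : (unitaryFibrations.{u} 𝕜).IsStableUnderRetracts where
  of_retract {A B C D F G} h hG := by
    rw [unitaryFibrations_iff] at hG ⊢
    intro x t ht hu
    have hi : ∀ x, ob h.r.left (ob h.i.left x) = x := fun x =>
      congr_ob (show h.i.left ≫ h.r.left = 𝟙 _ from by simp) x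
    have hi' : ∀ a, arr h.r.right (arr h.i.right a) = a := fun a =>
      congr_arr (show h.i.right ≫ h.r.right = 𝟙 _ from by simp) a
    have hw : ∀ x, ob G (ob h.i.left x) = ob h.i.right (ob F x) := fun x =>
      congr_ob (show h.i.left ≫ G = F ≫ h.i.right from by simp) x
    have hw' : ∀ a, arr F (arr h.r.left a) = arr h.r.right (arr G a) := fun a =>
      congr_arr (show h.r.left ≫ F = G ≫ h.r.right from by simp) a
    obtain ⟨s, hs, hs', e⟩ := hG (ob h.i.left x) (arr h.i.right t)
      ((congrArg (ob h.i.right) ht).trans (hw x).symm) (isUnitaryArrow_mor h.i.right hu)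
    exact ⟨arr h.r.left s, (congrArg (ob h.r.left) hs).trans (hi x),
      isUnitaryArrow_mor h.r.left hs', (hw' s).trans ((congrArg _ e).trans (hi' t))⟩

/-- An object of `B` is reached up to a unitary, and lifting that unitary replaces the source object
by one whose image is the given object exactly. -/
theorem ob_surjective_of_trivialFibration {F : A ⟶ B} (hF : unitaryFibrations 𝕜 F)
    (hF' : unitaryEquivalences 𝕜 F) : Function.Surjective (ob F) := by
  intro y
  obtain ⟨x, v, hv⟩ := exists_unitary_of_unitaryEquivalence hF' y
  obtain ⟨x', s, h, -, -⟩ := hF x y v hv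
  exact ⟨x', h⟩

/-! ### Lifting properties -/

/-- As `p` is fully faithful and surjective on objects, a diagonal amounts to a choice of objects
over `g`: prescribed by `f` on the image of `i`, where injectivity of `i` prevents conflicts, and
arbitrary elsewhere. -/
theorem hasLiftingProperty_of_trivialFibration {i : A ⟶ B} {p : X ⟶ Y}
    (hi : unitaryCofibrations 𝕜 i) (hp : unitaryFibrations 𝕜 p)
    (hp' : unitaryEquivalences 𝕜 p) : HasLiftingProperty i p where
  sq_hasLift {f g} sq := by
    have hff := fullyFaithful_of_unitaryEquivalence hp'
    have key : ∀ b, ∃ x, ob g b = ob p x ∧ ∀ a, ob i a = b → x = ob f a := by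
      intro b
      by_cases h : ∃ a, ob i a = b
      · obtain ⟨a, rfl⟩ := h
        exact ⟨ob f a, (congr_ob sq.w a).symm, fun a' ha => by rw [hi ha]⟩
      · obtain ⟨x, hx⟩ := ob_surjective_of_trivialFibration hp hp' (ob g b)
        exact ⟨x, hx.symm, fun a ha => (h ⟨a, ha⟩).elim⟩
    choose o ho ho' using key
    refine ⟨⟨⟨hff.lift g o ho, hff.hom_ext (fun a => ho' _ a rfl) ?_, hff.lift_comp g o ho⟩⟩⟩
    rw [Category.assoc, hff.lift_comp, sq.w]

/-- `i` has a strict retraction `r`, with a unitary isomorphism `w` from r ≫ i to the identity that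
is trivial on the image of `i`. Lifting `g` of `w` along `p` to unitaries `v` starting at r ≫ f, and
conjugating r ≫ f by `v`, gives the diagonal. -/
theorem hasLiftingProperty_of_trivialCofibration {i : A ⟶ B} {p : X ⟶ Y}
    (hi : unitaryCofibrations 𝕜 i) (hi' : unitaryEquivalences 𝕜 i)
    (hp : unitaryFibrations 𝕜 p) : HasLiftingProperty i p where
  sq_hasLift {f g} sq := by
    have hff := fullyFaithful_of_unitaryEquivalence hi'
    -- Over the image of `i` both unitaries are chosen to be identities, so that the diagonal
    -- extends `f` strictly and not only up to isomorphism.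
    have key : ∀ b, ∃ (a : A) (w : ob i a ⟶ b) (x : X) (v : ob f a ⟶ x),
        IsUnitaryArrow 𝕜 w ∧ IsUnitaryArrow 𝕜 v ∧
        Arrow.mk (mor p v) = Arrow.mk (mor g w) ∧
        ∀ a', ob i a' = b → a = a' ∧ Arrow.mk w = Arrow.mk (𝟙 (ob i a')) ∧
          Arrow.mk v = Arrow.mk (𝟙 (ob f a')) := by
      intro b
      by_cases h : ∃ a, ob i a = b
      · obtain ⟨a, rfl⟩ := h
        refine ⟨a, 𝟙 _, ob f a, 𝟙 _, .id _, .id _, ?_, fun a' ha => ?_⟩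
        · rw [mor_id, mor_id]
          exact congrArg (fun y => Arrow.mk (𝟙 y)) (congr_ob sq.w a)
        · obtain rfl := hi ha
          exact ⟨rfl, rfl, rfl⟩
      · obtain ⟨a, w, hw⟩ := exists_unitary_of_unitaryEquivalence hi' b
        obtain ⟨⟨_, x, v⟩, rfl, hv, e⟩ := (unitaryFibrations_iff p).1 hp (ob f a)
          (Arrow.mk (mor g w)) (congr_ob sq.w a).symm (isUnitaryArrow_mor g hw)
        exact ⟨a, w, x, v, hw, hv, e, fun a' ha => (h ⟨a', ha⟩).elim⟩
    choose o w t v hw hv e hn using key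
    let r : B ⟶ A := hff.liftConj (𝟙 B) o (fun b => star (w b)) fun b => (hw b).adj
    have hri : r ≫ i = conj (𝟙 B) (fun b => ob i (o b)) (fun b => star (w b))
        fun b => (hw b).adj := hff.liftConj_comp _ _ _ _
    have hir : i ≫ r = 𝟙 A := hff.hom_ext (fun a => (hn _ a rfl).1) <|
      (congrArg (i ≫ ·) hri).trans <| (comp_conj i _ _ _ _).trans <| conj_eq_self i fun a =>
        (congrArg (fun a : Arrow B => Arrow.mk (star a.hom)) (hn _ a rfl).2.1).trans
          (congrArg Arrow.mk (star_id _))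
    -- r ≫ i is the identity conjugated by the adjoints of `w`, so conjugating by `w` undoes it.
    have hw' : conj (r ≫ i) (fun b => b) w hw = 𝟙 B :=
      (conj_congr hri fun _ => rfl).trans <|
        (conj_conj (𝟙 B) _ _ (fun b => (hw b).adj) _ w hw).trans <|
          conj_eq_self (𝟙 B) fun b => congrArg Arrow.mk (hw b).2
    have hf : i ≫ r ≫ f = f := by rw [← Category.assoc, hir, Category.id_comp]
    have hg : (r ≫ f) ≫ p = (r ≫ i) ≫ g := by rw [Category.assoc, sq.w, Category.assoc]
    refine ⟨⟨⟨conj (r ≫ f) t v hv, ?_, ?_⟩⟩⟩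
    · exact (comp_conj i (r ≫ f) t v hv).trans <|
        (conj_congr hf fun a => (hn _ a rfl).2.2).trans (conj_id f)
    -- Since `p` sends `v` to the image of `w` under `g`, the diagonal followed by `p` is conj (r ≫
    -- i) w followed by `g`, that is, `g`.
    · exact (conj_comp (r ≫ f) t v hv p).trans <| (conj_congr hg e).trans <|
        (conj_comp (r ≫ i) _ w hw g).symm.trans <|
          (congrArg (· ≫ g) hw').trans (Category.id_comp g)

/-! ### Factorizations -/

section

variable (B : CStarCat.{u} 𝕜) {S : Type u} (f : S → B)

/-- The objects of a `C*`-category with objects indexed by a given type. -/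
structure PullbackObj {𝕜 : Type} [RCLike 𝕜] (B : CStarCat.{u} 𝕜) {S : Type u} (f : S → B) :
    Type u where
  val : S

instance : Category.{u} (PullbackObj B f) where
  Hom x y := f x.val ⟶ f y.val
  id x := 𝟙 (f x.val)
  comp a b := a ≫ b
  id_comp _ := Category.id_comp _
  comp_id _ := Category.comp_id _
  assoc _ _ _ := Category.assoc _ _ _

instance : Preadditive (PullbackObj B f) where
  homGroup x y := inferInstanceAs (AddCommGroup (f x.val ⟶ f y.val))
  add_comp _ _ _ := Preadditive.add_comp (C := B) _ _ _
  comp_add _ _ _ := Preadditive.comp_add (C := B) _ _ _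

instance : Linear 𝕜 (PullbackObj B f) where
  homModule x y := inferInstanceAs (Module 𝕜 (f x.val ⟶ f y.val))
  smul_comp _ _ _ := Linear.smul_comp (C := B) _ _ _
  comp_smul _ _ _ := Linear.comp_smul (C := B) _ _ _

theorem isIso_pullbackObj {x : PullbackObj B f} {h : x ⟶ x}
    (hh : IsIso (C := B) (X := f x.val) (Y := f x.val) h) : IsIso h :=
  ⟨⟨inv (C := B) (X := f x.val) (Y := f x.val) h, IsIso.hom_inv_id (C := B) _,
    IsIso.inv_hom_id (C := B) _⟩⟩

instance : CStarCategory 𝕜 (PullbackObj B f) where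
  adj a := StarCategory.adj 𝕜 (A := B) a
  adj_add := StarCategory.adj_add (A := B)
  adj_smul := StarCategory.adj_smul (A := B)
  adj_comp := StarCategory.adj_comp (A := B)
  adj_adj := StarCategory.adj_adj (A := B)
  homNorm x y := CStarCategory.homNorm 𝕜 (f x.val) (f y.val)
  core x y := CStarCategory.core (f x.val) (f y.val)
  complete x y := CStarCategory.complete (𝕜 := 𝕜) (f x.val) (f y.val)
  norm_comp_le := CStarCategory.norm_comp_le (𝕜 := 𝕜) (A := B)
  norm_comp_adj := CStarCategory.norm_comp_adj (𝕜 := 𝕜) (A := B)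
  positive a z hz := CStarCategory.positive (𝕜 := 𝕜) (A := B) a z
    fun h => hz (isIso_pullbackObj B f h)

/-- The `C*`-category with objects indexed by a given type and arrows from a given
`C*`-category. -/
def pullbackObj : CStarCat.{u} 𝕜 := ⟨PullbackObj B f⟩

/-- The forgetful `*`-functor from a `C*`-category with objects indexed by a given type. -/
def forget : pullbackObj B f ⟶ B :=
  { obj := fun x => f x.val
    map := fun a => a
    map_id := fun _ => rfl
    map_comp := fun _ _ => rfl
    map_add := fun _ _ => rfl
    map_smul := fun _ _ => rfl
    map_adj := fun _ => rfl : StarFunctor 𝕜 (PullbackObj B f) B }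

theorem fullyFaithful_forget : FullyFaithful (forget B f) := fun _ _ => Function.bijective_id

end

end

end CStarCat

/-! ### Functorial factorizations -/

namespace CStarCat

variable {𝕜 : Type} [RCLike 𝕜]

section

variable {A B C : CStarCat.{u} 𝕜}

/-- The mapping cylinder: its objects are those of the source and of the target, and its arrows
are those of the target. -/
def cylinder (F : A ⟶ B) : CStarCat.{u} 𝕜 := pullbackObj B (Sum.elim (ob F) id)

/-- The projection of the mapping cylinder to the target. -/
def cylinderEnd (F : A ⟶ B) : cylinder F ⟶ B := forget _ _

theorem fullyFaithful_cylinderEnd (F : A ⟶ B) : FullyFaithful (cylinderEnd F) :=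
  fullyFaithful_forget _ _

/-- The functoriality of the mapping cylinder. -/
def cylinderMap {f g : Arrow (CStarCat.{u} 𝕜)} (φ : f ⟶ g) : cylinder f.hom ⟶ cylinder g.hom :=
  (fullyFaithful_cylinderEnd g.hom).lift (cylinderEnd f.hom ≫ φ.right)
    (fun x => ⟨Sum.map (ob φ.left) (ob φ.right) x.val⟩) (by
      rintro ⟨x | y⟩
      · exact (congr_ob (Arrow.w φ) x).symm
      · rfl)

theorem cylinderMap_cylinderEnd {f g : Arrow (CStarCat.{u} 𝕜)} (φ : f ⟶ g) :
    cylinderMap φ ≫ cylinderEnd g.hom = cylinderEnd f.hom ≫ φ.right :=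
  (fullyFaithful_cylinderEnd _).lift_comp _ _ _

/-- The embedding of the source in the mapping cylinder. -/
def cylinderInl (F : A ⟶ B) : A ⟶ cylinder F :=
  (fullyFaithful_cylinderEnd F).lift F (fun x => ⟨Sum.inl x⟩) fun _ => rfl

theorem cylinderInl_cylinderEnd (F : A ⟶ B) : cylinderInl F ≫ cylinderEnd F = F :=
  (fullyFaithful_cylinderEnd _).lift_comp _ _ _

/-- A unitary ending at y lifts to the same arrow, ending at the copy of y in the second summand. -/
theorem unitaryFibrations_cylinderEnd (F : A ⟶ B) : unitaryFibrations 𝕜 (cylinderEnd F) :=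
  fun x y t ht => ⟨⟨Sum.inr y⟩, t, rfl, ht,
    Category.comp_id (show (Hom.toStar (cylinderEnd F)).obj x ⟶ y from t)⟩

theorem unitaryEquivalences_cylinderEnd (F : A ⟶ B) : unitaryEquivalences 𝕜 (cylinderEnd F) :=
  unitaryEquivalences_of_fullyFaithful (fullyFaithful_cylinderEnd F) fun y =>
    ⟨⟨Sum.inr y⟩, 𝟙 y, .id y⟩

variable (𝕜) in
/-- The factorization through the mapping cylinder. -/
def cylinderFactorization : MorphismProperty.FunctorialFactorizationData
    (unitaryCofibrations.{u} 𝕜) (unitaryFibrations 𝕜 ⊓ unitaryEquivalences 𝕜) where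
  Z :=
    { obj := fun f => cylinder f.hom
      map := cylinderMap
      map_id := fun f => (fullyFaithful_cylinderEnd _).hom_ext (by rintro ⟨x | y⟩ <;> rfl)
        (cylinderMap_cylinderEnd _)
      map_comp := fun φ ψ => (fullyFaithful_cylinderEnd _).hom_ext (by rintro ⟨x | y⟩ <;> rfl) (by
        rw [Category.assoc, cylinderMap_cylinderEnd, cylinderMap_cylinderEnd, ← Category.assoc,
          cylinderMap_cylinderEnd, Category.assoc, Arrow.comp_right]) }
  i :=
    { app := fun f => cylinderInl f.hom
      naturality := fun f g φ => (fullyFaithful_cylinderEnd _).hom_ext (fun _ => rfl) (by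
        change (φ.left ≫ cylinderInl g.hom) ≫ cylinderEnd g.hom =
          (cylinderInl f.hom ≫ cylinderMap φ) ≫ cylinderEnd g.hom
        rw [Category.assoc, cylinderInl_cylinderEnd, Category.assoc, cylinderMap_cylinderEnd,
          ← Category.assoc, cylinderInl_cylinderEnd, Arrow.w]) }
  p :=
    { app := fun f => cylinderEnd f.hom
      naturality := fun f g φ => cylinderMap_cylinderEnd φ }
  fac := by
    ext f : 2
    exact cylinderInl_cylinderEnd f.hom
  hi f x y h := Sum.inl_injective (congrArg PullbackObj.val h)
  hp f := ⟨unitaryFibrations_cylinderEnd f.hom, unitaryEquivalences_cylinderEnd f.hom⟩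

/-- The objects of the mapping path category: an object of the source together with a unitary
arrow of the target starting at its image. -/
@[ext]
structure PathObj (F : A ⟶ B) : Type u where
  pt : A
  -- Storing the unitary with its endpoints and an equation for its source makes the functoriality
  -- of paths an equality of arrows, free of transports.
  arrow : Arrow B
  left_eq : arrow.left = ob F pt
  unitary : IsUnitaryArrow 𝕜 arrow.hom

/-- The mapping path category: its arrows are those of the source. -/
def path (F : A ⟶ B) : CStarCat.{u} 𝕜 := pullbackObj A (PathObj.pt (F := F))

/-- The projection of the mapping path category to the source. -/
def pathStart (F : A ⟶ B) : path F ⟶ A := forget _ _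

theorem fullyFaithful_pathStart (F : A ⟶ B) : FullyFaithful (pathStart F) :=
  fullyFaithful_forget _ _

/-- The functoriality of the mapping path category on objects. -/
def PathObj.map {f g : Arrow (CStarCat.{u} 𝕜)} (φ : f ⟶ g) (x : PathObj f.hom) :
    PathObj g.hom where
  pt := ob φ.left x.pt
  arrow := arr φ.right x.arrow
  left_eq := (congrArg (ob φ.right) x.left_eq).trans (congr_ob φ.w x.pt).symm
  unitary := isUnitaryArrow_mor φ.right x.unitary

/-- The functoriality of the mapping path category. -/
def pathMap {f g : Arrow (CStarCat.{u} 𝕜)} (φ : f ⟶ g) : path f.hom ⟶ path g.hom :=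
  (fullyFaithful_pathStart _).lift (pathStart _ ≫ φ.left) (fun x => ⟨PathObj.map φ x.val⟩)
    fun _ => rfl

theorem pathMap_pathStart {f g : Arrow (CStarCat.{u} 𝕜)} (φ : f ⟶ g) :
    pathMap φ ≫ pathStart _ = pathStart _ ≫ φ.left :=
  (fullyFaithful_pathStart _).lift_comp _ _ _

/-- The constant path at an object. -/
def PathObj.const (F : A ⟶ B) (x : A) : PathObj F := ⟨x, Arrow.mk (𝟙 (ob F x)), rfl, .id _⟩

/-- The embedding of the source in the mapping path category. -/
def pathConst (F : A ⟶ B) : A ⟶ path F :=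
  (fullyFaithful_pathStart _).lift (𝟙 A) (fun x => ⟨PathObj.const F x⟩) fun _ => rfl

theorem pathConst_pathStart (F : A ⟶ B) : pathConst F ≫ pathStart _ = 𝟙 A :=
  (fullyFaithful_pathStart _).lift_comp _ _ _

/-- The unitary arrow belonging to an object of the mapping path category. -/
def PathObj.hom {F : A ⟶ B} (x : PathObj F) : ob F x.pt ⟶ x.arrow.right :=
  eqToHom x.left_eq.symm ≫ x.arrow.hom

theorem PathObj.isUnitaryArrow_hom {F : A ⟶ B} (x : PathObj F) : IsUnitaryArrow 𝕜 x.hom :=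
  (IsUnitaryArrow.eqToHom _).comp x.unitary

theorem PathObj.mk_hom {F : A ⟶ B} (x : PathObj F) : Arrow.mk x.hom = x.arrow :=
  arrow_eqToHom_comp _ _

/-- The evaluation at the end point. -/
def pathEnd (F : A ⟶ B) : path F ⟶ B :=
  conj (pathStart _ ≫ F) (fun x => x.val.arrow.right) (fun x => x.val.hom)
    fun x => x.val.isUnitaryArrow_hom

theorem pathMap_pathEnd {f g : Arrow (CStarCat.{u} 𝕜)} (φ : f ⟶ g) :
    pathMap φ ≫ pathEnd g.hom = pathEnd f.hom ≫ φ.right := by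
  refine (comp_conj (pathMap φ) (pathStart _ ≫ g.hom) _ _ _).trans ?_
  refine Eq.trans ?_ (conj_comp (pathStart _ ≫ f.hom) _ _ _ φ.right).symm
  refine conj_congr ?_ fun x => ?_
  · rw [← Category.assoc, pathMap_pathStart, Category.assoc, Category.assoc]
    exact congrArg (_ ≫ ·) (Arrow.w φ)
  · exact (PathObj.mk_hom _).trans (congrArg (arr φ.right) (PathObj.mk_hom x.val)).symm

theorem pathConst_pathEnd (F : A ⟶ B) : pathConst F ≫ pathEnd F = F := by
  refine (comp_conj (pathConst F) (pathStart _ ≫ F) _ _ _).trans ?_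
  refine (conj_congr (K' := F) (v' := fun x => 𝟙 (ob F x)) (hv' := fun _ => .id _) ?_
    fun x => PathObj.mk_hom _).trans (conj_id F)
  rw [← Category.assoc, pathConst_pathStart, Category.id_comp]

/-- A path (x, u) is prolonged by a unitary t to (x, u ≫ t). The identity of x is a unitary arrow
between these paths, and its image under `pathEnd` is star u ≫ u ≫ t = t. -/
theorem unitaryFibrations_pathEnd (F : A ⟶ B) : unitaryFibrations 𝕜 (pathEnd F) := by
  rw [unitaryFibrations_iff]
  rintro x ⟨_, y, t⟩ rfl ht
  change ob (pathEnd F) x ⟶ y at t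
  let x' : path F := ⟨⟨x.val.pt, Arrow.mk (x.val.arrow.hom ≫ t), x.val.left_eq,
    x.val.unitary.comp ht⟩⟩
  let s : x ⟶ x' := 𝟙 x.val.pt
  refine ⟨Arrow.mk s, rfl, .id x.val.pt, congrArg Arrow.mk ?_⟩
  refine (congrArg (fun a => star x.val.hom ≫ a ≫ x'.val.hom) (mor_id F x.val.pt)).trans ?_
  refine (congrArg (star x.val.hom ≫ ·) ((Category.id_comp _).trans
    (Category.assoc _ _ _).symm)).trans ?_
  exact x.val.isUnitaryArrow_hom.adj_comp_comp t

/-- The constant paths form a section of `pathStart`, which is fully faithful and surjective on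
objects; two-out-of-three concludes. -/
theorem unitaryEquivalences_pathConst (F : A ⟶ B) : unitaryEquivalences 𝕜 (pathConst F) := by
  have h : unitaryEquivalences 𝕜 (pathStart F) :=
    unitaryEquivalences_of_fullyFaithful (fullyFaithful_pathStart F) fun x =>
      ⟨⟨PathObj.const F x⟩, 𝟙 x, .id x⟩
  refine MorphismProperty.of_postcomp _ (pathConst F) (pathStart F) h ?_
  rw [pathConst_pathStart]
  exact (unitaryEquivalences_iff _).2 ⟨𝟙 A, unitaryIso_refl _, unitaryIso_refl _⟩

variable (𝕜) in
/-- The factorization through the mapping path category. -/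
def pathFactorization : MorphismProperty.FunctorialFactorizationData
    (unitaryCofibrations.{u} 𝕜 ⊓ unitaryEquivalences 𝕜) (unitaryFibrations 𝕜) where
  Z :=
    { obj := fun f => path f.hom
      map := pathMap
      map_id := fun f => (fullyFaithful_pathStart _).hom_ext (fun _ => rfl) (pathMap_pathStart _)
      map_comp := fun φ ψ => (fullyFaithful_pathStart _).hom_ext (fun _ => rfl) (by
        rw [Category.assoc, pathMap_pathStart, pathMap_pathStart, ← Category.assoc,
          pathMap_pathStart, Category.assoc, Arrow.comp_left]) }
  i :=
    { app := fun f => pathConst f.hom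
      naturality := fun f g φ => (fullyFaithful_pathStart _).hom_ext
        (fun x => congrArg PullbackObj.mk (PathObj.ext rfl
          ((congrArg (fun y => Arrow.mk (𝟙 y)) (congr_ob (Arrow.w φ) x)).trans
            (congrArg Arrow.mk (mor_id φ.right _)).symm))) (by
        change (φ.left ≫ pathConst g.hom) ≫ pathStart g.hom =
          (pathConst f.hom ≫ pathMap φ) ≫ pathStart g.hom
        rw [Category.assoc, pathConst_pathStart, Category.assoc, pathMap_pathStart,
          ← Category.assoc, pathConst_pathStart, Category.id_comp, Category.comp_id]) }
  p :=
    { app := fun f => pathEnd f.hom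
      naturality := fun f g φ => pathMap_pathEnd φ }
  fac := by
    ext f : 2
    exact pathConst_pathEnd f.hom
  hi f := ⟨fun x y h => congrArg (fun z : path f.hom => z.val.pt) h,
    unitaryEquivalences_pathConst f.hom⟩
  hp f := unitaryFibrations_pathEnd f.hom

variable (𝕜) in
/-- The unitary model structure. -/
@[reducible]
def unitaryModelCategory : ModelCategory (CStarCat.{u} 𝕜) where
  categoryWithFibrations := ⟨unitaryFibrations 𝕜⟩
  categoryWithCofibrations := ⟨unitaryCofibrations 𝕜⟩
  categoryWithWeakEquivalences := ⟨unitaryEquivalences 𝕜⟩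
  cm2 := inferInstanceAs (unitaryEquivalences.{u} 𝕜).HasTwoOutOfThreeProperty
  cm3a := inferInstanceAs (unitaryEquivalences.{u} 𝕜).IsStableUnderRetracts
  cm3b := inferInstanceAs (unitaryFibrations.{u} 𝕜).IsStableUnderRetracts
  cm3c := inferInstanceAs (unitaryCofibrations.{u} 𝕜).IsStableUnderRetracts
  cm4a i p hi hi' hp := hasLiftingProperty_of_trivialCofibration hi.mem hi'.mem hp.mem
  cm4b i p hi hp hp' := hasLiftingProperty_of_trivialFibration hi.mem hp.mem hp'.mem
  cm5a :=
    have : MorphismProperty.HasFunctorialFactorization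
      (unitaryCofibrations.{u} 𝕜 ⊓ unitaryEquivalences 𝕜) (unitaryFibrations 𝕜) :=
        ⟨⟨pathFactorization 𝕜⟩⟩
    inferInstanceAs (MorphismProperty.HasFactorization
      (unitaryCofibrations.{u} 𝕜 ⊓ unitaryEquivalences 𝕜) (unitaryFibrations 𝕜))
  cm5b :=
    have : MorphismProperty.HasFunctorialFactorization
      (unitaryCofibrations.{u} 𝕜) (unitaryFibrations 𝕜 ⊓ unitaryEquivalences 𝕜) :=
        ⟨⟨cylinderFactorization 𝕜⟩⟩
    inferInstanceAs (MorphismProperty.HasFactorization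
      (unitaryCofibrations.{u} 𝕜) (unitaryFibrations 𝕜 ⊓ unitaryEquivalences 𝕜))

end

end CStarCat

/-! ### The pushout-product axiom -/

namespace CStarCat

variable {𝕜 : Type} [RCLike 𝕜]

section

variable {A B C A' B' : CStarCat.{u} 𝕜}

theorem tensHom_mapl (F : A ⟶ A') (G : B ⟶ B') {x x' : A} (a : x ⟶ x') (y : B) :
    (Hom.toStar (tensHom F G)).map (mapl a y) = mapl (mor F a) (ob G y) :=
  (homBimap F G).lift_mapl a y

theorem tensHom_mapr (F : A ⟶ A') (G : B ⟶ B') (x : A) {y y' : B} (b : y ⟶ y') :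
    (Hom.toStar (tensHom F G)).map (mapr x b) = mapr (ob F x) (mor G b) :=
  (homBimap F G).lift_mapr x b

/-- The isomorphism is v ⊗ 1. Its naturality in the first variable is that of v, in the second it is
the exchange law, and `tens_natural` combines the two. -/
theorem unitaryIso_tensHom_id {F G : A ⟶ B} (h : unitaryIso 𝕜 F G) (C : CStarCat.{u} 𝕜) :
    unitaryIso 𝕜 (tensHom F (𝟙 C)) (tensHom G (𝟙 C)) := by
  obtain ⟨v, hv, h⟩ := h
  refine ⟨fun p => mapl (v (tfst p)) (tsnd p),
    fun p => isUnitaryArrow_mor (tinl B (tsnd p)) (hv _), fun {p q} f =>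
    tens_natural (L := tensHom F (𝟙 C)) (L' := tensHom G (𝟙 C))
      (fun p => mapl (v (tfst p)) (tsnd p)) (fun y x x' a => ?_) (fun x y y' b => ?_) f⟩
  · rw [tensHom_mapl, tensHom_mapl]
    refine (mor_comp (tinl B y) _ _).symm.trans (Eq.trans ?_ (mor_comp (tinl B y) _ _))
    exact congrArg (mor (tinl B y)) (h a)
  · rw [tensHom_mapr, tensHom_mapr]
    exact (mapl_comp_mapr (v x) b).symm

theorem unitaryEquivalences_tensHom_id {F : A ⟶ B} (hF : unitaryEquivalences 𝕜 F)
    (C : CStarCat.{u} 𝕜) : unitaryEquivalences 𝕜 (tensHom F (𝟙 C)) := by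
  rw [unitaryEquivalences_iff] at hF ⊢
  obtain ⟨G, h, h'⟩ := hF
  refine ⟨tensHom G (𝟙 C), ?_, ?_⟩
  · have := unitaryIso_tensHom_id h C
    rwa [tensHom_id, ← Category.comp_id (𝟙 C), ← tensHom_comp] at this
  · have := unitaryIso_tensHom_id h' C
    rwa [tensHom_id, ← Category.comp_id (𝟙 C), ← tensHom_comp] at this

theorem unitaryEquivalences_id_tensHom {F : A ⟶ B} (hF : unitaryEquivalences 𝕜 F)
    (C : CStarCat.{u} 𝕜) : unitaryEquivalences 𝕜 (tensHom (𝟙 C) F) := by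
  have hβ : ∀ X Y : CStarCat.{u} 𝕜, unitaryEquivalences 𝕜 (braid X Y) := fun X Y =>
    (unitaryEquivalences_iff _).2 ⟨braid Y X, unitaryIso_of_eq (braid_braid X Y),
      unitaryIso_of_eq (braid_braid Y X)⟩
  refine MorphismProperty.of_postcomp _ _ (braid C B) (hβ C B) ?_
  rw [braid_naturality]
  exact MorphismProperty.comp_mem _ _ _ (hβ C A) (unitaryEquivalences_tensHom_id hF C)

theorem unitaryCofibrations_tensHom {F : A ⟶ B} {F' : A' ⟶ B'} (hF : unitaryCofibrations 𝕜 F)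
    (hF' : unitaryCofibrations 𝕜 F') : unitaryCofibrations 𝕜 (tensHom F F') := by
  intro p q h
  change tpair (ob F (tfst p)) (ob F' (tsnd p)) = tpair (ob F (tfst q)) (ob F' (tsnd q)) at h
  have h1 : tfst p = tfst q := hF (congrArg tfst h)
  have h2 : tsnd p = tsnd q := hF' (congrArg tsnd h)
  rw [← tpair_eta p, ← tpair_eta q, h1, h2]

/-! ### Objects of pushouts -/

/-- The data of the `C*`-category with given objects and zero Hom spaces. -/
def zeroData (𝕜 : Type) [RCLike 𝕜] (T : Type u) : FamilyData.{u} 𝕜 where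
  I := PEmpty
  C := PEmpty.elim
  X := T
  ev _ i := i.elim
  N _ _ := ⊤
  isClosed _ _ := isClosed_univ
  id_mem _ := trivial
  comp_mem _ _ := trivial
  star_mem _ := trivial

theorem zeroData_hom_eq {T : Type u} {x y : (zeroData 𝕜 T).Obj} (f g : x ⟶ y) : f = g :=
  FamilyData.hom_ext fun i => i.elim

/-- The `*`-functor to a `C*`-category with zero Hom spaces with given values on objects. -/
def toZero {T : Type u} (g : A → T) : A ⟶ (zeroData 𝕜 T).toCStarCat :=
  { obj := fun x => ⟨g x⟩
    map := fun _ => 0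
    map_id := fun _ => zeroData_hom_eq _ _
    map_comp := fun _ _ => zeroData_hom_eq _ _
    map_add := fun _ _ => zeroData_hom_eq _ _
    map_smul := fun _ _ => zeroData_hom_eq _ _
    map_adj := fun _ => zeroData_hom_eq _ _ : StarFunctor 𝕜 A (zeroData 𝕜 T).Obj }

theorem toZero_ext {T : Type u} {F G : A ⟶ (zeroData 𝕜 T).toCStarCat}
    (h : ∀ x, ob F x = ob G x) : F = G :=
  hom_ext_mor h fun _ => zeroData_hom_eq _ _

/-- A map of objects into a C*-category with zero Hom spaces extends uniquely to a *-functor. With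
truth values as objects, the characteristic function of the union of the two images and the constant
function `True` agree on both legs, hence on the whole pushout. -/
theorem exists_ob_eq_of_isPushout {P : CStarCat.{u} 𝕜} {f : A ⟶ B} {g : A ⟶ C} {inl : B ⟶ P}
    {inr : C ⟶ P} (sq : IsPushout f g inl inr) (p : P) :
    (∃ b, ob inl b = p) ∨ ∃ c, ob inr c = p := by
  let χ : P ⟶ (zeroData 𝕜 (ULift.{u} Prop)).toCStarCat :=
    toZero fun p => ⟨(∃ b, ob inl b = p) ∨ ∃ c, ob inr c = p⟩
  let τ : P ⟶ (zeroData 𝕜 (ULift.{u} Prop)).toCStarCat := toZero fun _ => ⟨True⟩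
  let mk (q : Prop) : (zeroData 𝕜 (ULift.{u} Prop)).Obj := ⟨ULift.up q⟩
  have h : χ = τ := sq.hom_ext
    (toZero_ext fun b => congrArg mk (eq_true (Or.inl ⟨b, rfl⟩)))
    (toZero_ext fun c => congrArg mk (eq_true (Or.inr ⟨c, rfl⟩)))
  exact of_eq_true (congrArg (fun x : (zeroData 𝕜 (ULift.{u} Prop)).Obj => x.val.down)
    (congr_ob h p))

/-- On objects, both legs map injectively to ob B × ob B'. If (b, F' a') = (F a, b'), then b = F a
and b' = F' a', so both objects come from (a, a') and are already identified in the pushout. -/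
theorem unitaryCofibrations_pushoutProduct {F : A ⟶ B} {F' : A' ⟶ B'}
    (hF : unitaryCofibrations 𝕜 F) (hF' : unitaryCofibrations 𝕜 F') {P : CStarCat.{u} 𝕜}
    {inl : tens B A' ⟶ P} {inr : tens A B' ⟶ P} {ι : P ⟶ tens B B'}
    (sq : IsPushout (tensHom F (𝟙 A')) (tensHom (𝟙 A) F') inl inr)
    (hl : inl ≫ ι = tensHom (𝟙 B) F') (hr : inr ≫ ι = tensHom F (𝟙 B')) :
    unitaryCofibrations 𝕜 ι := by
  have el : ∀ p, ob ι (ob inl p) = tpair (tfst p) (ob F' (tsnd p)) := fun p => congr_ob hl p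
  have er : ∀ p, ob ι (ob inr p) = tpair (ob F (tfst p)) (tsnd p) := fun p => congr_ob hr p
  have glue : ∀ p q, ob ι (ob inl p) = ob ι (ob inr q) → ob inl p = ob inr q := by
    intro p q h
    rw [el, er] at h
    have h1 : tfst p = ob F (tfst q) := congrArg tfst h
    have h2 : ob F' (tsnd p) = tsnd q := congrArg tsnd h
    have e : ob inl (tpair (ob F (tfst q)) (tsnd p)) = ob inr (tpair (tfst q) (ob F' (tsnd p))) :=
      congr_ob sq.w (tpair (tfst q) (tsnd p))
    rw [← h1, h2] at e
    exact e
  have hl' : Function.Injective (ob (tensHom (𝟙 B) F')) :=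
    unitaryCofibrations_tensHom (fun _ _ h => h) hF'
  have hr' : Function.Injective (ob (tensHom F (𝟙 B'))) :=
    unitaryCofibrations_tensHom hF fun _ _ h => h
  intro p q h
  change ob ι p = ob ι q at h
  obtain ⟨p, rfl⟩ | ⟨p, rfl⟩ := exists_ob_eq_of_isPushout sq p <;>
    obtain ⟨q, rfl⟩ | ⟨q, rfl⟩ := exists_ob_eq_of_isPushout sq q
  · exact congrArg _ (hl' ((el p).symm.trans (h.trans (el q)) ))
  · exact glue p q h
  · exact (glue q p h.symm).symm
  · exact congrArg _ (hr' ((er p).symm.trans (h.trans (er q))))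

/-- If `F` is also a weak equivalence, then F ⊗ A' is a trivial cofibration, and so is its cobase
change `sq.inr`. As `sq.inr` followed by the pushout-product is the weak equivalence F ⊗ B',
two-out-of-three applies; the case of `F'` is symmetric. -/
theorem pushoutProductAxiom (𝕜 : Type) [RCLike 𝕜] :
    PushoutProductAxiom (C := CStarCat.{u} 𝕜) (unitaryCofibrations 𝕜)
      (unitaryEquivalences 𝕜) := by
  intro A B A' B' F F' sq hF hF'
  refine ⟨unitaryCofibrations_pushoutProduct hF hF' sq.isPushout sq.inl_ι sq.inr_ι, ?_⟩
  -- The model structure is used here for the stability of trivial cofibrations under cobase change.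
  let _ := unitaryModelCategory.{u} 𝕜
  rintro (h | h)
  · have h1 : trivialCofibrations (CStarCat.{u} 𝕜) (tensHom F (𝟙 A')) :=
      ⟨unitaryCofibrations_tensHom hF fun _ _ h => h, unitaryEquivalences_tensHom_id h A'⟩
    have h2 : unitaryEquivalences 𝕜 sq.inr :=
      (MorphismProperty.of_isPushout (P := trivialCofibrations (CStarCat.{u} 𝕜))
        sq.isPushout.flip h1).2
    refine MorphismProperty.of_precomp _ sq.inr sq.ι h2 ?_
    rw [sq.inr_ι]
    exact unitaryEquivalences_tensHom_id h B'
  · have h1 : trivialCofibrations (CStarCat.{u} 𝕜) (tensHom (𝟙 A) F') :=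
      ⟨unitaryCofibrations_tensHom (fun _ _ h => h) hF', unitaryEquivalences_id_tensHom h A⟩
    have h2 : unitaryEquivalences 𝕜 sq.inl :=
      (MorphismProperty.of_isPushout (P := trivialCofibrations (CStarCat.{u} 𝕜))
        sq.isPushout h1).2
    refine MorphismProperty.of_precomp _ sq.inl sq.ι h2 ?_
    rw [sq.inl_ι]
    exact unitaryEquivalences_id_tensHom h B

theorem isSymmetricMonoidalModelCategory (𝕜 : Type) [RCLike 𝕜] :
    letI := unitaryModelCategory.{u} 𝕜
    IsSymmetricMonoidalModelCategory (CStarCat.{u} 𝕜) :=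
  letI := unitaryModelCategory.{u} 𝕜
  { hasLimits := inferInstance
    hasColimits := inferInstance
    factorization₁ := ⟨⟨pathFactorization 𝕜⟩⟩
    factorization₂ := ⟨⟨cylinderFactorization 𝕜⟩⟩
    closed := ⟨inferInstance⟩
    pushoutProduct := pushoutProductAxiom 𝕜
    unit := fun _ X _ hq _ => ⟨⟨unitaryEquivalences_tensHom_id hq.mem X⟩,
      ⟨unitaryEquivalences_id_tensHom hq.mem X⟩⟩ }

end

end CStarCat

end

theorem proposition3p15 (𝕜 : Type) [RCLike 𝕜] :
    ∃ (_ : MonoidalCategory (CStarCat.{u} 𝕜)) (_ : SymmetricCategory (CStarCat.{u} 𝕜))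
      (_ : ModelCategory (CStarCat.{u} 𝕜)),
      Nonempty (MaxTensorStructure.{u} 𝕜) ∧
      weakEquivalences (CStarCat.{u} 𝕜) = CStarCat.unitaryEquivalences 𝕜 ∧
      cofibrations (CStarCat.{u} 𝕜) = CStarCat.unitaryCofibrations 𝕜 ∧
      fibrations (CStarCat.{u} 𝕜) = CStarCat.unitaryFibrations 𝕜 ∧
      PushoutProductAxiom (C := CStarCat.{u} 𝕜) (CStarCat.unitaryCofibrations 𝕜)
        (CStarCat.unitaryEquivalences 𝕜) ∧
      IsSymmetricMonoidalModelCategory (CStarCat.{u} 𝕜) :=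
  ⟨inferInstance, inferInstance, CStarCat.unitaryModelCategory 𝕜,
    ⟨CStarCat.maxTensorStructure 𝕜⟩, rfl, rfl, rfl, CStarCat.pushoutProductAxiom 𝕜,
    CStarCat.isSymmetricMonoidalModelCategory 𝕜⟩
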